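/- Let $N\ge 1$ be an integer, $\alpha>-1$ and $0<a\le A$ be real numbers. For a radial function $u(x)=g(|x|)$ on a ball of $\mathbb{R}^N$ centred at $0$, or on $\mathbb{R}^N$, the operator $|\nabla u|^{\alpha}\mathcal{M}_{a,A}(D^2u)$, where $\mathcal{M}_{a,A}(M)=A\,\mathrm{tr}(M^+)-a\,\mathrm{tr}(M^-)$, reads $$\tilde F(r,g',g'')=|g'|^{\alpha}\Big(m(g'')+\frac{N-1}{r}\,m(g')\Big),\qquad m(x)=A\max(x,0)-a\max(-x,0).$$ A regular radial solution of $\tilde F(r,u',u'')=-\mu|u|^{\alpha}u$ on $[0,R)$, $0<R\le\infty$, is a $C^1$ function $u$ on $[0,R)$ with $u'(0)=0$ which is $C^2$ around each point $r>0$ with $u'(r)\ne0$ and satisfies the equation there, and which satisfies $\mu|u|^\alpha u=0$ at each point around which it is constant. (For functions of this regularity this is the notion of a viscosity solution, in which points with vanishing gradient are not tested unless the function is locally constant.) For $s=+1$ and $s=-1$ there is exactly one regular radial solution $w^{\pm}$ on $[0,\infty)$, with $\mu=1$ and $w^\pm(0)=\pm1$, and its positive zeros form an infinite increasing sequence $\beta_1^\pm<\beta_2^\pm<\dots$.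 Put, for $k\ge1$, $$\mu_k^\pm=(\beta_k^\pm)^{\alpha+2},\qquad u_k^\pm(r)=w^\pm(\beta_k^\pm r)\quad(0\le r\le1).$$ A regular radial eigenfunction for $\mu\in\mathbb{R}$ in the unit ball is a continuous function $v\not\equiv0$ on $[0,1]$ with $v(1)=0$ which is a regular radial solution on $[0,1)$ for this $\mu$. Then, for every $k\ge1$ and each sign: 1. The $k$-th eigenfunction exists and is unique up to a positive multiplicative constant. That is, $u_k^\pm$ is a regular radial eigenfunction for $\mu_k^\pm$, it has exactly $k-1$ zeros in $(0,1)$, and $\pm u_k^\pm(0)>0$. Each regular radial eigenfunction $v$ for $\mu_k^\pm$ satisfies $v(0)\neq 0$, and if $\pm v(0)>0$ then $v=c\,u_k^\pm$ on $[0,1]$ for some $c>0$. Moreover, if $v$ is a regular radial eigenfunction for some $\mu\in\mathbb{R}$, with $\pm v(0)>0$ and exactly $k-1$ zeros in $(0,1)$, then $\mu=\mu_k^\pm$ and $v=c\,u_k^\pm$ on $[0,1]$ for some $c>0$. 2. The half-eigenvalues interlace: $\mu_k^-<\mu_{k+1}^+$ and $\mu_k^+<\mu_{k+1}^-$. -/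

import Mathlib

open Set Filter Topology

noncomputable section

/-- The scalar Pucci function `x ↦ A x⁺ - a x⁻`, so that `pucci a A q = Γ₁ q` with `Γ₁ = A` for
`q > 0` and `Γ₁ = a` for `q < 0`. -/
def pucci (a A x : ℝ) : ℝ := A * max x 0 - a * max (-x) 0

/-- The operator `|∇u|^α M_{a,A}(D²u)` in `ℝ^N` on a radial function `u(x) = g(|x|)`, at
`r = |x| > 0`, with `p = g'(r)` and `q = g''(r)`; the Hessian has the eigenvalue `q` once and
`p / r` with multiplicity `N - 1`. -/
def radialOp (N : ℕ) (α a A r p q : ℝ) : ℝ :=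
  |p| ^ α * (pucci a A q + ((N : ℝ) - 1) / r * pucci a A p)

/-- `u` is a regular radial solution of `|∇u|^α M_{a,A}(D²u) + μ |u|^α u = 0`, as a function of
`r = |x| ∈ I`, where `I` is `[0, ∞)` or `[0, R)`.

It is `C¹` (as a function of `x`, whence `u'(0) = 0`) and `C²` around each point with nonzero
derivative, where the equation holds classically. At a point where the gradient vanishes, the
definition of a viscosity solution for this singular operator only asks that `0` be equal to the
right-hand side `-μ |u|^α u` if `u` is constant around the point: a `C¹` function with zero
derivative is touched by no test function with nonzero gradient. -/
structure IsRadialSolution (N : ℕ) (α a A μ : ℝ) (I : Set ℝ) (u : ℝ → ℝ) : Prop where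
  contDiffOn : ContDiffOn ℝ 1 u I
  deriv_zero : derivWithin u I 0 = 0
  equation : ∀ r ∈ I, 0 < r → deriv u r ≠ 0 →
    ContDiffAt ℝ 2 u r ∧
      radialOp N α a A r (deriv u r) (deriv (deriv u) r) + μ * (|u r| ^ α * u r) = 0
  locally_const : ∀ r ∈ I, 0 < r → (∀ᶠ t in 𝓝 r, u t = u r) → μ * (|u r| ^ α * u r) = 0

/-- `w` is a global radial solution with `μ = 1`, `w(0) = s` and `w'(0) = 0`. -/
def IsProfile (N : ℕ) (α a A s : ℝ) (w : ℝ → ℝ) : Prop :=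
  IsRadialSolution N α a A 1 (Ici 0) w ∧ w 0 = s

/-- The function `w⁺` (for `s = 1`) or `w⁻` (for `s = -1`), as a function on `[0, ∞)`. -/
def profile (N : ℕ) (α a A s : ℝ) : ℝ → ℝ :=
  Classical.epsilon (IsProfile N α a A s)

/-- For `k ≥ 1` the `k`-th positive zero `β_k^±` of `w^±`; by convention `β_0^± = 0`. -/
def profileZero (N : ℕ) (α a A s : ℝ) : ℕ → ℝ
  | 0 => 0
  | k + 1 => sInf {r : ℝ | profileZero N α a A s k < r ∧ profile N α a A s r = 0}

/-- The half-eigenvalue `μ_k^± = (β_k^±)^(α + 2)`. -/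
def halfEigenvalue (N : ℕ) (α a A s : ℝ) (k : ℕ) : ℝ :=
  profileZero N α a A s k ^ (α + 2)

/-- The function `u_k^±(r) = w^±(β_k^± r)`. -/
def halfEigenfunction (N : ℕ) (α a A s : ℝ) (k : ℕ) (r : ℝ) : ℝ :=
  profile N α a A s (profileZero N α a A s k * r)

/-- `v` is a regular radial eigenfunction for the eigenvalue `μ` in the unit ball of `ℝ^N`, with
zero boundary values. -/
structure IsRadialEigenfunction (N : ℕ) (α a A μ : ℝ) (v : ℝ → ℝ) : Prop where
  solution : IsRadialSolution N α a A μ (Ico 0 1) v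
  continuousOn : ContinuousOn v (Icc 0 1)
  boundary : v 1 = 0
  nontrivial : ∃ r ∈ Ico (0 : ℝ) 1, v r ≠ 0

/-- The interior zeros of a radial function in the unit ball, as radii. -/
def interiorZeros (v : ℝ → ℝ) : Set ℝ := {r | r ∈ Ioo (0 : ℝ) 1 ∧ v r = 0}

end

/-! In terms of the momentum p = |u'|^α u', the equation with μ = 1 becomes the first order system
u' = `vel p`, p' = (α+1) `force r u p`, because the Pucci function is positively homogeneous and
invertible. The system is invariant under u ↦ cu for c > 0, and u ↦ -u only exchanges a and A.

For α ≠ 0 the system is not locally Lipschitz on both coordinate axes. Two projective charts repair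
this. Where u > 0, y = p/(|u|^α u) solves a Riccati equation that does not contain u and whose
superlinear term |y|^(1+γ), γ = 1/(α+1), is C¹. Where u' > 0, z = u/u' solves a companion equation
that is locally Lipschitz as well. A Gronwall estimate for the energy |u|^(α+2) + |u'|^(α+2)
excludes double zeros of nontrivial solutions (`eq_zero_right`, `eq_zero_left`), so up to sign one
chart is always available. This yields uniqueness (`IsSolOn.eqOn`) and local existence with a step
that is uniform away from the origin, hence global existence. At the origin the Riccati equation is
solved by a contraction, and uniqueness holds because the singular friction term is nonincreasing in
y.

A regular radial solution is not required to satisfy the equation where u' = 0. If u ≠ 0 there, p is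
monotone near that point and vanishes on no interval, so the system extends across the point
(`hasDerivAt_of_deriv_neg_off_zero`).

The profiles oscillate: for a solution positive near infinity, Y = -y would satisfy Y' ≥
c(1+|Y|^(1+γ)) and blow up. Their zeros are simple, hence isolated. By scaling and uniqueness, an
eigenfunction for μ = κ^(α+2) is a multiple of r ↦ w(κr); its boundary value makes κ a zero of w,
and the number of interior zeros tells which one. For μ ≤ 0 the momentum would be nondecreasing
wherever a positive solution decreases, so no boundary zero is reached. Interlacing is a Sturm
comparison of solutions of equal sign (`IsSolOn.sturm`): a positive multiple of one touches the
other, so they coincide by uniqueness. -/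

/-! ### Signed powers -/

/-- The odd power function `x ↦ |x| ^ β x`. -/
noncomputable def signedPow (β x : ℝ) : ℝ := |x| ^ β * x

section SignedPow

variable {β x y t : ℝ}

@[simp] theorem signedPow_zero : signedPow β 0 = 0 := by simp [signedPow]

@[simp] theorem signedPow_neg : signedPow β (-x) = -signedPow β x := by simp [signedPow]

theorem signedPow_of_pos (hx : 0 < x) : signedPow β x = x ^ (β + 1) := by
  rw [signedPow, abs_of_pos hx, Real.rpow_add_one hx.ne']

@[simp] theorem signedPow_one : signedPow β 1 = 1 := by simp [signedPow]

theorem signedPow_mul (t x : ℝ) : signedPow β (t * x) = signedPow β t * signedPow β x := by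
  simp only [signedPow, abs_mul, Real.mul_rpow (abs_nonneg t) (abs_nonneg x)]; ring

theorem signedPow_pos_iff : 0 < signedPow β x ↔ 0 < x := by
  rcases eq_or_ne x 0 with rfl | hx
  · simp
  · have : 0 < |x| ^ β := Real.rpow_pos_of_pos (abs_pos.2 hx) _
    rw [signedPow, mul_pos_iff_of_pos_left this]

theorem signedPow_neg_iff : signedPow β x < 0 ↔ x < 0 := by
  have := signedPow_pos_iff (β := β) (x := -x)
  simpa using this

theorem signedPow_eq_zero_iff : signedPow β x = 0 ↔ x = 0 := by
  rcases lt_trichotomy x 0 with h | h | h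
  · simp [h.ne, (signedPow_neg_iff (β := β).2 h).ne]
  · simp [h]
  · simp [h.ne', (signedPow_pos_iff (β := β).2 h).ne']

theorem signedPow_nonneg (hx : 0 ≤ x) : 0 ≤ signedPow β x := by
  unfold signedPow; positivity

theorem signedPow_nonpos (hx : x ≤ 0) : signedPow β x ≤ 0 :=
  mul_nonpos_of_nonneg_of_nonpos (by positivity) hx

theorem abs_signedPow (hβ : -1 < β) : |signedPow β x| = |x| ^ (β + 1) := by
  rcases eq_or_ne x 0 with rfl | hx
  · simp [Real.zero_rpow (show β + 1 ≠ 0 by linarith)]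
  · rw [signedPow, abs_mul, Real.rpow_add_one (abs_pos.2 hx).ne', abs_of_nonneg (a := |x| ^ β)
      (by positivity)]

theorem self_mul_signedPow (hβ : -1 < β) : x * signedPow β x = |x| ^ (β + 2) := by
  rcases eq_or_ne x 0 with rfl | hx
  · simp [Real.zero_rpow (show β + 2 ≠ 0 by linarith)]
  · rw [signedPow, Real.rpow_add (abs_pos.2 hx), Real.rpow_two, sq_abs]; ring

theorem abs_mul_signedPow (x : ℝ) : |x| * signedPow β x = signedPow (β + 1) x := by
  rcases eq_or_ne x 0 with rfl | hx
  · simp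
  · rw [signedPow, signedPow, Real.rpow_add_one (abs_pos.2 hx).ne']; ring

theorem hasDerivAt_signedPow (hx : x ≠ 0) :
    HasDerivAt (signedPow β) ((β + 1) * |x| ^ β) x := by
  have key : ∀ z : ℝ, 0 < z → HasDerivAt (signedPow β) ((β + 1) * |z| ^ β) z := by
    intro z hz
    have h := Real.hasDerivAt_rpow_const (x := z) (p := β + 1) (Or.inl hz.ne')
    rw [add_sub_cancel_right] at h
    rw [abs_of_pos hz]
    exact h.congr_of_eventuallyEq
      ((eventually_gt_nhds hz).mono fun w hw => signedPow_of_pos hw)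
  rcases lt_or_gt_of_ne hx with h | h
  · have h1 := (key (-x) (by linarith)).comp x (hasDerivAt_neg x)
    have h2 := h1.neg
    simp only [abs_neg, mul_neg, mul_one, neg_neg] at h2
    refine h2.congr_of_eventuallyEq (Eventually.of_forall fun w => ?_)
    simp
  · exact key x h

theorem continuous_signedPow (hβ : -1 < β) : Continuous (signedPow β) := by
  rw [continuous_iff_continuousAt]
  intro x
  rcases eq_or_ne x 0 with rfl | hx
  · rw [ContinuousAt, signedPow_zero, tendsto_zero_iff_abs_tendsto_zero]
    have : Tendsto (fun y : ℝ => |y| ^ (β + 1)) (𝓝 0) (𝓝 (|(0 : ℝ)| ^ (β + 1))) :=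
      (continuous_abs.continuousAt).rpow_const (Or.inr (by linarith))
    rw [abs_zero, Real.zero_rpow (by linarith)] at this
    exact this.congr fun y => (abs_signedPow hβ).symm
  · exact (hasDerivAt_signedPow hx).continuousAt

/-- The true degrees β + 1 and δ + 1 multiply under composition. This makes `mom` and `vel` inverse
to each other. -/
theorem signedPow_comp (β δ : ℝ) (x : ℝ) :
    signedPow δ (signedPow β x) = signedPow ((β + 1) * (δ + 1) - 1) x := by
  have key : ∀ z : ℝ, 0 < z →
      signedPow δ (signedPow β z) = signedPow ((β + 1) * (δ + 1) - 1) z := by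
    intro z hz
    rw [signedPow_of_pos (signedPow_pos_iff.2 hz), signedPow_of_pos hz, signedPow_of_pos hz,
      ← Real.rpow_mul hz.le]
    congr 1; ring
  rcases lt_trichotomy x 0 with h | rfl | h
  · have := key (-x) (by linarith)
    simpa using this
  · simp
  · exact key x h

theorem signedPow_zero_exponent (x : ℝ) : signedPow 0 x = x := by simp [signedPow]

theorem hasDerivAt_signedPow_of_pos (hβ : 0 < β) (x : ℝ) :
    HasDerivAt (signedPow β) ((β + 1) * |x| ^ β) x := by
  rcases eq_or_ne x 0 with rfl | hx
  · rw [abs_zero, Real.zero_rpow hβ.ne', mul_zero, hasDerivAt_iff_tendsto_slope_zero]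
    have : Tendsto (fun y : ℝ => |y| ^ β) (𝓝[≠] 0) (𝓝 (|(0 : ℝ)| ^ β)) :=
      ((continuous_abs.continuousAt).rpow_const (Or.inr hβ.le)).tendsto.mono_left
        nhdsWithin_le_nhds
    rw [abs_zero, Real.zero_rpow hβ.ne'] at this
    refine this.congr' ?_
    filter_upwards [self_mem_nhdsWithin] with y hy
    have hy : y ≠ 0 := hy
    simp only [signedPow, zero_add, mul_zero, sub_zero, smul_eq_mul]
    field_simp
  · exact hasDerivAt_signedPow hx

theorem abs_signedPow_sub_le (hβ : 0 < β) {M : ℝ} (hx : |x| ≤ M) (hy : |y| ≤ M) :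
    |signedPow β x - signedPow β y| ≤ (β + 1) * M ^ β * |x - y| := by
  have h := (convex_Icc (-M) M).norm_image_sub_le_of_norm_hasDerivWithin_le
    (f := signedPow β) (f' := fun z => (β + 1) * |z| ^ β) (C := (β + 1) * M ^ β)
    (fun z _ => (hasDerivAt_signedPow_of_pos hβ z).hasDerivWithinAt) ?_ (abs_le.1 hy)
    (abs_le.1 hx)
  · simpa using h
  · intro z hz
    rw [Real.norm_of_nonneg (by positivity)]
    gcongr
    exact abs_le.2 hz

theorem abs_abs_rpow_sub_le {e : ℝ} (he : 1 < e) {M : ℝ} (hx : |x| ≤ M) (hy : |y| ≤ M) :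
    |(|x| ^ e) - |y| ^ e| ≤ e * M ^ (e - 1) * |x - y| := by
  have hM : 0 ≤ M := (abs_nonneg x).trans hx
  have h := (convex_Icc (-M) M).norm_image_sub_le_of_norm_hasDerivWithin_le
    (f := fun z : ℝ => |z| ^ e) (f' := fun z => e * |z| ^ (e - 2) * z) (C := e * M ^ (e - 1))
    (fun z _ => (hasDerivAt_abs_rpow z he).hasDerivWithinAt) ?_ (abs_le.1 hy)
    (abs_le.1 hx)
  · simpa using h
  · intro z hz
    have : e * |z| ^ (e - 2) * z = e * signedPow (e - 2) z := by rw [signedPow]; ring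
    rw [this, Real.norm_eq_abs, abs_mul, abs_signedPow (by linarith), abs_of_pos (by linarith)]
    rw [show e - 2 + 1 = e - 1 by ring]
    have : |z| ≤ M := abs_le.2 hz
    gcongr

end SignedPow

/-! ### The scalar Pucci function -/

section Pucci

variable {a A x y t : ℝ}

theorem pucci_of_nonneg (hx : 0 ≤ x) : pucci a A x = A * x := by
  simp [pucci, max_eq_left hx, max_eq_right (neg_nonpos.2 hx)]

theorem pucci_of_nonpos (hx : x ≤ 0) : pucci a A x = a * x := by
  simp [pucci, max_eq_right hx, max_eq_left (neg_nonneg.2 hx)]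

@[simp] theorem pucci_zero : pucci a A 0 = 0 := by simp [pucci]

/-- Reflection exchanges the two slopes, so negative solutions are treated as positive solutions for
the parameters `swap`. -/
theorem pucci_neg : pucci a A (-x) = -pucci A a x := by simp [pucci]

theorem pucci_mul_of_nonneg (ht : 0 ≤ t) : pucci a A (t * x) = t * pucci a A x := by
  rcases le_total 0 x with h | h
  · rw [pucci_of_nonneg h, pucci_of_nonneg (mul_nonneg ht h)]; ring
  · rw [pucci_of_nonpos h, pucci_of_nonpos (mul_nonpos_of_nonneg_of_nonpos ht h)]; ring

theorem strictMono_pucci (ha : 0 < a) (hA : 0 < A) : StrictMono (pucci a A) := by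
  intro x y hxy
  rcases le_total 0 x with h | h
  · rw [pucci_of_nonneg h, pucci_of_nonneg (h.trans hxy.le)]
    gcongr
  · rcases le_total 0 y with h' | h'
    · rw [pucci_of_nonpos h, pucci_of_nonneg h']
      rcases h.lt_or_eq with h | rfl
      · nlinarith
      · nlinarith
    · rw [pucci_of_nonpos h, pucci_of_nonpos h']
      gcongr

theorem pucci_neg_iff (ha : 0 < a) (hA : 0 < A) : pucci a A x < 0 ↔ x < 0 := by
  simpa using (strictMono_pucci ha hA).lt_iff_lt (a := x) (b := 0)

theorem pucci_nonneg (ha : 0 < a) (hA : 0 < A) (hx : 0 ≤ x) : 0 ≤ pucci a A x := by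
  simpa using (strictMono_pucci ha hA).monotone hx

theorem pucci_nonpos (ha : 0 < a) (hA : 0 < A) (hx : x ≤ 0) : pucci a A x ≤ 0 := by
  simpa using (strictMono_pucci ha hA).monotone hx

/-- Each half line is mapped linearly onto itself, so inversion takes reciprocal slopes. This solves
the equation for the second derivative. -/
theorem pucci_inv_pucci (ha : 0 < a) (hA : 0 < A) : pucci a⁻¹ A⁻¹ (pucci a A x) = x := by
  rcases le_total 0 x with h | h
  · rw [pucci_of_nonneg (pucci_nonneg ha hA h), pucci_of_nonneg h, inv_mul_cancel_left₀ hA.ne']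
  · rw [pucci_of_nonpos (pucci_nonpos ha hA h), pucci_of_nonpos h, inv_mul_cancel_left₀ ha.ne']

theorem pucci_pucci_inv (ha : 0 < a) (hA : 0 < A) : pucci a A (pucci a⁻¹ A⁻¹ x) = x := by
  simpa using pucci_inv_pucci (x := x) (inv_pos.2 ha) (inv_pos.2 hA)

theorem abs_pucci_sub_le (ha : 0 < a) (hA : 0 < A) (x y : ℝ) :
    |pucci a A x - pucci a A y| ≤ (a + A) * |x - y| := by
  have h1 : pucci a A x - pucci a A y
      = A * (max x 0 - max y 0) - a * (max (-x) 0 - max (-y) 0) := by simp only [pucci]; ring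
  have h2 := abs_max_sub_max_le_abs x y 0
  have h3 := abs_max_sub_max_le_abs (-x) (-y) 0
  rw [show -x - -y = -(x - y) by ring, abs_neg] at h3
  rw [h1]
  calc _ ≤ |A * (max x 0 - max y 0)| + |a * (max (-x) 0 - max (-y) 0)| := abs_sub _ _
    _ = A * |max x 0 - max y 0| + a * |max (-x) 0 - max (-y) 0| := by
      rw [abs_mul, abs_mul, abs_of_pos ha, abs_of_pos hA]
    _ ≤ A * |x - y| + a * |x - y| := by gcongr
    _ = _ := by ring

theorem abs_pucci_le (ha : 0 < a) (hA : 0 < A) (x : ℝ) : |pucci a A x| ≤ (a + A) * |x| := by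
  simpa using abs_pucci_sub_le ha hA x 0

theorem continuous_pucci : Continuous (pucci a A) := by
  unfold pucci; fun_prop

end Pucci

/-! ### Gronwall inequalities starting from a limit value -/

/-- The product D(s) exp(-Cs) is nonincreasing. Only a one-sided limit at c enters, so c may be the
singular point 0 or a point where D is not differentiable. -/
theorem nonpos_of_deriv_le_mul_right {D D' : ℝ → ℝ} {C c d : ℝ}
    (hD : ∀ t ∈ Ioo c d, HasDerivAt D (D' t) t) (hle : ∀ t ∈ Ioo c d, D' t ≤ C * D t)
    (hlim : Tendsto D (𝓝[>] c) (𝓝 0)) : ∀ t ∈ Ioo c d, D t ≤ 0 := by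
  intro t ht
  have hder : ∀ s ∈ Ioo c d, HasDerivAt (fun s => D s * Real.exp (-C * s))
      ((D' s - C * D s) * Real.exp (-C * s)) s := by
    intro s hs
    have h1 : HasDerivAt (fun s => Real.exp (-C * s)) (Real.exp (-C * s) * (-C * 1)) s :=
      ((hasDerivAt_id s).const_mul (-C)).exp
    exact ((hD s hs).mul h1).congr_deriv (by ring)
  have hanti : AntitoneOn (fun s => D s * Real.exp (-C * s)) (Ioo c d) := by
    refine antitoneOn_of_deriv_nonpos (convex_Ioo c d)
      (fun s hs => (hder s hs).continuousAt.continuousWithinAt) ?_ ?_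
    · rw [interior_Ioo]
      exact fun s hs => (hder s hs).differentiableAt.differentiableWithinAt
    · rw [interior_Ioo]
      intro s hs
      rw [(hder s hs).deriv]
      exact mul_nonpos_of_nonpos_of_nonneg (by linarith [hle s hs]) (Real.exp_pos _).le
  have hlim' : Tendsto (fun s => D s * Real.exp (-C * s)) (𝓝[>] c) (𝓝 (0 * Real.exp (-C * c))) := by
    refine hlim.mul (Tendsto.mono_left ?_ nhdsWithin_le_nhds)
    exact Continuous.tendsto (by fun_prop) c
  rw [zero_mul] at hlim'
  have : D t * Real.exp (-C * t) ≤ 0 := by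
    refine ge_of_tendsto hlim' ?_
    filter_upwards [Ioo_mem_nhdsGT ht.1] with s hs
    exact hanti ⟨hs.1, hs.2.trans ht.2⟩ ht hs.2.le
  exact nonpos_of_mul_nonpos_left this (Real.exp_pos _)

theorem nonpos_of_deriv_ge_mul_left {D D' : ℝ → ℝ} {C c d : ℝ}
    (hD : ∀ t ∈ Ioo c d, HasDerivAt D (D' t) t) (hle : ∀ t ∈ Ioo c d, -(C * D t) ≤ D' t)
    (hlim : Tendsto D (𝓝[<] d) (𝓝 0)) : ∀ t ∈ Ioo c d, D t ≤ 0 := by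
  intro t ht
  have h := nonpos_of_deriv_le_mul_right (D := fun s => D (-s)) (D' := fun s => -D' (-s)) (C := C)
    (c := -d) (d := -c) ?_ ?_ ?_ (-t) ⟨by linarith [ht.2], by linarith [ht.1]⟩
  · simpa using h
  · intro s hs
    exact ((hD (-s) ⟨by linarith [hs.2], by linarith [hs.1]⟩).comp s (hasDerivAt_neg s)).congr_deriv
      (by simp)
  · intro s hs
    have := hle (-s) ⟨by linarith [hs.2], by linarith [hs.1]⟩
    linarith
  · refine hlim.comp ?_
    have := tendsto_neg_nhdsGT_neg (a := d)
    exact this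

/-! ### The radial system -/

/-- Parameters of the radial equation, with `ν = N - 1`; no order between `a` and `A` is
assumed, so that the reflection `u ↦ -u` acts. -/
structure RadialParams where
  ν : ℝ
  α : ℝ
  a : ℝ
  A : ℝ
  ν_nonneg : 0 ≤ ν
  neg_one_lt_α : -1 < α
  a_pos : 0 < a
  A_pos : 0 < A

namespace RadialParams

variable (P : RadialParams)

/-- The parameters of the equation satisfied by `-u`. -/
def swap : RadialParams where
  ν := P.ν
  α := P.α
  a := P.A
  A := P.a
  ν_nonneg := P.ν_nonneg
  neg_one_lt_α := P.neg_one_lt_α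
  a_pos := P.A_pos
  A_pos := P.a_pos

/-- The exponent `1 / (α + 1)`. -/
noncomputable def γ : ℝ := 1 / (P.α + 1)

/-- The momentum `p = |u'| ^ α u'` of a velocity `u'`. -/
noncomputable def mom (x : ℝ) : ℝ := signedPow P.α x

/-- The velocity `u'` with momentum `p`. -/
noncomputable def vel (p : ℝ) : ℝ := signedPow (P.γ - 1) p

/-- The right-hand side of the equation for `p' / (α + 1)`, where `p = |u'| ^ α u'`. -/
noncomputable def force (r u p : ℝ) : ℝ :=
  pucci P.a⁻¹ P.A⁻¹ (-P.mom u - P.ν / r * pucci P.a P.A p)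

/-- `(u, p)` solves the first order system on `J`. -/
def IsSolOn (J : Set ℝ) (u p : ℝ → ℝ) : Prop :=
  ∀ r ∈ J, HasDerivAt u (P.vel (p r)) r ∧ HasDerivAt p ((P.α + 1) * P.force r (u r) (p r)) r

theorem α_add_one_pos : 0 < P.α + 1 := by linarith [P.neg_one_lt_α]

theorem γ_pos : 0 < P.γ := one_div_pos.2 P.α_add_one_pos

theorem γ_mul : P.γ * (P.α + 1) = 1 := one_div_mul_cancel P.α_add_one_pos.ne'

theorem vel_mom (x : ℝ) : P.vel (P.mom x) = x := by
  rw [vel, mom, signedPow_comp]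
  rw [show (P.α + 1) * (P.γ - 1 + 1) - 1 = P.γ * (P.α + 1) - 1 by ring, γ_mul, sub_self,
    signedPow_zero_exponent]

theorem mom_vel (x : ℝ) : P.mom (P.vel x) = x := by
  rw [vel, mom, signedPow_comp]
  rw [show (P.γ - 1 + 1) * (P.α + 1) - 1 = P.γ * (P.α + 1) - 1 by ring, γ_mul, sub_self,
    signedPow_zero_exponent]

theorem continuous_mom : Continuous P.mom := continuous_signedPow P.neg_one_lt_α

theorem continuous_vel : Continuous P.vel := continuous_signedPow (by linarith [P.γ_pos])

@[simp] theorem mom_zero : P.mom 0 = 0 := signedPow_zero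
@[simp] theorem vel_zero : P.vel 0 = 0 := signedPow_zero
@[simp] theorem mom_one : P.mom 1 = 1 := signedPow_one
@[simp] theorem mom_neg (x : ℝ) : P.mom (-x) = -P.mom x := signedPow_neg
@[simp] theorem vel_neg (x : ℝ) : P.vel (-x) = -P.vel x := signedPow_neg
theorem mom_mul (x y : ℝ) : P.mom (x * y) = P.mom x * P.mom y := signedPow_mul x y
theorem vel_mul (x y : ℝ) : P.vel (x * y) = P.vel x * P.vel y := signedPow_mul x y
theorem mom_pos_iff {x : ℝ} : 0 < P.mom x ↔ 0 < x := signedPow_pos_iff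
theorem vel_pos_iff {x : ℝ} : 0 < P.vel x ↔ 0 < x := signedPow_pos_iff
theorem mom_neg_iff {x : ℝ} : P.mom x < 0 ↔ x < 0 := signedPow_neg_iff
theorem vel_neg_iff {x : ℝ} : P.vel x < 0 ↔ x < 0 := signedPow_neg_iff
theorem mom_eq_zero_iff {x : ℝ} : P.mom x = 0 ↔ x = 0 := signedPow_eq_zero_iff
theorem vel_eq_zero_iff {x : ℝ} : P.vel x = 0 ↔ x = 0 := signedPow_eq_zero_iff

@[simp] theorem swap_mom : P.swap.mom = P.mom := rfl
@[simp] theorem swap_vel : P.swap.vel = P.vel := rfl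
@[simp] theorem swap_α : P.swap.α = P.α := rfl

theorem mul_vel (p : ℝ) : p * P.vel p = |p| ^ (1 + P.γ) := by
  rw [vel, self_mul_signedPow (by linarith [P.γ_pos])]; congr 1; ring

theorem swap_force (r u p : ℝ) : P.swap.force r (-u) (-p) = -P.force r u p := by
  rw [force, force, ← pucci_neg]
  congr 1
  simp only [swap, mom_neg, pucci_neg]
  simp only [mom]; ring

/-- The source of the scaling invariance (u, p) ↦ (tu, `mom t` p). The sign of t matters, since the
Pucci function is only positively homogeneous. -/
theorem force_mul {t : ℝ} (ht : 0 ≤ t) (r u p : ℝ) :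
    P.force r (t * u) (P.mom t * p) = P.mom t * P.force r u p := by
  have h : 0 ≤ P.mom t := signedPow_nonneg ht
  rw [force, force, mom_mul, pucci_mul_of_nonneg (x := p) h, 
    ← pucci_mul_of_nonneg (x := -P.mom u - _) h]
  congr 1; ring

variable {P} {J : Set ℝ} {u p : ℝ → ℝ}

theorem IsSolOn.mono {J' : Set ℝ} (h : P.IsSolOn J u p) (hJ : J' ⊆ J) : P.IsSolOn J' u p :=
  fun r hr => h r (hJ hr)

theorem IsSolOn.neg (h : P.IsSolOn J u p) : P.swap.IsSolOn J (fun r => -u r) (fun r => -p r) := by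
  intro r hr
  refine ⟨(h r hr).1.neg.congr_deriv (by simp), (h r hr).2.neg.congr_deriv ?_⟩
  rw [swap_force]; simp

theorem IsSolOn.smul (h : P.IsSolOn J u p) {t : ℝ} (ht : 0 ≤ t) :
    P.IsSolOn J (fun r => t * u r) (fun r => P.mom t * p r) := by
  intro r hr
  constructor
  · exact ((h r hr).1.const_mul t).congr_deriv (by rw [vel_mul, vel_mom])
  · exact ((h r hr).2.const_mul (P.mom t)).congr_deriv (by rw [force_mul P ht]; ring)

theorem IsSolOn.continuousAt_fst (h : P.IsSolOn J u p) {r : ℝ} (hr : r ∈ J) : ContinuousAt u r :=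
  (h r hr).1.continuousAt

theorem IsSolOn.continuousAt_snd (h : P.IsSolOn J u p) {r : ℝ} (hr : r ∈ J) : ContinuousAt p r :=
  (h r hr).2.continuousAt

/-! ### The energy and the absence of double zeros -/

variable (P)

/-- The energy `|u| ^ (α + 2) + |u'| ^ (α + 2)`, where `|u'| ^ (α + 2) = |p| ^ (1 + γ)`. -/
noncomputable def energy (u p : ℝ) : ℝ := |u| ^ (P.α + 2) + |p| ^ (1 + P.γ)

theorem energy_nonneg (u p : ℝ) : 0 ≤ P.energy u p := by unfold energy; positivity

theorem energy_eq_zero_iff {u p : ℝ} : P.energy u p = 0 ↔ u = 0 ∧ p = 0 := by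
  have h1 : P.α + 2 ≠ 0 := by linarith [P.neg_one_lt_α]
  have h2 : 1 + P.γ ≠ 0 := by linarith [P.γ_pos]
  rw [energy, add_eq_zero_iff_of_nonneg (by positivity) (by positivity),
    Real.rpow_eq_zero (abs_nonneg u) h1, Real.rpow_eq_zero (abs_nonneg p) h2, abs_eq_zero,
    abs_eq_zero]

theorem continuous_energy : Continuous fun x : ℝ × ℝ => P.energy x.1 x.2 := by
  have h1 : 0 ≤ P.α + 2 := by linarith [P.neg_one_lt_α]
  have h2 : 0 ≤ 1 + P.γ := by linarith [P.γ_pos]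
  unfold energy
  exact ((continuous_abs.comp continuous_fst).rpow_const fun _ => Or.inr h1).add
    ((continuous_abs.comp continuous_snd).rpow_const fun _ => Or.inr h2)

theorem abs_vel_rpow (p : ℝ) : |P.vel p| ^ (P.α + 2) = |p| ^ (1 + P.γ) := by
  rw [vel, abs_signedPow (by linarith [P.γ_pos]), ← Real.rpow_mul (abs_nonneg p)]
  congr 1
  linear_combination P.γ_mul

/-- The product is |u'| |u|^(α+1), of total degree α + 2; replacing the smaller of |u| and |u'| by
the larger leaves one term of the energy. -/
theorem abs_vel_mul_abs_mom_le (u p : ℝ) : |P.vel p| * |P.mom u| ≤ P.energy u p := by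
  rw [mom, abs_signedPow P.neg_one_lt_α, energy, ← abs_vel_rpow]
  have e : ∀ x : ℝ, |x| ^ (P.α + 2) = |x| * |x| ^ (P.α + 1) := by
    intro x
    rw [show P.α + 2 = 1 + (P.α + 1) by ring, Real.rpow_add' (abs_nonneg x)
      (by linarith [P.neg_one_lt_α]), Real.rpow_one]
  have hα := P.α_add_one_pos.le
  rcases le_total |P.vel p| |u| with h | h
  · calc |P.vel p| * |u| ^ (P.α + 1) ≤ |u| * |u| ^ (P.α + 1) := by gcongr
      _ ≤ _ := by rw [← e]; linarith [Real.rpow_nonneg (abs_nonneg (P.vel p)) (P.α + 2)]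
  · calc |P.vel p| * |u| ^ (P.α + 1) ≤ |P.vel p| * |P.vel p| ^ (P.α + 1) := by gcongr
      _ ≤ _ := by rw [← e]; linarith [Real.rpow_nonneg (abs_nonneg u) (P.α + 2)]

theorem hasDerivAt_energy {u p : ℝ → ℝ} {r : ℝ} (hu : HasDerivAt u (P.vel (p r)) r)
    (hp : HasDerivAt p ((P.α + 1) * P.force r (u r) (p r)) r) :
    HasDerivAt (fun r => P.energy (u r) (p r))
      ((P.α + 2) * (P.vel (p r) * P.mom (u r) + P.vel (p r) * P.force r (u r) (p r))) r := by
  have h1 := (hasDerivAt_abs_rpow (u r) (p := P.α + 2) (by linarith [P.neg_one_lt_α])).comp r hu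
  have h2 := (hasDerivAt_abs_rpow (p r) (p := 1 + P.γ) (by linarith [P.γ_pos])).comp r hp
  refine (h1.add h2).congr_deriv ?_
  rw [show P.α + 2 - 2 = P.α by ring, show 1 + P.γ - 2 = P.γ - 1 by ring]
  have e1 : |u r| ^ P.α * u r = P.mom (u r) := rfl
  have e2 : |p r| ^ (P.γ - 1) * p r = P.vel (p r) := rfl
  have e3 : (1 + P.γ) * (P.α + 1) = P.α + 2 := by linear_combination P.γ_mul
  rw [mul_assoc (P.α + 2) _ (u r), e1, mul_assoc (1 + P.γ) _ (p r), e2]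
  linear_combination (P.vel (p r) * P.force r (u r) (p r)) * e3

/-- Friction dissipates energy: its contribution has the sign opposite to `vel p` and is dropped by
monotonicity of the Pucci function. The constant is therefore independent of r, and forward
estimates may start at the origin. -/
theorem vel_mul_force_le {r : ℝ} (hr : 0 < r) (u p : ℝ) :
    P.vel p * P.force r u p ≤ (P.a⁻¹ + P.A⁻¹) * P.energy u p := by
  have ha := inv_pos.2 P.a_pos
  have hA := inv_pos.2 P.A_pos
  have h1 : P.vel p * P.force r u p ≤ P.vel p * pucci P.a⁻¹ P.A⁻¹ (-P.mom u) := by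
    have hν : 0 ≤ P.ν / r := div_nonneg P.ν_nonneg hr.le
    rcases le_total 0 p with h | h
    · refine mul_le_mul_of_nonneg_left ?_ (signedPow_nonneg h)
      refine (strictMono_pucci ha hA).monotone ?_
      linarith [mul_nonneg hν (pucci_nonneg P.a_pos P.A_pos h)]
    · refine mul_le_mul_of_nonpos_left ?_ (signedPow_nonpos h)
      refine (strictMono_pucci ha hA).monotone ?_
      linarith [mul_nonpos_of_nonneg_of_nonpos hν (pucci_nonpos P.a_pos P.A_pos h)]
  have h2 := abs_pucci_le ha hA (-P.mom u)
  have h3 := P.abs_vel_mul_abs_mom_le u p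
  calc _ ≤ _ := h1
    _ ≤ |P.vel p * pucci P.a⁻¹ P.A⁻¹ (-P.mom u)| := le_abs_self _
    _ = |P.vel p| * |pucci P.a⁻¹ P.A⁻¹ (-P.mom u)| := abs_mul _ _
    _ ≤ |P.vel p| * ((P.a⁻¹ + P.A⁻¹) * |-P.mom u|) := by gcongr
    _ = (P.a⁻¹ + P.A⁻¹) * (|P.vel p| * |P.mom u|) := by rw [abs_neg]; ring
    _ ≤ _ := by gcongr

/-- Backwards in r, friction creates energy and has to be estimated, which costs the factor 1/c. -/
theorem abs_vel_mul_force_le {r c : ℝ} (hc : 0 < c) (hr : c ≤ r) (u p : ℝ) :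
    |P.vel p * P.force r u p|
      ≤ (P.a⁻¹ + P.A⁻¹) * (1 + P.ν / c * (P.a + P.A)) * P.energy u p := by
  have ha := inv_pos.2 P.a_pos
  have hA := inv_pos.2 P.A_pos
  have hν := P.ν_nonneg
  have haA : 0 < P.a + P.A := add_pos P.a_pos P.A_pos
  have h3 := P.abs_vel_mul_abs_mom_le u p
  have h4 : |P.vel p| * |p| ≤ P.energy u p := by
    rw [← abs_mul, mul_comm, mul_vel, abs_of_nonneg (by positivity), energy]
    linarith [Real.rpow_nonneg (abs_nonneg u) (P.α + 2)]
  have h5 : |-P.mom u - P.ν / r * pucci P.a P.A p|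
      ≤ |P.mom u| + P.ν / c * (P.a + P.A) * |p| := by
    calc _ ≤ |-P.mom u| + |P.ν / r * pucci P.a P.A p| := abs_sub _ _
      _ = |P.mom u| + P.ν / r * |pucci P.a P.A p| := by
        rw [abs_neg, abs_mul, abs_of_nonneg (div_nonneg hν (hc.le.trans hr))]
      _ ≤ |P.mom u| + P.ν / c * ((P.a + P.A) * |p|) := by
        gcongr; exact abs_pucci_le P.a_pos P.A_pos p
      _ = _ := by ring
  rw [abs_mul, force]
  calc _ ≤ |P.vel p| * ((P.a⁻¹ + P.A⁻¹) * |-P.mom u - P.ν / r * pucci P.a P.A p|) := by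
        gcongr; exact abs_pucci_le ha hA _
    _ ≤ |P.vel p| * ((P.a⁻¹ + P.A⁻¹) * (|P.mom u| + P.ν / c * (P.a + P.A) * |p|)) := by gcongr
    _ = (P.a⁻¹ + P.A⁻¹) * (|P.vel p| * |P.mom u| + P.ν / c * (P.a + P.A) * (|P.vel p| * |p|)) := by
      ring
    _ ≤ (P.a⁻¹ + P.A⁻¹) * (P.energy u p + P.ν / c * (P.a + P.A) * P.energy u p) := by gcongr
    _ = _ := by ring

/-- The system holds on `J` away from the double zeros. -/
def IsSolOffZero (J : Set ℝ) (u p : ℝ → ℝ) : Prop :=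
  ∀ r ∈ J, (u r ≠ 0 ∨ p r ≠ 0) →
    HasDerivAt u (P.vel (p r)) r ∧ HasDerivAt p ((P.α + 1) * P.force r (u r) (p r)) r

variable {P}

theorem IsSolOn.isSolOffZero (h : P.IsSolOn J u p) : P.IsSolOffZero J u p := fun r hr _ => h r hr

/-- Forward Gronwall for the energy. The case c = 0 is allowed and shows that solutions with u(0) =
0 vanish. -/
theorem IsSolOffZero.eq_zero_right {c d : ℝ} (hc : 0 ≤ c) (hu : ContinuousOn u (Ico c d))
    (hp : ContinuousOn p (Ico c d)) (h : P.IsSolOffZero (Ioo c d) u p) (hu0 : u c = 0)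
    (hp0 : p c = 0) : ∀ r ∈ Ico c d, u r = 0 ∧ p r = 0 := by
  intro r hr
  by_contra hne
  have hE : ContinuousOn (fun t => P.energy (u t) (p t)) (Icc c r) :=
    P.continuous_energy.comp_continuousOn ((hu.mono (Icc_subset_Ico_right hr.2)).prodMk
      (hp.mono (Icc_subset_Ico_right hr.2)))
  -- The system is known only off the double zeros, so Gronwall is applied between the last of them,
  -- b, and r.
  set S := {t ∈ Icc c r | P.energy (u t) (p t) = 0} with hS
  have hScl : IsClosed S := hE.preimage_isClosed_of_isClosed isClosed_Icc isClosed_singleton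
  have hcS : c ∈ S := ⟨left_mem_Icc.2 hr.1, by rw [P.energy_eq_zero_iff]; exact ⟨hu0, hp0⟩⟩
  have hSb : BddAbove S := ⟨r, fun t ht => ht.1.2⟩
  have hmem : sSup S ∈ S := hScl.csSup_mem ⟨c, hcS⟩ hSb
  set b := sSup S
  have hbr : b < r := by
    refine lt_of_le_of_ne hmem.1.2 fun hb => hne ?_
    rw [← P.energy_eq_zero_iff, ← hb]; exact hmem.2
  have hbd : Ioo b r ⊆ Ioo c d := fun t ht => ⟨hmem.1.1.trans_lt ht.1, ht.2.trans hr.2⟩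
  have hpos : ∀ t ∈ Ioc b r, P.energy (u t) (p t) ≠ 0 := by
    intro t ht h0
    exact absurd (le_csSup hSb ⟨⟨hmem.1.1.trans ht.1.le, ht.2⟩, h0⟩) (not_le.2 ht.1)
  have key := nonpos_of_deriv_le_mul_right (D := fun t => P.energy (u t) (p t)) (c := b) (d := r)
    (D' := fun t => (P.α + 2) * (P.vel (p t) * P.mom (u t) +
      P.vel (p t) * P.force t (u t) (p t)))
    (C := (P.α + 2) * (1 + (P.a⁻¹ + P.A⁻¹))) ?_ ?_ ?_
  · have hclos : ContinuousWithinAt (fun t => P.energy (u t) (p t)) (Ioo b r) r :=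
      (hE r ⟨hr.1, le_rfl⟩).mono fun t ht => ⟨hmem.1.1.trans ht.1.le, ht.2.le⟩
    have hle : P.energy (u r) (p r) ≤ 0 := by
      have : (𝓝[Ioo b r] r).NeBot := by
        rw [nhdsWithin_Ioo_eq_nhdsLT hbr]; infer_instance
      refine le_of_tendsto hclos ?_
      filter_upwards [self_mem_nhdsWithin] with t ht using key t ht
    exact hpos r ⟨hbr, le_rfl⟩ (le_antisymm hle (P.energy_nonneg _ _))
  · intro t ht
    have hnz : u t ≠ 0 ∨ p t ≠ 0 := by
      by_contra! h0
      exact hpos t ⟨ht.1, ht.2.le⟩ (P.energy_eq_zero_iff.2 h0)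
    obtain ⟨h1, h2⟩ := h t (hbd ht) hnz
    exact P.hasDerivAt_energy h1 h2
  · intro t ht
    have h1 := P.vel_mul_force_le (hc.trans_lt (hbd ht).1) (u t) (p t)
    have h2 := P.abs_vel_mul_abs_mom_le (u t) (p t)
    have h3 : P.vel (p t) * P.mom (u t) ≤ P.energy (u t) (p t) := by
      rw [← abs_mul] at h2; exact (le_abs_self _).trans h2
    have h4 : 0 ≤ P.α + 2 := by linarith [P.neg_one_lt_α]
    rw [mul_assoc]
    refine mul_le_mul_of_nonneg_left ?_ h4
    linarith
  · have : Tendsto (fun t => P.energy (u t) (p t)) (𝓝[>] b) (𝓝 (P.energy (u b) (p b))) := by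
      have := (hE b hmem.1).mono (s := Ioo b r) fun t ht => ⟨hmem.1.1.trans ht.1.le, ht.2.le⟩
      rw [ContinuousWithinAt, nhdsWithin_Ioo_eq_nhdsGT hbr] at this
      exact this
    rwa [hmem.2] at this

/-- Backward Gronwall from d; the friction bound requires c > 0. -/
theorem IsSolOffZero.eq_zero_left {c d : ℝ} (hc : 0 < c) (hu : ContinuousOn u (Ioc c d))
    (hp : ContinuousOn p (Ioc c d)) (h : P.IsSolOffZero (Ioo c d) u p) (hu0 : u d = 0)
    (hp0 : p d = 0) : ∀ r ∈ Ioc c d, u r = 0 ∧ p r = 0 := by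
  intro r hr
  by_contra hne
  have hsub : Icc r d ⊆ Ioc c d := fun t ht => ⟨hr.1.trans_le ht.1, ht.2⟩
  have hE : ContinuousOn (fun t => P.energy (u t) (p t)) (Icc r d) :=
    P.continuous_energy.comp_continuousOn ((hu.mono hsub).prodMk (hp.mono hsub))
  set S := {t ∈ Icc r d | P.energy (u t) (p t) = 0} with hS
  have hScl : IsClosed S := hE.preimage_isClosed_of_isClosed isClosed_Icc isClosed_singleton
  have hdS : d ∈ S := ⟨right_mem_Icc.2 hr.2, by rw [P.energy_eq_zero_iff]; exact ⟨hu0, hp0⟩⟩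
  have hSb : BddBelow S := ⟨r, fun t ht => ht.1.1⟩
  have hmem : sInf S ∈ S := hScl.csInf_mem ⟨d, hdS⟩ hSb
  set b := sInf S
  have hbr : r < b := by
    refine lt_of_le_of_ne hmem.1.1 fun hb => hne ?_
    rw [← P.energy_eq_zero_iff, hb]; exact hmem.2
  have hbd : Ioo r b ⊆ Ioo c d := fun t ht => ⟨hr.1.trans ht.1, ht.2.trans_le hmem.1.2⟩
  have hpos : ∀ t ∈ Ico r b, P.energy (u t) (p t) ≠ 0 := by
    intro t ht h0
    exact absurd (csInf_le hSb ⟨⟨ht.1, ht.2.le.trans hmem.1.2⟩, h0⟩) (not_le.2 ht.2)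
  have key := nonpos_of_deriv_ge_mul_left (D := fun t => P.energy (u t) (p t)) (c := r) (d := b)
    (D' := fun t => (P.α + 2) * (P.vel (p t) * P.mom (u t) +
      P.vel (p t) * P.force t (u t) (p t)))
    (C := (P.α + 2) * (1 + (P.a⁻¹ + P.A⁻¹) * (1 + P.ν / r * (P.a + P.A)))) ?_ ?_ ?_
  · have hclos : ContinuousWithinAt (fun t => P.energy (u t) (p t)) (Ioo r b) r :=
      (hE r ⟨le_rfl, hr.2⟩).mono fun t ht => ⟨ht.1.le, ht.2.le.trans hmem.1.2⟩
    have hle : P.energy (u r) (p r) ≤ 0 := by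
      have : (𝓝[Ioo r b] r).NeBot := by
        rw [nhdsWithin_Ioo_eq_nhdsGT hbr]; infer_instance
      refine le_of_tendsto hclos ?_
      filter_upwards [self_mem_nhdsWithin] with t ht using key t ht
    exact hpos r ⟨le_rfl, hbr⟩ (le_antisymm hle (P.energy_nonneg _ _))
  · intro t ht
    have hnz : u t ≠ 0 ∨ p t ≠ 0 := by
      by_contra! h0
      exact hpos t ⟨ht.1.le, ht.2⟩ (P.energy_eq_zero_iff.2 h0)
    obtain ⟨h1, h2⟩ := h t (hbd ht) hnz
    exact P.hasDerivAt_energy h1 h2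
  · intro t ht
    have h1 := P.abs_vel_mul_force_le (hc.trans hr.1) ht.1.le (u t) (p t)
    have h2 := P.abs_vel_mul_abs_mom_le (u t) (p t)
    rw [← abs_mul] at h2
    have h4 : 0 ≤ P.α + 2 := by linarith [P.neg_one_lt_α]
    rw [mul_assoc, ← mul_neg]
    refine mul_le_mul_of_nonneg_left ?_ h4
    linarith [(abs_le.1 h1).1, (abs_le.1 h2).1]
  · have : Tendsto (fun t => P.energy (u t) (p t)) (𝓝[<] b) (𝓝 (P.energy (u b) (p b))) := by
      have := (hE b hmem.1).mono (s := Ioo r b) fun t ht => ⟨ht.1.le, ht.2.le.trans hmem.1.2⟩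
      rw [ContinuousWithinAt, nhdsWithin_Ioo_eq_nhdsLT hbr] at this
      exact this
    rwa [hmem.2] at this

end RadialParams

/-! ### From regular radial solutions to the system -/

/-- If p t exceeded p s, then after the last point c where p is at most max(p s, 0) the function
would be positive, hence differentiable and strictly decreasing, and could not reach p t. -/
theorem le_of_deriv_neg_off_zero_of_pos {p g : ℝ → ℝ} {s t : ℝ} (hst : s ≤ t)
    (hp : ContinuousOn p (Icc s t)) (hd : ∀ x ∈ Ioo s t, p x ≠ 0 → HasDerivAt p (g x) x)
    (hg : ∀ x ∈ Ioo s t, g x < 0) (ht : 0 < p t) : p t ≤ p s := by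
  by_contra! hlt
  set S := {x ∈ Icc s t | p x ≤ max (p s) 0} with hS
  have hScl : IsClosed S := hp.preimage_isClosed_of_isClosed isClosed_Icc isClosed_Iic
  have hsS : s ∈ S := ⟨left_mem_Icc.2 hst, le_max_left _ _⟩
  have hSb : BddAbove S := ⟨t, fun x hx => hx.1.2⟩
  have hmem : sSup S ∈ S := hScl.csSup_mem ⟨s, hsS⟩ hSb
  set c := sSup S
  have hmt : max (p s) 0 < p t := max_lt hlt ht
  have hct : c < t := by
    refine lt_of_le_of_ne hmem.1.2 fun h => ?_
    have := hmem.2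
    rw [h] at this
    exact absurd this (not_le.2 hmt)
  have hpos : ∀ x ∈ Ioc c t, 0 < p x := by
    intro x hx
    by_contra! h0
    exact absurd (le_csSup hSb ⟨⟨hmem.1.1.trans hx.1.le, hx.2⟩, h0.trans (le_max_right _ _)⟩)
      (not_le.2 hx.1)
  have hanti : StrictAntiOn p (Icc c t) := by
    refine strictAntiOn_of_deriv_neg (convex_Icc c t)
      (hp.mono (Icc_subset_Icc_left hmem.1.1)) ?_
    rw [interior_Icc]
    intro x hx
    have hx' : x ∈ Ioo s t := ⟨hmem.1.1.trans_lt hx.1, hx.2⟩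
    rw [(hd x hx' (hpos x ⟨hx.1, hx.2.le⟩).ne').deriv]
    exact hg x hx'
  have := hanti (left_mem_Icc.2 hct.le) (right_mem_Icc.2 hct.le) hct
  linarith [hmem.2]

theorem le_of_deriv_neg_off_zero {p g : ℝ → ℝ} {s t : ℝ} (hst : s ≤ t)
    (hp : ContinuousOn p (Icc s t)) (hd : ∀ x ∈ Ioo s t, p x ≠ 0 → HasDerivAt p (g x) x)
    (hg : ∀ x ∈ Ioo s t, g x < 0) : p t ≤ p s := by
  rcases lt_or_ge 0 (p t) with ht | ht
  · exact le_of_deriv_neg_off_zero_of_pos hst hp hd hg ht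
  rcases le_or_gt 0 (p s) with hs | hs
  · exact ht.trans hs
  have hneg : ∀ x ∈ Ioo (-t) (-s), -x ∈ Ioo s t := fun x hx =>
    ⟨by linarith [hx.2], by linarith [hx.1]⟩
  have := le_of_deriv_neg_off_zero_of_pos (p := fun x => -p (-x)) (g := fun x => g (-x))
    (s := -t) (t := -s) (by linarith) ?_ ?_ ?_ ?_
  · simpa using this
  · refine (hp.comp continuous_neg.continuousOn fun x hx => ?_).neg
    exact ⟨by linarith [hx.2], by linarith [hx.1]⟩
  · intro x hx h0
    refine (((hd (-x) (hneg x hx) (by simpa using h0)).comp x (hasDerivAt_neg x)).neg).congr_deriv ?_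
    simp
  · exact fun x hx => hg _ (hneg x hx)
  · simpa using hs

/-- A function whose derivative extends continuously with a negative value across the zeros of the
function is differentiable there, provided that it vanishes on no interval. -/
theorem hasDerivAt_of_deriv_neg_off_zero {p g : ℝ → ℝ} {x₀ : ℝ}
    (hp : ∀ᶠ x in 𝓝 x₀, ContinuousAt p x) (hd : ∀ᶠ x in 𝓝 x₀, p x ≠ 0 → HasDerivAt p (g x) x)
    (hconst : ∀ᶠ x in 𝓝 x₀, ¬ ∀ᶠ y in 𝓝 x, p y = 0) (hg : ContinuousAt g x₀) (hneg : g x₀ < 0)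
    (h0 : p x₀ = 0) : HasDerivAt p (g x₀) x₀ := by
  obtain ⟨ε, hε, hball⟩ := Metric.eventually_nhds_iff.1
    (hp.and (hd.and (hconst.and (hg.eventually (gt_mem_nhds hneg)))))
  have hI : ∀ x ∈ Ioo (x₀ - ε) (x₀ + ε), ContinuousAt p x ∧ (p x ≠ 0 → HasDerivAt p (g x) x) ∧
      (¬ ∀ᶠ y in 𝓝 x, p y = 0) ∧ g x < 0 := fun x hx =>
    hball (by rw [Real.dist_eq, abs_lt]; constructor <;> linarith [hx.1, hx.2])
  -- Monotonicity needs no information on the derivative at the zeros of p.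
  have hanti : ∀ s t, x₀ - ε < s → s ≤ t → t < x₀ + ε → p t ≤ p s := by
    intro s t hs hst ht
    refine le_of_deriv_neg_off_zero (g := g) hst (fun x hx => ?_) (fun x hx => ?_) fun x hx => ?_
    · exact (hI x ⟨hs.trans_le hx.1, hx.2.trans_lt ht⟩).1.continuousWithinAt
    · exact (hI x ⟨hs.trans hx.1, hx.2.trans ht⟩).2.1
    · exact (hI x ⟨hs.trans hx.1, hx.2.trans ht⟩).2.2.2
  -- By monotonicity, two zeros would make p vanish between them. Hence x₀ is the only zero nearby,
  -- and the derivative at x₀ is the limit of the derivatives on either side.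
  have hne : ∀ s t, x₀ - ε < s → s < t → t < x₀ + ε → p s = 0 → p t ≠ 0 := by
    intro s t hs hst ht hps hpt
    have hm : (s + t) / 2 ∈ Ioo s t := ⟨by linarith, by linarith⟩
    refine (hI ((s + t) / 2) ⟨hs.trans hm.1, hm.2.trans ht⟩).2.2.1 ?_
    filter_upwards [Ioo_mem_nhds hm.1 hm.2] with y hy
    have h1 := hanti s y hs hy.1.le (hy.2.trans ht)
    have h2 := hanti y t (hs.trans hy.1) hy.2.le ht
    linarith
  have hder : ∀ x ∈ Ioo (x₀ - ε) (x₀ + ε), x ≠ x₀ → HasDerivAt p (g x) x := by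
    intro x hx hxx
    refine (hI x hx).2.1 ?_
    rcases lt_or_gt_of_ne hxx with h | h
    · exact fun h' => hne x x₀ hx.1 h (by linarith) h' h0
    · exact hne x₀ x (by linarith) h hx.2 h0
  have hc : ContinuousAt p x₀ := (hI x₀ ⟨by linarith, by linarith⟩).1
  have hR : HasDerivWithinAt p (g x₀) (Ici x₀) x₀ := by
    have hs : ∀ x ∈ Ioo x₀ (x₀ + ε), HasDerivAt p (g x) x := fun x hx =>
      hder x ⟨by linarith [hx.1], hx.2⟩ hx.1.ne'
    have hmem : Ioo x₀ (x₀ + ε) ∈ 𝓝[>] x₀ := Ioo_mem_nhdsGT (by linarith)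
    refine hasDerivWithinAt_Ici_of_tendsto_deriv (s := Ioo x₀ (x₀ + ε))
      (fun x hx => (hs x hx).differentiableAt.differentiableWithinAt) hc.continuousWithinAt hmem ?_
    refine (hg.tendsto.mono_left nhdsWithin_le_nhds).congr' ?_
    filter_upwards [hmem] with x hx using (hs x hx).deriv.symm
  have hL : HasDerivWithinAt p (g x₀) (Iic x₀) x₀ := by
    have hs : ∀ x ∈ Ioo (x₀ - ε) x₀, HasDerivAt p (g x) x := fun x hx =>
      hder x ⟨hx.1, by linarith [hx.2]⟩ hx.2.ne
    have hmem : Ioo (x₀ - ε) x₀ ∈ 𝓝[<] x₀ := Ioo_mem_nhdsLT (by linarith)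
    refine hasDerivWithinAt_Iic_of_tendsto_deriv (s := Ioo (x₀ - ε) x₀)
      (fun x hx => (hs x hx).differentiableAt.differentiableWithinAt) hc.continuousWithinAt hmem ?_
    refine (hg.tendsto.mono_left nhdsWithin_le_nhds).congr' ?_
    filter_upwards [hmem] with x hx using (hs x hx).deriv.symm
  have := hL.union hR
  rwa [Iic_union_Ici, hasDerivWithinAt_univ] at this

section

variable {N : ℕ} {α a A μ : ℝ} {I : Set ℝ} {u : ℝ → ℝ}

theorem radialOp_neg (r p q : ℝ) :
    radialOp N α a A r (-p) (-q) = -radialOp N α A a r p q := by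
  simp only [radialOp, abs_neg, pucci_neg]; ring

theorem IsRadialSolution.neg (h : IsRadialSolution N α a A μ I u) :
    IsRadialSolution N α A a μ I (fun r => -u r) where
  contDiffOn := h.contDiffOn.neg
  deriv_zero := by
    have := derivWithin.fun_neg (f := u) (s := I) (x := 0)
    rw [this, h.deriv_zero, neg_zero]
  equation := by
    intro r hr hr0 hd
    have h1 : deriv (fun r => -u r) = fun r => -deriv u r := by
      ext x; exact deriv.fun_neg
    rw [h1] at hd ⊢
    obtain ⟨h2, h3⟩ := h.equation r hr hr0 (by simpa using hd)
    refine ⟨h2.neg, ?_⟩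
    rw [deriv.fun_neg, radialOp_neg, abs_neg]
    linear_combination -h3
  locally_const := by
    intro r hr hr0 hc
    have := h.locally_const r hr hr0 (hc.mono fun t ht => by simpa using ht)
    rw [abs_neg]
    linear_combination -this

end

namespace RadialParams

variable {P : RadialParams} {N : ℕ} {R : ℝ} {u : ℝ → ℝ}

theorem continuousAt_force {u p : ℝ → ℝ} {r : ℝ} (hr : r ≠ 0) (hu : ContinuousAt u r)
    (hp : ContinuousAt p r) : ContinuousAt (fun r => P.force r (u r) (p r)) r := by
  unfold force
  refine continuous_pucci.continuousAt.comp ?_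
  refine ((P.continuous_mom.continuousAt.comp hu).neg).sub ?_
  exact (continuousAt_const.div continuousAt_id hr).mul (continuous_pucci.continuousAt.comp hp)

theorem force_zero_neg {r u : ℝ} (hu : 0 < u) : P.force r u 0 < 0 := by
  rw [force, pucci_zero, mul_zero, sub_zero, pucci_neg_iff (inv_pos.2 P.a_pos) (inv_pos.2 P.A_pos)]
  exact neg_neg_of_pos (P.mom_pos_iff.2 hu)

/-- The weight |u'|^α is moved inside both Pucci functions, and the outer one is inverted. The
parameter μ is kept general for the exclusion of μ ≤ 0. -/
theorem hasDerivAt_mom_of_equation' (hν : P.ν = (N : ℝ) - 1) {μ r : ℝ} (hd : deriv u r ≠ 0)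
    (h2 : ContDiffAt ℝ 2 u r)
    (heq : radialOp N P.α P.a P.A r (deriv u r) (deriv (deriv u) r) + μ * (|u r| ^ P.α * u r) = 0) :
    HasDerivAt (fun x => P.mom (deriv u x)) ((P.α + 1) * pucci P.a⁻¹ P.A⁻¹
      (-(μ * P.mom (u r)) - P.ν / r * pucci P.a P.A (P.mom (deriv u r)))) r := by
  have h3 : DifferentiableAt ℝ (deriv u) r := by
    have : ContDiffAt ℝ 1 (deriv u) r := h2.derivWithin (by norm_num)
    exact this.differentiableAt (by norm_num)
  have h4 := (hasDerivAt_signedPow (β := P.α) hd).comp r h3.hasDerivAt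
  refine h4.congr_deriv ?_
  have ht : 0 ≤ |deriv u r| ^ P.α := by positivity
  have h5 : pucci P.a P.A (|deriv u r| ^ P.α * deriv (deriv u) r)
      = -(μ * P.mom (u r)) - P.ν / r * pucci P.a P.A (P.mom (deriv u r)) := by
    rw [mom, mom, signedPow, signedPow, pucci_mul_of_nonneg ht, pucci_mul_of_nonneg ht, hν]
    rw [radialOp] at heq
    linear_combination heq
  rw [← h5, pucci_inv_pucci P.a_pos P.A_pos]; ring

theorem hasDerivAt_mom_of_equation (hν : P.ν = (N : ℝ) - 1) {r : ℝ} (hd : deriv u r ≠ 0)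
    (h2 : ContDiffAt ℝ 2 u r)
    (heq : radialOp N P.α P.a P.A r (deriv u r) (deriv (deriv u) r) + 1 * (|u r| ^ P.α * u r) = 0) :
    HasDerivAt (fun x => P.mom (deriv u x)) ((P.α + 1) * P.force r (u r) (P.mom (deriv u r))) r :=
  (hasDerivAt_mom_of_equation' hν hd h2 heq).congr_deriv (by rw [one_mul, force])

theorem _root_.IsRadialSolution.hasDerivAt {α a A μ : ℝ}
    (hu : IsRadialSolution N α a A μ (Ico 0 R) u) {r : ℝ} (hr : r ∈ Ioo 0 R) :
    HasDerivAt u (deriv u r) r :=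
  ((hu.contDiffOn.contDiffAt (Ico_mem_nhds hr.1 hr.2)).differentiableAt (by norm_num)).hasDerivAt

theorem _root_.IsRadialSolution.continuousAt_deriv {α a A μ : ℝ}
    (hu : IsRadialSolution N α a A μ (Ico 0 R) u)
    {r : ℝ} (hr : r ∈ Ioo 0 R) : ContinuousAt (deriv u) r := by
  have := (hu.contDiffOn.mono Ioo_subset_Ico_self).continuousOn_deriv_of_isOpen isOpen_Ioo le_rfl
  exact this.continuousAt (Ioo_mem_nhds hr.1 hr.2)

/-- At a critical point with u > 0 the right-hand side of the momentum equation is negative, so the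
momentum equation extends across it. -/
theorem hasDerivAt_mom_of_pos (hν : P.ν = (N : ℝ) - 1)
    (hu : IsRadialSolution N P.α P.a P.A 1 (Ico 0 R) u) {r : ℝ} (hr : r ∈ Ioo 0 R) (h0 : 0 < u r) :
    HasDerivAt (fun x => P.mom (deriv u x)) ((P.α + 1) * P.force r (u r) (P.mom (deriv u r))) r := by
  have hnhds : ∀ᶠ x in 𝓝 r, x ∈ Ioo 0 R := Ioo_mem_nhds hr.1 hr.2
  have hoff : ∀ x ∈ Ioo 0 R, deriv u x ≠ 0 → HasDerivAt (fun x => P.mom (deriv u x))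
      ((P.α + 1) * P.force x (u x) (P.mom (deriv u x))) x := by
    intro x hx hd
    obtain ⟨h2, h3⟩ := hu.equation x ⟨hx.1.le, hx.2⟩ hx.1 hd
    exact hasDerivAt_mom_of_equation hν hd h2 h3
  by_cases hd : deriv u r = 0
  swap
  · exact hoff r hr hd
  have hcp : ∀ x ∈ Ioo 0 R, ContinuousAt (fun x => P.mom (deriv u x)) x := fun x hx =>
    P.continuous_mom.continuousAt.comp (hu.continuousAt_deriv hx)
  have hcu := (hu.hasDerivAt hr).continuousAt
  refine hasDerivAt_of_deriv_neg_off_zero (p := fun x => P.mom (deriv u x))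
    (g := fun x => (P.α + 1) * P.force x (u x) (P.mom (deriv u x))) (x₀ := r)
    (hnhds.mono hcp) (hnhds.mono fun x hx hne => hoff x hx fun h => hne (by simp [h])) ?_ ?_ ?_ ?_
  -- A momentum vanishing near x would make u a positive constant there, which `locally_const`
  -- forbids.
  · filter_upwards [hnhds, hcu.eventually (lt_mem_nhds h0)] with x hx hux hev
    have hev' : ∀ᶠ y in 𝓝 x, deriv u y = 0 ∧ y ∈ Ioo 0 R :=
      (hev.mono fun y hy => P.mom_eq_zero_iff.1 hy).and (Ioo_mem_nhds hx.1 hx.2)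
    obtain ⟨ε, hε, hball⟩ := Metric.eventually_nhds_iff_ball.1 hev'
    have hcon : ∀ᶠ y in 𝓝 x, u y = u x := by
      filter_upwards [Metric.ball_mem_nhds x hε] with y hy
      refine (convex_ball x ε).is_const_of_fderivWithin_eq_zero (𝕜 := ℝ) (f := u)
        (fun z hz => ((hu.hasDerivAt (hball z hz).2).differentiableAt).differentiableWithinAt)
        (fun z hz => ?_) hy (Metric.mem_ball_self hε)
      have h1 := hu.hasDerivAt (hball z hz).2
      rw [(hball z hz).1] at h1
      rw [fderivWithin_of_isOpen Metric.isOpen_ball hz]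
      simpa using h1.hasFDerivAt.fderiv
    have := hu.locally_const x ⟨hx.1.le, hx.2⟩ hx.1 hcon
    have h1 : 0 < |u x| ^ P.α * u x := signedPow_pos_iff (β := P.α).2 hux
    linarith
  · exact continuousAt_const.mul (continuousAt_force hr.1.ne' hcu (hcp r hr))
  · rw [hd, mom_zero]
    exact mul_neg_of_pos_of_neg P.α_add_one_pos (force_zero_neg h0)
  · simp [hd]

theorem isSolOffZero_of_isRadialSolution (hν : P.ν = (N : ℝ) - 1)
    (hu : IsRadialSolution N P.α P.a P.A 1 (Ico 0 R) u) :
    P.IsSolOffZero (Ioo 0 R) u (fun x => P.mom (deriv u x)) := by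
  intro r hr hne
  refine ⟨by rw [vel_mom]; exact hu.hasDerivAt hr, ?_⟩
  by_cases hd : deriv u r = 0
  swap
  · obtain ⟨h2, h3⟩ := hu.equation r ⟨hr.1.le, hr.2⟩ hr.1 hd
    exact hasDerivAt_mom_of_equation hν hd h2 h3
  rcases lt_trichotomy (u r) 0 with h | h | h
  · have h1 : (fun x => -u x) = -u := rfl
    have h2 := hasDerivAt_mom_of_pos (P := P.swap) hν hu.neg hr (by simpa using h)
    have h3 : deriv (fun x => -u x) = fun x => -deriv u x := by ext x; exact deriv.fun_neg
    rw [h3] at h2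
    simp only [swap_mom, mom_neg, swap_α, swap_force] at h2
    refine h2.neg.congr_deriv (by ring) |>.congr_of_eventuallyEq (Eventually.of_forall fun x => ?_)
    simp
  · simp [h, hd] at hne
  · exact hasDerivAt_mom_of_pos hν hu hr h

theorem tendsto_deriv_zero (hR : 0 < R) (hu : IsRadialSolution N P.α P.a P.A 1 (Ico 0 R) u) :
    Tendsto (deriv u) (𝓝[>] 0) (𝓝 0) := by
  have h1 := (hu.contDiffOn.continuousOn_derivWithin (uniqueDiffOn_Ico 0 R) le_rfl) 0 ⟨le_rfl, hR⟩
  rw [ContinuousWithinAt, hu.deriv_zero] at h1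
  have h2 : Tendsto (derivWithin u (Ico 0 R)) (𝓝[>] 0) (𝓝 0) := by
    rw [← nhdsWithin_Ioo_eq_nhdsGT hR]
    exact h1.mono_left (nhdsWithin_mono _ Ioo_subset_Ico_self)
  refine h2.congr' ?_
  filter_upwards [Ioo_mem_nhdsGT hR] with x hx
  exact derivWithin_of_mem_nhds (Ico_mem_nhds hx.1 hx.2)

theorem tendsto_mom_deriv_zero (hR : 0 < R) (hu : IsRadialSolution N P.α P.a P.A 1 (Ico 0 R) u) :
    Tendsto (fun x => P.mom (deriv u x)) (𝓝[>] 0) (𝓝 0) := by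
  have := (P.continuous_mom.tendsto 0).comp (tendsto_deriv_zero hR hu)
  rwa [mom_zero] at this

theorem tendsto_nhdsGT_of_isRadialSolution (hR : 0 < R)
    (hu : IsRadialSolution N P.α P.a P.A 1 (Ico 0 R) u) : Tendsto u (𝓝[>] 0) (𝓝 (u 0)) := by
  have h1 := hu.contDiffOn.continuousOn 0 ⟨le_rfl, hR⟩
  rw [← nhdsWithin_Ioo_eq_nhdsGT hR]
  exact h1.mono_left (nhdsWithin_mono _ Ioo_subset_Ico_self)

theorem eq_zero_of_isRadialSolution (hν : P.ν = (N : ℝ) - 1)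
    (hu : IsRadialSolution N P.α P.a P.A 1 (Ico 0 R) u) (h0 : u 0 = 0) :
    ∀ r ∈ Ico 0 R, u r = 0 := by
  have hoff := isSolOffZero_of_isRadialSolution hν hu
  -- The one-sided derivative is used because p has to be continuous at 0, where `deriv u` depends
  -- on values of u at negative radii.
  set p : ℝ → ℝ := fun x => P.mom (derivWithin u (Ico 0 R) x) with hp
  have hpe : ∀ x ∈ Ioo 0 R, p x = P.mom (deriv u x) := fun x hx => by
    rw [hp]; simp only; rw [derivWithin_of_mem_nhds (Ico_mem_nhds hx.1 hx.2)]
  have hoff' : P.IsSolOffZero (Ioo 0 R) u p := by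
    intro r hr hne
    rw [hpe r hr] at hne ⊢
    refine ⟨(hoff r hr hne).1, (hoff r hr hne).2.congr_of_eventuallyEq ?_⟩
    filter_upwards [Ioo_mem_nhds hr.1 hr.2] with x hx using hpe x hx
  have := hoff'.eq_zero_right le_rfl hu.contDiffOn.continuousOn
    (P.continuous_mom.comp_continuousOn
      (hu.contDiffOn.continuousOn_derivWithin (uniqueDiffOn_Ico 0 R) le_rfl)) h0
    (by simp [hu.deriv_zero])
  exact fun r hr => (this r hr).1

/-- Only double zeros remain to be excluded: one at r would force u = 0 on (0, r), against the limit
u(0) ≠ 0. -/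
theorem isSolOn_of_isRadialSolution (hν : P.ν = (N : ℝ) - 1)
    (hu : IsRadialSolution N P.α P.a P.A 1 (Ico 0 R) u) (h0 : u 0 ≠ 0) :
    P.IsSolOn (Ioo 0 R) u (fun x => P.mom (deriv u x)) := by
  have hoff := isSolOffZero_of_isRadialSolution hν hu
  intro r hr
  refine hoff r hr ?_
  by_contra! hz
  have hcu : ∀ x ∈ Ioo 0 R, ContinuousAt u x := fun x hx => (hu.hasDerivAt hx).continuousAt
  have hcp : ∀ x ∈ Ioo 0 R, ContinuousAt (fun x => P.mom (deriv u x)) x := fun x hx =>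
    P.continuous_mom.continuousAt.comp (hu.continuousAt_deriv hx)
  have hzero : ∀ x ∈ Ioo 0 r, u x = 0 := by
    intro x hx
    -- The backward estimate needs a positive left endpoint, here x/2.
    have hsub : Ioc (x / 2) r ⊆ Ioo 0 R := fun y hy =>
      ⟨by linarith [hx.1, hy.1], hy.2.trans_lt hr.2⟩
    refine (IsSolOffZero.eq_zero_left (c := x / 2) (d := r) (half_pos hx.1)
      (fun y hy => (hcu y (hsub hy)).continuousWithinAt)
      (fun y hy => (hcp y (hsub hy)).continuousWithinAt)
      (fun y hy => hoff y (hsub ⟨hy.1, hy.2.le⟩)) hz.1 hz.2 x ⟨by linarith [hx.1], hx.2.le⟩).1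
  have hlim := tendsto_nhdsGT_of_isRadialSolution (hr.1.trans hr.2) hu
  refine h0 (tendsto_nhds_unique (hlim.congr' ?_) tendsto_const_nhds)
  filter_upwards [Ioo_mem_nhdsGT hr.1] with x hx using hzero x hx

end RadialParams

namespace RadialParams

variable (P : RadialParams)

/-! ### The two projective charts -/

/-- The right-hand side of the Riccati equation for `y = p / (|u| ^ α u)` where `u > 0`. -/
noncomputable def riccati (r y : ℝ) : ℝ := (P.α + 1) * (P.force r 1 y - y * P.vel y)

/-- The right-hand side of the equation for `z = u / u'` where `u' > 0`. -/
noncomputable def coriccati (r z : ℝ) : ℝ := 1 - z * P.force r z 1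

theorem force_eq_mul_of_pos {u : ℝ} (hu : 0 < u) (r p : ℝ) :
    P.force r u p = P.mom u * P.force r 1 (p / P.mom u) := by
  have := P.force_mul hu.le r 1 (p / P.mom u)
  rwa [mul_one, mul_div_cancel₀ _ (P.mom_pos_iff.2 hu).ne'] at this

theorem force_eq_mul_of_pos_right {p : ℝ} (hp : 0 < p) (r u : ℝ) :
    P.force r u p = p * P.force r (u / P.vel p) 1 := by
  have hv := P.vel_pos_iff.2 hp
  have := P.force_mul hv.le r (u / P.vel p) 1
  rwa [mul_one, mom_vel, mul_div_cancel₀ _ hv.ne'] at this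

theorem vel_eq_mul_of_pos {u : ℝ} (hu : 0 < u) (p : ℝ) :
    P.vel p = u * P.vel (p / P.mom u) := by
  have h : P.vel (P.mom u * (p / P.mom u)) = u * P.vel (p / P.mom u) := by rw [vel_mul, vel_mom]
  rwa [mul_div_cancel₀ _ (P.mom_pos_iff.2 hu).ne'] at h

variable {P} {u p : ℝ → ℝ} {r : ℝ}

theorem hasDerivAt_riccati (hu : HasDerivAt u (P.vel (p r)) r)
    (hp : HasDerivAt p ((P.α + 1) * P.force r (u r) (p r)) r) (h0 : 0 < u r) :
    HasDerivAt (fun x => p x / P.mom (u x)) (P.riccati r (p r / P.mom (u r))) r := by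
  have hM := P.mom_pos_iff.2 h0
  have h1 : HasDerivAt (fun x => P.mom (u x)) ((P.α + 1) * |u r| ^ P.α * P.vel (p r)) r :=
    (hasDerivAt_signedPow (β := P.α) h0.ne').comp r hu
  refine (hp.div h1 hM.ne').congr_deriv ?_
  rw [force_eq_mul_of_pos P h0, vel_eq_mul_of_pos P h0 (p r), riccati]
  have h2 : |u r| ^ P.α * u r = P.mom (u r) := rfl
  field_simp
  linear_combination (-((P.α + 1) * p r * P.vel (p r / P.mom (u r)))) * h2

theorem hasDerivAt_vel_of_pos (hp : HasDerivAt p ((P.α + 1) * P.force r (u r) (p r)) r)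
    (h0 : 0 < p r) :
    HasDerivAt (fun x => P.vel (p x)) (P.vel (p r) * P.force r (u r / P.vel (p r)) 1) r := by
  refine ((hasDerivAt_signedPow (β := P.γ - 1) h0.ne').comp r hp).congr_deriv ?_
  have h2 : |p r| ^ (P.γ - 1) * p r = P.vel (p r) := rfl
  rw [force_eq_mul_of_pos_right P h0]
  linear_combination P.force r (u r / P.vel (p r)) 1 * (h2 + |p r| ^ (P.γ - 1) * p r * P.γ_mul)

theorem hasDerivAt_coriccati (hu : HasDerivAt u (P.vel (p r)) r)
    (hp : HasDerivAt p ((P.α + 1) * P.force r (u r) (p r)) r) (h0 : 0 < p r) :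
    HasDerivAt (fun x => u x / P.vel (p x)) (P.coriccati r (u r / P.vel (p r))) r := by
  have hV := P.vel_pos_iff.2 h0
  refine (hu.div (hasDerivAt_vel_of_pos hp h0) hV.ne').congr_deriv ?_
  rw [coriccati]
  field_simp

variable (P)

theorem abs_force_sub_le {c : ℝ} (hc : 0 < c) (hr : c ≤ r) (u y₁ y₂ : ℝ) :
    |P.force r u y₁ - P.force r u y₂|
      ≤ (P.a⁻¹ + P.A⁻¹) * (P.ν / c * (P.a + P.A)) * |y₁ - y₂| := by
  have ha := inv_pos.2 P.a_pos
  have hA := inv_pos.2 P.A_pos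
  have hν := P.ν_nonneg
  have haA : 0 < P.a + P.A := add_pos P.a_pos P.A_pos
  rw [force, force]
  refine (abs_pucci_sub_le ha hA _ _).trans ?_
  rw [show -P.mom u - P.ν / r * pucci P.a P.A y₁ - (-P.mom u - P.ν / r * pucci P.a P.A y₂)
    = -(P.ν / r * (pucci P.a P.A y₁ - pucci P.a P.A y₂)) by ring, abs_neg, abs_mul,
    abs_of_nonneg (div_nonneg hν (hc.le.trans hr)), mul_assoc (P.a⁻¹ + P.A⁻¹)]
  refine mul_le_mul_of_nonneg_left ?_ (by positivity)
  calc _ ≤ P.ν / c * ((P.a + P.A) * |y₁ - y₂|) := by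
        gcongr; exact abs_pucci_sub_le P.a_pos P.A_pos _ _
    _ = _ := by ring

theorem abs_mul_vel_sub_le {M y₁ y₂ : ℝ} (h1 : |y₁| ≤ M) (h2 : |y₂| ≤ M) :
    |y₁ * P.vel y₁ - y₂ * P.vel y₂| ≤ (1 + P.γ) * M ^ P.γ * |y₁ - y₂| := by
  rw [mul_vel, mul_vel]
  have := abs_abs_rpow_sub_le (e := 1 + P.γ) (by linarith [P.γ_pos]) h1 h2
  rwa [add_sub_cancel_left] at this

/-- Although `vel` may fail to be Lipschitz at 0, the product y `vel y` = |y|^(1+γ) has exponent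
above 1. Friction is Lipschitz for r ≥ c. -/
theorem exists_lipschitz_riccati {c : ℝ} (hc : 0 < c) (M : ℝ) :
    ∃ K : NNReal, ∀ r, c ≤ r → LipschitzOnWith K (P.riccati r) (Icc (-M) M) := by
  have ha := inv_pos.2 P.a_pos
  have hA := inv_pos.2 P.A_pos
  have hν := P.ν_nonneg
  have haA : 0 < P.a + P.A := add_pos P.a_pos P.A_pos
  refine ⟨Real.toNNReal ((P.α + 1) * ((P.a⁻¹ + P.A⁻¹) * (P.ν / c * (P.a + P.A)) +
    (1 + P.γ) * M ^ P.γ)), fun r hr => LipschitzOnWith.of_dist_le_mul fun x hx y hy => ?_⟩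
  have hM : |x| ≤ M := abs_le.2 hx
  have hM' : |y| ≤ M := abs_le.2 hy
  have hM0 : 0 ≤ M := (abs_nonneg x).trans hM
  have hγ := P.γ_pos
  have hα := P.α_add_one_pos
  rw [Real.coe_toNNReal _ (by positivity), Real.dist_eq, Real.dist_eq, riccati, riccati, ← mul_sub,
    abs_mul, abs_of_pos hα, mul_assoc]
  gcongr
  have h1 := P.abs_force_sub_le hc hr 1 x y
  have h2 := P.abs_mul_vel_sub_le hM hM'
  rw [show P.force r 1 x - x * P.vel x - (P.force r 1 y - y * P.vel y)
    = (P.force r 1 x - P.force r 1 y) - (x * P.vel x - y * P.vel y) by ring]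
  refine (abs_sub _ _).trans ?_
  linarith

/-- The weight |z₂| compensates for the failure of the Lipschitz condition for `mom` when α < 0: up
to a Lipschitz error, the weighted difference is a difference of signed powers of exponent α + 1 >
0. -/
theorem abs_mul_mom_sub_le {M z₁ z₂ : ℝ} (h1 : |z₁| ≤ M) (h2 : |z₂| ≤ M) :
    |z₂| * |P.mom z₁ - P.mom z₂| ≤ (P.α + 3) * M ^ (P.α + 1) * |z₁ - z₂| := by
  have hα := P.α_add_one_pos
  have e : |z₂| * (P.mom z₁ - P.mom z₂)
      = (signedPow (P.α + 1) z₁ - signedPow (P.α + 1) z₂) - (|z₁| - |z₂|) * P.mom z₁ := by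
    rw [← abs_mul_signedPow, ← abs_mul_signedPow, mom]; simp only [mom]; ring
  have h3 := abs_signedPow_sub_le hα h1 h2
  have h4 : |P.mom z₁| ≤ M ^ (P.α + 1) := by
    rw [mom, abs_signedPow P.neg_one_lt_α]; gcongr
  calc |z₂| * |P.mom z₁ - P.mom z₂| = |(|z₂| * (P.mom z₁ - P.mom z₂))| := by
        rw [abs_mul, abs_abs]
    _ ≤ |signedPow (P.α + 1) z₁ - signedPow (P.α + 1) z₂| + |(|z₁| - |z₂|)| * |P.mom z₁| := by
        rw [e, ← abs_mul ((|z₁| : ℝ) - |z₂|)]; exact abs_sub _ _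
    _ ≤ (P.α + 1 + 1) * M ^ (P.α + 1) * |z₁ - z₂| + |z₁ - z₂| * M ^ (P.α + 1) := by
        exact add_le_add h3 (mul_le_mul (abs_abs_sub_abs_le z₁ z₂) h4 (abs_nonneg _) (abs_nonneg _))
    _ = _ := by ring

theorem abs_force_one_le {c : ℝ} (hc : 0 < c) (hr : c ≤ r) {M z : ℝ} (hz : |z| ≤ M) :
    |P.force r z 1| ≤ (P.a⁻¹ + P.A⁻¹) * (M ^ (P.α + 1) + P.ν / c * P.A) := by
  have ha := inv_pos.2 P.a_pos
  have hA := inv_pos.2 P.A_pos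
  have hA' := P.A_pos
  have hν := P.ν_nonneg
  have hα := P.α_add_one_pos
  refine (abs_pucci_le ha hA _).trans ?_
  rw [pucci_of_nonneg zero_le_one, mul_one]
  gcongr
  calc _ ≤ |-P.mom z| + |P.ν / r * P.A| := abs_sub _ _
    _ = |z| ^ (P.α + 1) + P.ν / r * P.A := by
      rw [abs_neg, mom, abs_signedPow P.neg_one_lt_α,
        abs_of_nonneg (mul_nonneg (div_nonneg hν (hc.le.trans hr)) hA'.le)]
    _ ≤ _ := by gcongr

theorem exists_lipschitz_coriccati {c : ℝ} (hc : 0 < c) (M : ℝ) :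
    ∃ K : NNReal, ∀ r, c ≤ r → LipschitzOnWith K (P.coriccati r) (Icc (-M) M) := by
  have ha := inv_pos.2 P.a_pos
  have hA := inv_pos.2 P.A_pos
  have hA' := P.A_pos
  have hν := P.ν_nonneg
  have hα := P.α_add_one_pos
  refine ⟨Real.toNNReal ((P.a⁻¹ + P.A⁻¹) * (M ^ (P.α + 1) + P.ν / c * P.A) +
    (P.a⁻¹ + P.A⁻¹) * ((P.α + 3) * M ^ (P.α + 1))),
    fun r hr => LipschitzOnWith.of_dist_le_mul fun x hx y hy => ?_⟩
  have hM : |x| ≤ M := abs_le.2 hx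
  have hM' : |y| ≤ M := abs_le.2 hy
  have hM0 : 0 ≤ M := (abs_nonneg x).trans hM
  have h3 : 0 < P.α + 3 := by linarith
  rw [Real.coe_toNNReal _ (by positivity), Real.dist_eq, Real.dist_eq, coriccati, coriccati]
  -- This splitting leaves the factor y in front of the difference of forces, as
  -- `abs_mul_mom_sub_le` requires.
  rw [show 1 - x * P.force r x 1 - (1 - y * P.force r y 1)
    = -((x - y) * P.force r x 1 + y * (P.force r x 1 - P.force r y 1)) by ring, abs_neg]
  have h1 := P.abs_force_one_le hc hr hM
  have h2 : |P.force r x 1 - P.force r y 1| ≤ (P.a⁻¹ + P.A⁻¹) * |P.mom x - P.mom y| := by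
    refine (abs_pucci_sub_le ha hA _ _).trans (le_of_eq ?_)
    rw [show -P.mom x - P.ν / r * pucci P.a P.A 1 - (-P.mom y - P.ν / r * pucci P.a P.A 1)
      = -(P.mom x - P.mom y) by ring, abs_neg]
  calc _ ≤ |(x - y) * P.force r x 1| + |y * (P.force r x 1 - P.force r y 1)| := abs_add_le _ _
    _ = |P.force r x 1| * |x - y| + |y| * |P.force r x 1 - P.force r y 1| := by
      rw [abs_mul, abs_mul]; ring
    _ ≤ (P.a⁻¹ + P.A⁻¹) * (M ^ (P.α + 1) + P.ν / c * P.A) * |x - y|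
        + |y| * ((P.a⁻¹ + P.A⁻¹) * |P.mom x - P.mom y|) := by gcongr
    _ = (P.a⁻¹ + P.A⁻¹) * (M ^ (P.α + 1) + P.ν / c * P.A) * |x - y|
        + (P.a⁻¹ + P.A⁻¹) * (|y| * |P.mom x - P.mom y|) := by ring
    _ ≤ (P.a⁻¹ + P.A⁻¹) * (M ^ (P.α + 1) + P.ν / c * P.A) * |x - y|
        + (P.a⁻¹ + P.A⁻¹) * ((P.α + 3) * M ^ (P.α + 1) * |x - y|) := by
      exact add_le_add_right (mul_le_mul_of_nonneg_left (P.abs_mul_mom_sub_le hM hM') (by positivity)) _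
    _ = _ := by ring

/-! ### Uniqueness for the system -/

theorem eventually_eq_of_linear {f : ℝ → ℝ} {g₁ g₂ : ℝ → ℝ} {r : ℝ} (hf : ContinuousAt f r)
    (h1 : ∀ᶠ t in 𝓝 r, HasDerivAt g₁ (f t * g₁ t) t)
    (h2 : ∀ᶠ t in 𝓝 r, HasDerivAt g₂ (f t * g₂ t) t) (h : g₁ r = g₂ r) : g₁ =ᶠ[𝓝 r] g₂ := by
  refine ODE_solution_unique_of_eventually (v := fun t x => f t * x) (s := fun _ => univ)
    (K := Real.toNNReal (|f r| + 1)) ?_ (h1.mono fun t ht => ⟨ht, mem_univ _⟩)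
    (h2.mono fun t ht => ⟨ht, mem_univ _⟩) h
  filter_upwards [hf.abs.eventually (gt_mem_nhds (lt_add_one |f r|))] with t ht
  refine LipschitzOnWith.of_dist_le_mul fun x _ y _ => ?_
  rw [Real.coe_toNNReal _ (by positivity), Real.dist_eq, Real.dist_eq, ← mul_sub, abs_mul]
  gcongr

variable {P} {u₁ u₂ p₁ p₂ : ℝ → ℝ} {J : Set ℝ}

/-- The quotients y agree by uniqueness in the Riccati chart. Then both u solve the linear equation
u' = `vel y` u with the same continuous coefficient, and p is recovered from y and u. -/
theorem eventually_eq_of_pos (hJ : J ∈ 𝓝 r) (hr : 0 < r) (h1 : P.IsSolOn J u₁ p₁)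
    (h2 : P.IsSolOn J u₂ p₂) (hu : u₁ r = u₂ r) (hp : p₁ r = p₂ r) (h0 : 0 < u₁ r) :
    ∀ᶠ t in 𝓝 r, u₁ t = u₂ t ∧ p₁ t = p₂ t := by
  have hJ' : ∀ᶠ t in 𝓝 r, t ∈ J := hJ
  have hrJ : r ∈ J := mem_of_mem_nhds hJ
  have hpos1 := (h1.continuousAt_fst hrJ).eventually (lt_mem_nhds h0)
  have hpos2 := (h2.continuousAt_fst hrJ).eventually (lt_mem_nhds (hu ▸ h0))
  have hc1 := (hasDerivAt_riccati (h1 r hrJ).1 (h1 r hrJ).2 h0).continuousAt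
  have hc2 := (hasDerivAt_riccati (h2 r hrJ).1 (h2 r hrJ).2 (hu ▸ h0)).continuousAt
  set M := |p₁ r / P.mom (u₁ r)| + 1 with hM
  have hb1 : ∀ᶠ t in 𝓝 r, |p₁ t / P.mom (u₁ t)| < M :=
    hc1.abs.eventually (gt_mem_nhds (lt_add_one _))
  have hb2 : ∀ᶠ t in 𝓝 r, |p₂ t / P.mom (u₂ t)| < M :=
    hc2.abs.eventually (gt_mem_nhds (by simp only [← hu, ← hp]; exact lt_add_one _))
  obtain ⟨K, hK⟩ := P.exists_lipschitz_riccati (half_pos hr) M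
  have hy : (fun t => p₁ t / P.mom (u₁ t)) =ᶠ[𝓝 r] fun t => p₂ t / P.mom (u₂ t) := by
    refine ODE_solution_unique_of_eventually (v := P.riccati) (s := fun _ => Icc (-M) M) (K := K)
      ?_ ?_ ?_ (by simp only [hu, hp])
    · filter_upwards [eventually_ge_nhds (half_lt_self hr)] with t ht using hK t ht
    · filter_upwards [hJ', hpos1, hb1] with t ht hpt hbt
      exact ⟨hasDerivAt_riccati (h1 t ht).1 (h1 t ht).2 hpt, abs_le.1 hbt.le⟩
    · filter_upwards [hJ', hpos2, hb2] with t ht hpt hbt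
      exact ⟨hasDerivAt_riccati (h2 t ht).1 (h2 t ht).2 hpt, abs_le.1 hbt.le⟩
  have huu : u₁ =ᶠ[𝓝 r] u₂ := by
    refine eventually_eq_of_linear (f := fun t => P.vel (p₁ t / P.mom (u₁ t)))
      (P.continuous_vel.continuousAt.comp hc1) ?_ ?_ hu
    · filter_upwards [hJ', hpos1] with t ht hpt
      exact (h1 t ht).1.congr_deriv (by rw [P.vel_eq_mul_of_pos hpt, mul_comm])
    · filter_upwards [hJ', hpos2, hy] with t ht hpt hyt
      exact (h2 t ht).1.congr_deriv (by rw [hyt, P.vel_eq_mul_of_pos hpt, mul_comm])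
  filter_upwards [huu, hy, hpos1] with t hut hyt hpt
  refine ⟨hut, ?_⟩
  rw [← hut] at hyt
  have := (P.mom_pos_iff.2 hpt).ne'
  field_simp at hyt
  exact hyt

theorem eventually_eq_of_pos_right (hJ : J ∈ 𝓝 r) (hr : 0 < r) (h1 : P.IsSolOn J u₁ p₁)
    (h2 : P.IsSolOn J u₂ p₂) (hu : u₁ r = u₂ r) (hp : p₁ r = p₂ r) (h0 : 0 < p₁ r) :
    ∀ᶠ t in 𝓝 r, u₁ t = u₂ t ∧ p₁ t = p₂ t := by
  have hJ' : ∀ᶠ t in 𝓝 r, t ∈ J := hJ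
  have hrJ : r ∈ J := mem_of_mem_nhds hJ
  have hpos1 := (h1.continuousAt_snd hrJ).eventually (lt_mem_nhds h0)
  have hpos2 := (h2.continuousAt_snd hrJ).eventually (lt_mem_nhds (hp ▸ h0))
  have hc1 := (hasDerivAt_coriccati (h1 r hrJ).1 (h1 r hrJ).2 h0).continuousAt
  have hc2 := (hasDerivAt_coriccati (h2 r hrJ).1 (h2 r hrJ).2 (hp ▸ h0)).continuousAt
  set M := |u₁ r / P.vel (p₁ r)| + 1 with hM
  have hb1 : ∀ᶠ t in 𝓝 r, |u₁ t / P.vel (p₁ t)| < M :=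
    hc1.abs.eventually (gt_mem_nhds (lt_add_one _))
  have hb2 : ∀ᶠ t in 𝓝 r, |u₂ t / P.vel (p₂ t)| < M :=
    hc2.abs.eventually (gt_mem_nhds (by simp only [← hu, ← hp]; exact lt_add_one _))
  obtain ⟨K, hK⟩ := P.exists_lipschitz_coriccati (half_pos hr) M
  have hy : (fun t => u₁ t / P.vel (p₁ t)) =ᶠ[𝓝 r] fun t => u₂ t / P.vel (p₂ t) := by
    refine ODE_solution_unique_of_eventually (v := P.coriccati) (s := fun _ => Icc (-M) M) (K := K)
      ?_ ?_ ?_ (by simp only [hu, hp])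
    · filter_upwards [eventually_ge_nhds (half_lt_self hr)] with t ht using hK t ht
    · filter_upwards [hJ', hpos1, hb1] with t ht hpt hbt
      exact ⟨hasDerivAt_coriccati (h1 t ht).1 (h1 t ht).2 hpt, abs_le.1 hbt.le⟩
    · filter_upwards [hJ', hpos2, hb2] with t ht hpt hbt
      exact ⟨hasDerivAt_coriccati (h2 t ht).1 (h2 t ht).2 hpt, abs_le.1 hbt.le⟩
  have hpp : p₁ =ᶠ[𝓝 r] p₂ := by
    refine eventually_eq_of_linear
      (f := fun t => (P.α + 1) * P.force t (u₁ t / P.vel (p₁ t)) 1)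
      (continuousAt_const.mul (continuousAt_force hr.ne' hc1 continuousAt_const)) ?_ ?_ hp
    · filter_upwards [hJ', hpos1] with t ht hpt
      exact (h1 t ht).2.congr_deriv (by rw [P.force_eq_mul_of_pos_right hpt]; ring)
    · filter_upwards [hJ', hpos2, hy] with t ht hpt hyt
      exact (h2 t ht).2.congr_deriv (by rw [hyt, P.force_eq_mul_of_pos_right hpt]; ring)
  filter_upwards [hpp, hy, hpos1] with t hut hyt hpt
  refine ⟨?_, hut⟩
  rw [← hut] at hyt
  have := (P.vel_pos_iff.2 hpt).ne'
  field_simp at hyt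
  exact hyt

theorem eventually_eq_of_ne_zero (hJ : J ∈ 𝓝 r) (hr : 0 < r) (h1 : P.IsSolOn J u₁ p₁)
    (h2 : P.IsSolOn J u₂ p₂) (hu : u₁ r = u₂ r) (hp : p₁ r = p₂ r) (h0 : u₁ r ≠ 0 ∨ p₁ r ≠ 0) :
    ∀ᶠ t in 𝓝 r, u₁ t = u₂ t ∧ p₁ t = p₂ t := by
  rcases h0 with h0 | h0 <;> rcases lt_or_gt_of_ne h0 with h | h
  · have := eventually_eq_of_pos hJ hr h1.neg h2.neg (by simp [hu]) (by simp [hp]) (by simpa using h)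
    simpa using this
  · exact eventually_eq_of_pos hJ hr h1 h2 hu hp h
  · have := eventually_eq_of_pos_right hJ hr h1.neg h2.neg (by simp [hu]) (by simp [hp])
      (by simpa using h)
    simpa using this
  · exact eventually_eq_of_pos_right hJ hr h1 h2 hu hp h

theorem IsSolOn.ne_zero {c d r₀ : ℝ} (hc : 0 ≤ c) (h : P.IsSolOn (Ioo c d) u p)
    (hr₀ : r₀ ∈ Ioo c d) (h0 : u r₀ ≠ 0 ∨ p r₀ ≠ 0) : ∀ r ∈ Ioo c d, u r ≠ 0 ∨ p r ≠ 0 := by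
  intro r hr
  by_contra! hz
  have hcu : ∀ J : Set ℝ, J ⊆ Ioo c d → ContinuousOn u J := fun J hJ x hx =>
    (h.continuousAt_fst (hJ hx)).continuousWithinAt
  have hcp : ∀ J : Set ℝ, J ⊆ Ioo c d → ContinuousOn p J := fun J hJ x hx =>
    (h.continuousAt_snd (hJ hx)).continuousWithinAt
  have hzero : u r₀ = 0 ∧ p r₀ = 0 := by
    rcases le_total r r₀ with hle | hle
    · have hsub : Ico r d ⊆ Ioo c d := fun x hx => ⟨hr.1.trans_le hx.1, hx.2⟩
      exact (h.mono (Ioo_subset_Ico_self.trans hsub)).isSolOffZero.eq_zero_right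
        (hc.trans hr.1.le) (hcu _ hsub) (hcp _ hsub) hz.1 hz.2 r₀ ⟨hle, hr₀.2⟩
    · have hm : c < (c + r₀) / 2 := by linarith [hr₀.1]
      have hsub : Ioc ((c + r₀) / 2) r ⊆ Ioo c d := fun x hx =>
        ⟨hm.trans hx.1, hx.2.trans_lt hr.2⟩
      exact (h.mono (Ioo_subset_Ioc_self.trans hsub)).isSolOffZero.eq_zero_left
        (hc.trans_lt hm) (hcu _ hsub) (hcp _ hsub) hz.1 hz.2 r₀ ⟨by linarith [hr₀.1], hle⟩
  exact h0.elim (fun h => h hzero.1) fun h => h hzero.2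

/-- The set of local agreement is open, and relatively closed because local uniqueness applies at
every limit point: nondegeneracy at r₀ persists on the whole interval. -/
theorem IsSolOn.eqOn {c d r₀ : ℝ} (hc : 0 ≤ c) (h1 : P.IsSolOn (Ioo c d) u₁ p₁)
    (h2 : P.IsSolOn (Ioo c d) u₂ p₂) (hr₀ : r₀ ∈ Ioo c d) (hu : u₁ r₀ = u₂ r₀)
    (hp : p₁ r₀ = p₂ r₀) (h0 : u₁ r₀ ≠ 0 ∨ p₁ r₀ ≠ 0) :
    ∀ r ∈ Ioo c d, u₁ r = u₂ r ∧ p₁ r = p₂ r := by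
  have hne := h1.ne_zero hc hr₀ h0
  have hloc : ∀ r ∈ Ioo c d, u₁ r = u₂ r → p₁ r = p₂ r →
      ∀ᶠ t in 𝓝 r, u₁ t = u₂ t ∧ p₁ t = p₂ t := fun r hr hur hpr =>
    eventually_eq_of_ne_zero (Ioo_mem_nhds hr.1 hr.2) (hc.trans_lt hr.1) h1 h2 hur hpr (hne r hr)
  have := isPreconnected_Ioo.subset_of_closure_inter_subset (s := Ioo c d)
    (u := {r | ∀ᶠ t in 𝓝 r, u₁ t = u₂ t ∧ p₁ t = p₂ t}) isOpen_setOfPred_eventually_nhds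
    ⟨r₀, hr₀, hloc r₀ hr₀ hu hp⟩ ?_
  · exact fun r hr => (this hr).self_of_nhds
  · rintro r ⟨hcl, hr⟩
    have hfr : ∃ᶠ t in 𝓝 r, u₁ t = u₂ t ∧ p₁ t = p₂ t :=
      (mem_closure_iff_frequently.1 hcl).mono fun t ht => ht.self_of_nhds
    have e1 : u₁ r = u₂ r := by
      by_contra hcon
      have := ((h1.continuousAt_fst hr).ne_iff_eventually_ne (h2.continuousAt_fst hr)).1 hcon
      obtain ⟨t, ht1, ht2⟩ := (hfr.and_eventually this).exists
      exact ht2 ht1.1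
    have e2 : p₁ r = p₂ r := by
      by_contra hcon
      have := ((h1.continuousAt_snd hr).ne_iff_eventually_ne (h2.continuousAt_snd hr)).1 hcon
      obtain ⟨t, ht1, ht2⟩ := (hfr.and_eventually this).exists
      exact ht2 ht1.2
    exact hloc r hr e1 e2

/-! ### Uniqueness from the singular point r = 0 -/

theorem mul_force_sub_nonpos (hr : 0 < r) (y₁ y₂ : ℝ) :
    (y₁ - y₂) * (P.force r 1 y₁ - P.force r 1 y₂) ≤ 0 := by
  have hmono : ∀ x y, x ≤ y → P.force r 1 y ≤ P.force r 1 x := by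
    intro x y hxy
    refine (strictMono_pucci (inv_pos.2 P.a_pos) (inv_pos.2 P.A_pos)).monotone ?_
    have := mul_le_mul_of_nonneg_left ((strictMono_pucci P.a_pos P.A_pos).monotone hxy)
      (div_nonneg P.ν_nonneg hr.le)
    linarith
  rcases le_total y₁ y₂ with h | h
  · exact mul_nonpos_of_nonpos_of_nonneg (by linarith) (by linarith [hmono _ _ h])
  · exact mul_nonpos_of_nonneg_of_nonpos (by linarith) (by linarith [hmono _ _ h])

/-- In the derivative of (y₁ - y₂)² the term with ν/r has a favourable sign, so Gronwall needs only
the Lipschitz bound of |y|^(1+γ) on [-1, 1]. -/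
theorem IsSolOn.eqOn_of_tendsto_of_pos {R s : ℝ} (hR : 0 < R) (h1 : P.IsSolOn (Ioo 0 R) u₁ p₁)
    (h2 : P.IsSolOn (Ioo 0 R) u₂ p₂) (hs : 0 < s) (hu1 : Tendsto u₁ (𝓝[>] 0) (𝓝 s))
    (hu2 : Tendsto u₂ (𝓝[>] 0) (𝓝 s)) (hp1 : Tendsto p₁ (𝓝[>] 0) (𝓝 0))
    (hp2 : Tendsto p₂ (𝓝[>] 0) (𝓝 0)) : ∀ r ∈ Ioo 0 R, u₁ r = u₂ r ∧ p₁ r = p₂ r := by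
  have hM := P.mom_pos_iff.2 hs
  have hy : ∀ {u p : ℝ → ℝ}, Tendsto u (𝓝[>] 0) (𝓝 s) → Tendsto p (𝓝[>] 0) (𝓝 0) →
      Tendsto (fun t => p t / P.mom (u t)) (𝓝[>] 0) (𝓝 0) := by
    intro u p hu hp
    have := hp.div ((P.continuous_mom.tendsto s).comp hu) hM.ne'
    rwa [zero_div] at this
  have hy1 := hy hu1 hp1
  have hy2 := hy hu2 hp2
  have hb : ∀ {y : ℝ → ℝ}, Tendsto y (𝓝[>] 0) (𝓝 0) → ∀ᶠ t in 𝓝[>] 0, |y t| < 1 := by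
    intro y hy
    have := hy.abs
    rw [abs_zero] at this
    exact this.eventually (gt_mem_nhds zero_lt_one)
  have hev0 : ∀ᶠ t in 𝓝[>] (0 : ℝ), t ∈ Ioo 0 R := Ioo_mem_nhdsGT hR
  have hev := hev0.and
    ((hu1.eventually (lt_mem_nhds hs)).and ((hu2.eventually (lt_mem_nhds hs)).and
      ((hb hy1).and (hb hy2))))
  obtain ⟨δ, hδ, hsub⟩ := mem_nhdsGT_iff_exists_Ioo_subset.1 hev
  have hδ : 0 < δ := hδ
  set y₁ := fun t => p₁ t / P.mom (u₁ t) with hy₁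
  set y₂ := fun t => p₂ t / P.mom (u₂ t) with hy₂
  have hd1 : ∀ t ∈ Ioo 0 δ, HasDerivAt y₁ (P.riccati t (y₁ t)) t := fun t ht =>
    hasDerivAt_riccati (h1 t (hsub ht).1).1 (h1 t (hsub ht).1).2 (hsub ht).2.1
  have hd2 : ∀ t ∈ Ioo 0 δ, HasDerivAt y₂ (P.riccati t (y₂ t)) t := fun t ht =>
    hasDerivAt_riccati (h2 t (hsub ht).1).1 (h2 t (hsub ht).1).2 (hsub ht).2.2.1
  have hyy : ∀ t ∈ Ioo 0 δ, y₁ t = y₂ t := by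
    have := nonpos_of_deriv_le_mul_right (D := fun t => (y₁ t - y₂ t) ^ 2) (c := 0) (d := δ)
      (D' := fun t => 2 * (y₁ t - y₂ t) * (P.riccati t (y₁ t) - P.riccati t (y₂ t)))
      (C := 2 * ((P.α + 1) * (1 + P.γ))) ?_ ?_ ?_
    · intro t ht
      have h3 : (y₁ t - y₂ t) ^ 2 = 0 := le_antisymm (this t ht) (sq_nonneg _)
      exact sub_eq_zero.1 (pow_eq_zero_iff two_ne_zero |>.1 h3)
    · intro t ht
      refine (((hd1 t ht).sub (hd2 t ht)).pow 2).congr_deriv ?_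
      simp
    · intro t ht
      have hα := P.α_add_one_pos
      have e1 := mul_force_sub_nonpos (P := P) ht.1 (y₁ t) (y₂ t)
      have e2 := P.abs_mul_vel_sub_le (hsub ht).2.2.2.1.le (hsub ht).2.2.2.2.le
      rw [Real.one_rpow, mul_one] at e2
      have e3 : -((y₁ t - y₂ t) * (y₁ t * P.vel (y₁ t) - y₂ t * P.vel (y₂ t)))
          ≤ (1 + P.γ) * (y₁ t - y₂ t) ^ 2 := by
        calc _ ≤ |(y₁ t - y₂ t) * (y₁ t * P.vel (y₁ t) - y₂ t * P.vel (y₂ t))| := neg_le_abs _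
          _ = |y₁ t - y₂ t| * |y₁ t * P.vel (y₁ t) - y₂ t * P.vel (y₂ t)| := abs_mul _ _
          _ ≤ |y₁ t - y₂ t| * ((1 + P.γ) * |y₁ t - y₂ t|) := by gcongr
          _ = (1 + P.γ) * (|y₁ t - y₂ t| ^ 2) := by ring
          _ = _ := by rw [sq_abs]
      have e4 := mul_le_mul_of_nonneg_left (add_le_add e1 e3) (mul_pos two_pos hα).le
      simp only [riccati]
      linarith
    · have := (hy1.sub hy2).pow 2
      simpa using this
  -- Equal y means equal logarithmic derivatives of u₁ and u₂, so their quotient is constant with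
  -- limit 1.
  have huu : ∀ t ∈ Ioo 0 δ, u₁ t = u₂ t := by
    have := nonpos_of_deriv_le_mul_right (D := fun t => (u₁ t / u₂ t - 1) ^ 2) (c := 0) (d := δ)
      (D' := fun t => 0) (C := 0) ?_ ?_ ?_
    · intro t ht
      have h3 : (u₁ t / u₂ t - 1) ^ 2 = 0 := le_antisymm (this t ht) (sq_nonneg _)
      have h4 := sub_eq_zero.1 (pow_eq_zero_iff two_ne_zero |>.1 h3)
      rwa [div_eq_one_iff_eq (hsub ht).2.2.1.ne'] at h4
    · intro t ht
      have e1 := (hsub ht).2.1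
      have e2 := (hsub ht).2.2.1
      have hdu := ((h1 t (hsub ht).1).1.div (h2 t (hsub ht).1).1 e2.ne')
      refine ((hdu.sub_const 1).pow 2).congr_deriv ?_
      have e3 : P.vel (p₁ t) * u₂ t - u₁ t * P.vel (p₂ t) = 0 := by
        rw [P.vel_eq_mul_of_pos e1 (p₁ t), P.vel_eq_mul_of_pos e2 (p₂ t)]
        have := hyy t ht
        simp only [hy₁, hy₂] at this
        rw [this]; ring
      rw [e3]; simp
    · simp
    · have := ((hu1.div hu2 hs.ne').sub_const 1).pow 2
      simpa [hs.ne'] using this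
  have hδ2 : δ / 2 ∈ Ioo 0 δ := ⟨by linarith, by linarith⟩
  have e1 := (hsub hδ2).2.1
  refine h1.eqOn le_rfl h2 (hsub hδ2).1 (huu _ hδ2) ?_ (Or.inl e1.ne')
  have := hyy _ hδ2
  simp only [hy₁, hy₂, ← huu _ hδ2] at this
  have e2 := (P.mom_pos_iff.2 e1).ne'
  field_simp at this
  exact this

theorem IsSolOn.eqOn_of_tendsto {R s : ℝ} (hR : 0 < R) (h1 : P.IsSolOn (Ioo 0 R) u₁ p₁)
    (h2 : P.IsSolOn (Ioo 0 R) u₂ p₂) (hs : s ≠ 0) (hu1 : Tendsto u₁ (𝓝[>] 0) (𝓝 s))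
    (hu2 : Tendsto u₂ (𝓝[>] 0) (𝓝 s)) (hp1 : Tendsto p₁ (𝓝[>] 0) (𝓝 0))
    (hp2 : Tendsto p₂ (𝓝[>] 0) (𝓝 0)) : ∀ r ∈ Ioo 0 R, u₁ r = u₂ r ∧ p₁ r = p₂ r := by
  rcases lt_or_gt_of_ne hs with h | h
  · have := h1.neg.eqOn_of_tendsto_of_pos hR h2.neg (neg_pos.2 h) hu1.neg hu2.neg
      (by simpa using hp1.neg) (by simpa using hp2.neg)
    simpa using this
  · exact h1.eqOn_of_tendsto_of_pos hR h2 h hu1 hu2 hp1 hp2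

end RadialParams

namespace RadialParams

variable {P : RadialParams} {u p y z : ℝ → ℝ} {r : ℝ}

/-! ### Local existence -/

theorem hasDerivAt_of_riccati (h0 : 0 < u r) (hy : HasDerivAt y (P.riccati r (y r)) r)
    (hu : HasDerivAt u (P.vel (y r) * u r) r) :
    HasDerivAt u (P.vel (y r * P.mom (u r))) r ∧
      HasDerivAt (fun t => y t * P.mom (u t))
        ((P.α + 1) * P.force r (u r) (y r * P.mom (u r))) r := by
  have hM := P.mom_pos_iff.2 h0
  refine ⟨hu.congr_deriv (by rw [vel_mul, vel_mom]), ?_⟩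
  have h1 : HasDerivAt (fun x => P.mom (u x)) ((P.α + 1) * |u r| ^ P.α * (P.vel (y r) * u r)) r :=
    (hasDerivAt_signedPow (β := P.α) h0.ne').comp r hu
  refine (hy.mul h1).congr_deriv ?_
  have h2 : |u r| ^ P.α * u r = P.mom (u r) := rfl
  rw [force_eq_mul_of_pos P h0, mul_div_cancel_right₀ _ hM.ne', riccati]
  linear_combination (P.α + 1) * y r * P.vel (y r) * h2

theorem hasDerivAt_of_coriccati (h0 : 0 < p r) (hz : HasDerivAt z (P.coriccati r (z r)) r)
    (hp : HasDerivAt p ((P.α + 1) * P.force r (z r) 1 * p r) r) :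
    HasDerivAt (fun t => z t * P.vel (p t)) (P.vel (p r)) r ∧
      HasDerivAt p ((P.α + 1) * P.force r (z r * P.vel (p r)) (p r)) r := by
  have hV := P.vel_pos_iff.2 h0
  have e : P.force r (z r * P.vel (p r)) (p r) = p r * P.force r (z r) 1 := by
    rw [force_eq_mul_of_pos_right P h0, mul_div_cancel_right₀ _ hV.ne']
  have hp' : HasDerivAt p ((P.α + 1) * P.force r (z r * P.vel (p r)) (p r)) r :=
    hp.congr_deriv (by rw [e]; ring)
  refine ⟨?_, hp'⟩
  have h1 := hasDerivAt_vel_of_pos (u := fun t => z t * P.vel (p t)) hp' h0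
  rw [mul_div_cancel_right₀ _ hV.ne'] at h1
  refine (hz.mul h1).congr_deriv ?_
  rw [coriccati]; ring

theorem exists_primitive {f : ℝ → ℝ} {c d : ℝ} (hcd : c ≤ d) (hf : ContinuousOn f (Icc c d))
    (r₀ : ℝ) : ∃ F : ℝ → ℝ, F r₀ = 0 ∧ ∀ t ∈ Ioo c d, HasDerivAt F (f t) t := by
  -- The extension by constants outside [c, d] makes the integrand globally continuous, so r₀ needs
  -- no relation to the interval.
  have hg : Continuous (IccExtend hcd (domRestrict (Icc c d) f)) :=
    (continuousOn_iff_continuous_domRestrict.1 hf).Icc_extend'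
  refine ⟨fun t => ∫ s in r₀..t, IccExtend hcd (domRestrict (Icc c d) f) s, by simp, fun t ht => ?_⟩
  have := hg.integral_hasStrictDerivAt r₀ t
  refine this.hasDerivAt.congr_deriv ?_
  rw [IccExtend_of_mem hcd _ (Ioo_subset_Icc_self ht)]; rfl

/-- Picard–Lindelöf in the unit ball around x₀, which lies in [-2, 2]. The admissible δ depends only
on L. -/
theorem exists_hasDerivAt_of_bounded {v : ℝ → ℝ → ℝ} {c L : ℝ} {K : NNReal} (hL : 0 ≤ L)
    (hK : ∀ r, c ≤ r → LipschitzOnWith K (v r) (Icc (-2) 2))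
    (hc : ∀ x, ContinuousOn (fun r => v r x) (Ici c))
    (hb : ∀ r, c ≤ r → ∀ x, |x| ≤ 2 → |v r x| ≤ L) {r₀ δ x₀ : ℝ} (hδ : 0 < δ) (hr₀ : c ≤ r₀ - δ)
    (hLδ : L * δ ≤ 1) (hx₀ : |x₀| ≤ 1) :
    ∃ y : ℝ → ℝ, y r₀ = x₀ ∧ ContinuousOn y (Icc (r₀ - δ) (r₀ + δ)) ∧
      ∀ t ∈ Ioo (r₀ - δ) (r₀ + δ), HasDerivAt y (v t (y t)) t := by
  have hball : ∀ x ∈ Metric.closedBall x₀ ((1 : NNReal) : ℝ), |x| ≤ 2 := by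
    intro x hx
    rw [Metric.mem_closedBall, Real.dist_eq, NNReal.coe_one] at hx
    have := abs_add_le (x - x₀) x₀
    rw [sub_add_cancel] at this
    linarith
  have hpl : IsPicardLindelof v (tmin := r₀ - δ) (tmax := r₀ + δ)
      ⟨r₀, by constructor <;> linarith⟩ x₀ 1 0 (Real.toNNReal L) K := by
    refine ⟨fun t ht => (hK t (hr₀.trans ht.1)).mono fun x hx => abs_le.1 (hball x hx),
      fun x _ => (hc x).mono fun t ht => hr₀.trans ht.1, fun t ht x hx => ?_, ?_⟩
    · rw [Real.coe_toNNReal _ hL]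
      exact hb t (hr₀.trans ht.1) x (hball x hx)
    · rw [Real.coe_toNNReal _ hL]
      simpa using hLδ
  obtain ⟨y, hy0, hy⟩ := hpl.exists_eq_forall_mem_Icc_hasDerivWithinAt₀
  refine ⟨y, hy0, fun t ht => (hy t ht).continuousWithinAt, fun t ht => ?_⟩
  exact (hy t (Ioo_subset_Icc_self ht)).hasDerivAt (Icc_mem_nhds ht.1 ht.2)

variable (P)

theorem continuousOn_riccati {c : ℝ} (hc : 0 < c) (x : ℝ) :
    ContinuousOn (fun r => P.riccati r x) (Ici c) := fun _ ht =>
  (continuousAt_const.mul ((continuousAt_force (hc.trans_le ht).ne' continuousAt_const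
    continuousAt_const).sub continuousAt_const)).continuousWithinAt

theorem continuousOn_coriccati {c : ℝ} (hc : 0 < c) (x : ℝ) :
    ContinuousOn (fun r => P.coriccati r x) (Ici c) := fun _ ht =>
  (continuousAt_const.sub (continuousAt_const.mul (continuousAt_force (hc.trans_le ht).ne'
    continuousAt_const continuousAt_const))).continuousWithinAt

theorem exists_bound_riccati {c : ℝ} (hc : 0 < c) :
    ∃ L, 0 ≤ L ∧ ∀ r, c ≤ r → ∀ x, |x| ≤ 2 → |P.riccati r x| ≤ L := by
  have ha := inv_pos.2 P.a_pos
  have hA := inv_pos.2 P.A_pos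
  have haA : 0 < P.a + P.A := add_pos P.a_pos P.A_pos
  have hν := P.ν_nonneg
  have hα := P.α_add_one_pos
  refine ⟨(P.α + 1) * ((P.a⁻¹ + P.A⁻¹) * (1 + P.ν / c * ((P.a + P.A) * 2)) + 2 ^ (1 + P.γ)),
    by positivity, fun r hr x hx => ?_⟩
  have h1 : |P.force r 1 x| ≤ (P.a⁻¹ + P.A⁻¹) * (1 + P.ν / c * ((P.a + P.A) * 2)) := by
    refine (abs_pucci_le ha hA _).trans ?_
    refine mul_le_mul_of_nonneg_left ?_ (by positivity)
    rw [mom_one]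
    refine (abs_sub _ _).trans ?_
    rw [abs_neg, abs_one, abs_mul, abs_of_nonneg (div_nonneg hν (hc.le.trans hr))]
    have := (abs_pucci_le P.a_pos P.A_pos x).trans (mul_le_mul_of_nonneg_left hx haA.le)
    gcongr
  have h2 : |x * P.vel x| ≤ 2 ^ (1 + P.γ) := by
    rw [mul_vel, abs_of_nonneg (by positivity)]
    have := P.γ_pos
    gcongr
  rw [riccati, abs_mul, abs_of_pos hα]
  gcongr
  exact (abs_sub _ _).trans (add_le_add h1 h2)

theorem exists_bound_coriccati {c : ℝ} (hc : 0 < c) :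
    ∃ L, 0 ≤ L ∧ ∀ r, c ≤ r → ∀ x, |x| ≤ 2 → |P.coriccati r x| ≤ L := by
  have ha := inv_pos.2 P.a_pos
  have hA := inv_pos.2 P.A_pos
  have hA' := P.A_pos
  have hν := P.ν_nonneg
  refine ⟨1 + 2 * ((P.a⁻¹ + P.A⁻¹) * (2 ^ (P.α + 1) + P.ν / c * P.A)), by positivity,
    fun r hr x hx => ?_⟩
  have h1 := P.abs_force_one_le hc hr hx
  rw [coriccati]
  refine (abs_sub _ _).trans ?_
  rw [abs_one, abs_mul]
  gcongr

/-- The solution is rebuilt from y as u = u₀ exp ∫ `vel y` and p = y `mom u`. The condition on p₀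
says |y| ≤ 1 initially, so the step depends on c alone and not on the size of the data. -/
theorem exists_isSolOn_of_riccati_chart {c : ℝ} (hc : 0 < c) :
    ∃ δ₀ > 0, ∀ δ, 0 < δ → δ ≤ δ₀ → ∀ r₀, c ≤ r₀ - δ → ∀ u₀ p₀ : ℝ, 0 < u₀ → |p₀| ≤ P.mom u₀ →
      ∃ u p, P.IsSolOn (Ioo (r₀ - δ) (r₀ + δ)) u p ∧ u r₀ = u₀ ∧ p r₀ = p₀ := by
  obtain ⟨L, hL, hb⟩ := P.exists_bound_riccati hc
  obtain ⟨K, hK⟩ := P.exists_lipschitz_riccati hc 2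
  refine ⟨1 / (L + 1), by positivity, fun δ hδ hδ₀ r₀ hr₀ u₀ p₀ hu₀ hp₀ => ?_⟩
  have hM := P.mom_pos_iff.2 hu₀
  have hLδ : L * δ ≤ 1 := by
    rw [le_div_iff₀ (by positivity)] at hδ₀
    nlinarith
  obtain ⟨y, hy0, hyc, hy⟩ := exists_hasDerivAt_of_bounded hL hK (P.continuousOn_riccati hc) hb hδ
    hr₀ hLδ (x₀ := p₀ / P.mom u₀) (by rwa [abs_div, abs_of_pos hM, div_le_one hM])
  obtain ⟨F, hF0, hF⟩ := exists_primitive (f := fun t => P.vel (y t)) (by linarith)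
    (P.continuous_vel.comp_continuousOn hyc) r₀
  refine ⟨fun t => u₀ * Real.exp (F t), fun t => y t * P.mom (u₀ * Real.exp (F t)), ?_, ?_, ?_⟩
  · intro t ht
    refine hasDerivAt_of_riccati (u := fun t => u₀ * Real.exp (F t)) (by positivity) (hy t ht) ?_
    exact ((hF t ht).exp.const_mul u₀).congr_deriv (by ring)
  · simp [hF0]
  · simp only [hF0, Real.exp_zero, mul_one, hy0]
    field_simp

theorem exists_isSolOn_of_coriccati_chart {c : ℝ} (hc : 0 < c) :
    ∃ δ₀ > 0, ∀ δ, 0 < δ → δ ≤ δ₀ → ∀ r₀, c ≤ r₀ - δ → ∀ u₀ p₀ : ℝ, 0 < p₀ → |u₀| ≤ P.vel p₀ →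
      ∃ u p, P.IsSolOn (Ioo (r₀ - δ) (r₀ + δ)) u p ∧ u r₀ = u₀ ∧ p r₀ = p₀ := by
  obtain ⟨L, hL, hb⟩ := P.exists_bound_coriccati hc
  obtain ⟨K, hK⟩ := P.exists_lipschitz_coriccati hc 2
  refine ⟨1 / (L + 1), by positivity, fun δ hδ hδ₀ r₀ hr₀ u₀ p₀ hp₀ hu₀ => ?_⟩
  have hV := P.vel_pos_iff.2 hp₀
  have hLδ : L * δ ≤ 1 := by
    rw [le_div_iff₀ (by positivity)] at hδ₀
    nlinarith
  obtain ⟨z, hz0, hzc, hz⟩ := exists_hasDerivAt_of_bounded hL hK (P.continuousOn_coriccati hc) hb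
    hδ hr₀ hLδ (x₀ := u₀ / P.vel p₀) (by rwa [abs_div, abs_of_pos hV, div_le_one hV])
  have hcont : ContinuousOn (fun t => (P.α + 1) * P.force t (z t) 1)
      (Icc (r₀ - δ) (r₀ + δ)) := by
    unfold force
    refine continuousOn_const.mul (continuous_pucci.comp_continuousOn ?_)
    refine ((P.continuous_mom.comp_continuousOn hzc).neg).sub ?_
    exact (continuousOn_const.div continuousOn_id
      fun t ht => (hc.trans_le (hr₀.trans ht.1)).ne').mul continuousOn_const
  obtain ⟨F, hF0, hF⟩ := exists_primitive (by linarith) hcont r₀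
  refine ⟨fun t => z t * P.vel (p₀ * Real.exp (F t)), fun t => p₀ * Real.exp (F t), ?_, ?_, ?_⟩
  · intro t ht
    refine hasDerivAt_of_coriccati (p := fun t => p₀ * Real.exp (F t)) (by positivity) (hz t ht) ?_
    exact ((hF t ht).exp.const_mul p₀).congr_deriv (by ring)
  · simp only [hF0, Real.exp_zero, mul_one, hz0]
    field_simp
  · simp [hF0]

theorem exists_isSolOn_of_pos {c : ℝ} (hc : 0 < c) :
    ∃ δ₀ > 0, ∀ δ, 0 < δ → δ ≤ δ₀ → ∀ r₀, c ≤ r₀ - δ → ∀ u₀ p₀ : ℝ,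
      (0 < u₀ ∧ |p₀| ≤ P.mom u₀) ∨ (0 < p₀ ∧ |u₀| ≤ P.vel p₀) →
      ∃ u p, P.IsSolOn (Ioo (r₀ - δ) (r₀ + δ)) u p ∧ u r₀ = u₀ ∧ p r₀ = p₀ := by
  obtain ⟨δ₁, h1, H1⟩ := P.exists_isSolOn_of_riccati_chart hc
  obtain ⟨δ₂, h2, H2⟩ := P.exists_isSolOn_of_coriccati_chart hc
  refine ⟨min δ₁ δ₂, lt_min h1 h2, fun δ hδ hle r₀ hr₀ u₀ p₀ h => ?_⟩
  rcases h with h | h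
  · exact H1 δ hδ (hle.trans (min_le_left _ _)) r₀ hr₀ u₀ p₀ h.1 h.2
  · exact H2 δ hδ (hle.trans (min_le_right _ _)) r₀ hr₀ u₀ p₀ h.1 h.2

theorem abs_vel (p : ℝ) : |P.vel p| = P.vel |p| := by
  rcases le_total 0 p with h | h
  · rw [abs_of_nonneg h, abs_of_nonneg (a := P.vel p) (signedPow_nonneg h)]
  · rw [abs_of_nonpos h, abs_of_nonpos (a := P.vel p) (signedPow_nonpos h), vel_neg]

theorem abs_mom (p : ℝ) : |P.mom p| = P.mom |p| := by
  rcases le_total 0 p with h | h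
  · rw [abs_of_nonneg h, abs_of_nonneg (a := P.mom p) (signedPow_nonneg h)]
  · rw [abs_of_nonpos h, abs_of_nonpos (a := P.mom p) (signedPow_nonpos h), mom_neg]

theorem abs_vel_le_of_abs_le {x y : ℝ} (h : |x| ≤ |y|) : |P.vel x| ≤ |P.vel y| := by
  rw [vel, vel, abs_signedPow (by linarith [P.γ_pos]), abs_signedPow (by linarith [P.γ_pos])]
  have := P.γ_pos
  gcongr
  linarith

/-- Local existence with a step that is uniform away from the origin. -/
theorem exists_isSolOn {c : ℝ} (hc : 0 < c) :
    ∃ δ₀ > 0, ∀ δ, 0 < δ → δ ≤ δ₀ → ∀ r₀, c + δ ≤ r₀ → ∀ u₀ p₀ : ℝ, u₀ ≠ 0 ∨ p₀ ≠ 0 →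
      ∃ u p, P.IsSolOn (Ioo (r₀ - δ) (r₀ + δ)) u p ∧ u r₀ = u₀ ∧ p r₀ = p₀ := by
  obtain ⟨δ₁, h1, H1⟩ := P.exists_isSolOn_of_pos hc
  obtain ⟨δ₂, h2, H2⟩ := P.swap.exists_isSolOn_of_pos hc
  refine ⟨min δ₁ δ₂, lt_min h1 h2, fun δ hδ hle r₀ hr₀ u₀ p₀ h0 => ?_⟩
  have G1 := H1 _ hδ (hle.trans (min_le_left _ _)) r₀ (by linarith)
  have G2 : ∀ u₀ p₀ : ℝ, (u₀ < 0 ∧ |p₀| ≤ P.mom (-u₀)) ∨ (p₀ < 0 ∧ |u₀| ≤ P.vel (-p₀)) →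
      ∃ u p, P.IsSolOn (Ioo (r₀ - δ) (r₀ + δ)) u p ∧ u r₀ = u₀ ∧ p r₀ = p₀ := by
    intro u₀ p₀ h
    obtain ⟨u, p, h3, h4, h5⟩ := H2 _ hδ (hle.trans (min_le_right _ _)) r₀ (by linarith) (-u₀) (-p₀)
      (by simpa using h)
    exact ⟨fun r => -u r, fun r => -p r, h3.neg, by simp [h4], by simp [h5]⟩
  -- Since `vel` inverts `mom` and preserves the order of absolute values, the second case gives
  -- |u₀| ≤ |`vel p₀`|: one of the two charts always applies.
  rcases le_total |p₀| |P.mom u₀| with h | h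
  · have hu : u₀ ≠ 0 := by
      rintro rfl
      simp at h
      simp [h] at h0
    rw [abs_mom] at h
    rcases lt_or_gt_of_ne hu with hu | hu
    · rw [abs_of_neg hu] at h
      exact G2 u₀ p₀ (Or.inl ⟨hu, h⟩)
    · rw [abs_of_pos hu] at h
      exact G1 u₀ p₀ (Or.inl ⟨hu, h⟩)
  · have hp : p₀ ≠ 0 := by
      rintro rfl
      simp [mom_eq_zero_iff] at h
      simp [h] at h0
    have h := P.abs_vel_le_of_abs_le h
    rw [vel_mom, abs_vel] at h
    rcases lt_or_gt_of_ne hp with hp | hp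
    · rw [abs_of_neg hp] at h
      exact G2 u₀ p₀ (Or.inr ⟨hp, h⟩)
    · rw [abs_of_pos hp] at h
      exact G1 u₀ p₀ (Or.inr ⟨hp, h⟩)

end RadialParams

/-! ### The singular initial value problem at the origin -/

section SingularODE

variable {κ b l e : ℝ}

/-- The truncated power `min |y| 1 ^ e`. -/
noncomputable def truncPow (e y : ℝ) : ℝ := min |y| 1 ^ e

theorem truncPow_nonneg (y : ℝ) : 0 ≤ truncPow e y := by
  unfold truncPow
  exact Real.rpow_nonneg (le_min (abs_nonneg y) zero_le_one) _

theorem truncPow_le_one (he : 0 ≤ e) (y : ℝ) : truncPow e y ≤ 1 :=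
  Real.rpow_le_one (le_min (abs_nonneg y) zero_le_one) (min_le_right _ _) he

theorem continuous_truncPow (he : 0 ≤ e) : Continuous (truncPow e) := by
  unfold truncPow
  exact (continuous_abs.min continuous_const).rpow_const fun _ => Or.inr he

theorem truncPow_of_abs_le_one {y : ℝ} (hy : |y| ≤ 1) : truncPow e y = |y| ^ e := by
  rw [truncPow, min_eq_left hy]

theorem truncPow_le_abs (he : 1 ≤ e) {y : ℝ} (hy : |y| ≤ 1) : truncPow e y ≤ |y| := by
  rw [truncPow_of_abs_le_one hy]
  exact Real.rpow_le_self_of_le_one (abs_nonneg y) hy he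

theorem abs_truncPow_sub_le (he : 1 < e) (x y : ℝ) :
    |truncPow e x - truncPow e y| ≤ e * |x - y| := by
  have h0 : ∀ x : ℝ, 0 ≤ min |x| 1 := fun x => le_min (abs_nonneg x) zero_le_one
  have h1 : ∀ x : ℝ, |min |x| 1| ≤ 1 := fun x => by
    rw [abs_of_nonneg (h0 x)]; exact min_le_right _ _
  have h2 := abs_abs_rpow_sub_le he (h1 x) (h1 y)
  rw [abs_of_nonneg (h0 x), abs_of_nonneg (h0 y), Real.one_rpow, mul_one] at h2
  refine h2.trans (mul_le_mul_of_nonneg_left ?_ (by linarith))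
  have h3 := abs_min_sub_min_le_max |x| 1 |y| 1
  simp only [sub_self, abs_zero] at h3
  rw [max_eq_left (abs_nonneg _)] at h3
  exact h3.trans (abs_abs_sub_abs_le x y)

/-- The integrand of the fixed point equation. -/
noncomputable def singularKernel (κ b e : ℝ) (y : ℝ → ℝ) (r t : ℝ) : ℝ :=
  t ^ κ * (b + truncPow e (y (r * t)))

theorem continuous_singularKernel (hκ : 0 ≤ κ) (he : 0 ≤ e) {y : ℝ → ℝ} (hy : Continuous y) :
    Continuous fun x : ℝ × ℝ => singularKernel κ b e y x.1 x.2 := by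
  unfold singularKernel
  have h1 : Continuous fun x : ℝ × ℝ => x.2 ^ κ := continuous_snd.rpow_const fun _ => Or.inr hκ
  have h2 : Continuous fun x : ℝ × ℝ => truncPow e (y (x.1 * x.2)) :=
    (continuous_truncPow he).comp (hy.comp (continuous_fst.mul continuous_snd))
  fun_prop

theorem abs_singularKernel_le (hκ : 0 ≤ κ) (hb : 0 ≤ b) (he : 0 ≤ e) (y : ℝ → ℝ) (r : ℝ) {t : ℝ}
    (ht : t ∈ Ioc (0 : ℝ) 1) : |singularKernel κ b e y r t| ≤ b + 1 := by
  have h1 : 0 ≤ t ^ κ := Real.rpow_nonneg ht.1.le _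
  have h2 : t ^ κ ≤ 1 := Real.rpow_le_one ht.1.le ht.2 hκ
  have h3 := truncPow_nonneg (e := e) (y (r * t))
  have h4 := truncPow_le_one he (y (r * t))
  rw [singularKernel, abs_of_nonneg (by positivity)]
  calc _ ≤ 1 * (b + 1) := by gcongr
    _ = _ := one_mul _

theorem abs_singularKernel_sub_le (hκ : 0 ≤ κ) (he : 1 < e) (y₁ y₂ : ℝ → ℝ) (r : ℝ) {t C : ℝ}
    (hC : ∀ s, |y₁ s - y₂ s| ≤ C) (ht : t ∈ Ioc (0 : ℝ) 1) :
    |singularKernel κ b e y₁ r t - singularKernel κ b e y₂ r t| ≤ e * C := by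
  have h1 : 0 ≤ t ^ κ := Real.rpow_nonneg ht.1.le _
  have h2 : t ^ κ ≤ 1 := Real.rpow_le_one ht.1.le ht.2 hκ
  rw [singularKernel, singularKernel, ← mul_sub, abs_mul, abs_of_nonneg h1, add_sub_add_left_eq_sub]
  calc _ ≤ 1 * (e * |y₁ (r * t) - y₂ (r * t)|) := by
        gcongr; exact abs_truncPow_sub_le he _ _
    _ ≤ 1 * (e * C) := by gcongr; exact hC _
    _ = _ := one_mul _

/-- This is the integrated form of (r^κ y)' = -l r^κ (b + |y|^e), rescaled to the unit interval so
that no singularity at r = 0 remains. The truncation makes the integral operator globally Lipschitz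
and bounded, hence a contraction of the bounded continuous functions for small δ. -/
theorem exists_fixedPoint_singular (hκ : 0 ≤ κ) (hb : 0 ≤ b) (he : 1 < e) (hl : 0 ≤ l) {δ : ℝ}
    (hδ : 0 ≤ δ) (hcontr : l * δ * e ≤ 1 / 2) :
    ∃ y : ℝ → ℝ, Continuous y ∧
      ∀ r ∈ Icc 0 δ, y r = -(l * r * ∫ t in (0 : ℝ)..1, singularKernel κ b e y r t) := by
  have he0 : 0 ≤ e := by linarith
  -- Clamping r to [0, δ] lets the operator act on functions on all of ℝ.
  set c : ℝ → ℝ := fun r => max 0 (min r δ) with hc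
  have hcc : Continuous c := continuous_const.max (continuous_id.min continuous_const)
  have hc0 : ∀ r, 0 ≤ c r := fun r => le_max_left _ _
  have hcδ : ∀ r, c r ≤ δ := fun r => max_le hδ (min_le_right _ _)
  have hcont : ∀ y : BoundedContinuousFunction ℝ ℝ, Continuous fun r =>
      -(l * c r * ∫ t in (0 : ℝ)..1, singularKernel κ b e y (c r) t) := by
    intro y
    refine ((continuous_const.mul hcc).mul ?_).neg
    refine intervalIntegral.continuous_parametric_intervalIntegral_of_continuous'
      (f := fun r t => singularKernel κ b e y (c r) t) ?_ 0 1
    exact (continuous_singularKernel hκ he0 y.continuous).comp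
      ((hcc.comp continuous_fst).prodMk continuous_snd)
  have hint : ∀ (y : BoundedContinuousFunction ℝ ℝ) (r : ℝ), IntervalIntegrable
      (fun t => singularKernel κ b e y r t) MeasureTheory.volume 0 1 := fun y r =>
    ((continuous_singularKernel hκ he0 y.continuous).comp
      (continuous_const.prodMk continuous_id)).intervalIntegrable 0 1
  have hbound : ∀ (y : BoundedContinuousFunction ℝ ℝ) (r : ℝ),
      ‖-(l * c r * ∫ t in (0 : ℝ)..1, singularKernel κ b e y (c r) t)‖ ≤ l * δ * (b + 1) := by
    intro y r
    have := intervalIntegral.norm_integral_le_of_norm_le_const (a := (0 : ℝ)) (b := 1)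
      (f := fun t => singularKernel κ b e y (c r) t) (C := b + 1) fun t ht => by
        rw [uIoc_of_le zero_le_one] at ht
        exact abs_singularKernel_le hκ hb he0 y (c r) ht
    rw [norm_neg, norm_mul, Real.norm_of_nonneg (mul_nonneg hl (hc0 r))]
    simp only [sub_zero, abs_one, mul_one] at this
    have := hcδ r
    gcongr
  let T : BoundedContinuousFunction ℝ ℝ → BoundedContinuousFunction ℝ ℝ := fun y =>
    BoundedContinuousFunction.ofNormedAddCommGroup _ (hcont y) (l * δ * (b + 1)) (hbound y)
  have hT : ContractingWith (1 / 2) T := by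
    refine ⟨by rw [← NNReal.coe_lt_coe]; norm_num, LipschitzWith.of_dist_le_mul fun y₁ y₂ => ?_⟩
    rw [BoundedContinuousFunction.dist_le (by positivity)]
    intro r
    have h1 : ∀ s, |y₁ s - y₂ s| ≤ dist y₁ y₂ := fun s => by
      rw [← Real.dist_eq]; exact BoundedContinuousFunction.dist_coe_le_dist s
    have h2 := intervalIntegral.norm_integral_le_of_norm_le_const (a := (0 : ℝ)) (b := 1)
      (f := fun t => singularKernel κ b e y₁ (c r) t - singularKernel κ b e y₂ (c r) t)
      (C := e * dist y₁ y₂) fun t ht => by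
        rw [uIoc_of_le zero_le_one] at ht
        exact abs_singularKernel_sub_le hκ he y₁ y₂ (c r) h1 ht
    rw [intervalIntegral.integral_sub (hint y₁ _) (hint y₂ _)] at h2
    simp only [sub_zero, abs_one, mul_one] at h2
    change |-(l * c r * ∫ t in (0 : ℝ)..1, singularKernel κ b e y₁ (c r) t) -
      -(l * c r * ∫ t in (0 : ℝ)..1, singularKernel κ b e y₂ (c r) t)| ≤ _
    rw [neg_sub_neg, ← mul_sub, abs_mul, abs_of_nonneg (mul_nonneg hl (hc0 r)), abs_sub_comm]
    calc _ ≤ l * δ * (e * dist y₁ y₂) := by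
          have := hcδ r
          gcongr
          exact h2
      _ = l * δ * e * dist y₁ y₂ := by ring
      _ ≤ 1 / 2 * dist y₁ y₂ := by gcongr
      _ = _ := by simp
  obtain ⟨Y, hY⟩ : ∃ Y, T Y = Y := ⟨ContractingWith.fixedPoint T hT, hT.fixedPoint_isFixedPt⟩
  refine ⟨Y, Y.continuous, fun r hr => ?_⟩
  have h1 := congrArg (fun y : BoundedContinuousFunction ℝ ℝ => y r) hY
  have h2 : c r = r := by rw [hc]; simp [hr.1, hr.2]
  have h3 : T Y r = -(l * c r * ∫ t in (0 : ℝ)..1, singularKernel κ b e Y (c r) t) := rfl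
  rw [h2] at h3
  rw [← h3]
  exact h1.symm

/-- The substitution s = rt turns the fixed point equation into y = -l r^(-κ) ∫₀^r f, which can be
differentiated. -/
theorem hasDerivAt_of_fixedPoint_singular (hκ : 0 ≤ κ) (he : 0 ≤ e) {δ : ℝ} {y : ℝ → ℝ}
    (hy : Continuous y)
    (hfix : ∀ r ∈ Icc 0 δ, y r = -(l * r * ∫ t in (0 : ℝ)..1, singularKernel κ b e y r t))
    {r : ℝ} (hr : r ∈ Ioo 0 δ) :
    HasDerivAt y (-(κ * y r / r) - l * (b + truncPow e (y r))) r := by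
  set f : ℝ → ℝ := fun s => s ^ κ * (b + truncPow e (y s)) with hf
  have hfc : Continuous f := by
    have h1 : Continuous fun s : ℝ => s ^ κ := continuous_id.rpow_const fun _ => Or.inr hκ
    have h2 : Continuous fun s : ℝ => truncPow e (y s) := (continuous_truncPow he).comp hy
    exact h1.mul (continuous_const.add h2)
  have heq : ∀ s ∈ Ioo 0 δ, y s = -(l * s ^ (-κ) * ∫ t in (0 : ℝ)..s, f t) := by
    intro s hs
    rw [hfix s (Ioo_subset_Icc_self hs)]
    have h1 := intervalIntegral.mul_integral_comp_mul_left (f := f) (a := 0) (b := 1) (c := s)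
    rw [mul_zero, mul_one] at h1
    have h2 : ∫ t in (0 : ℝ)..1, f (s * t) = ∫ t in (0 : ℝ)..1, s ^ κ * singularKernel κ b e y s t := by
      refine intervalIntegral.integral_congr fun t ht => ?_
      rw [uIcc_of_le zero_le_one] at ht
      simp only [hf, singularKernel]
      rw [Real.mul_rpow hs.1.le ht.1]; ring
    rw [h2, intervalIntegral.integral_const_mul] at h1
    rw [← h1, Real.rpow_neg hs.1.le]
    have := (Real.rpow_pos_of_pos hs.1 κ).ne'
    field_simp
  have hder : HasDerivAt (fun s => -(l * s ^ (-κ) * ∫ t in (0 : ℝ)..s, f t))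
      (-(l * (-κ * r ^ (-κ - 1)) * (∫ t in (0 : ℝ)..r, f t) + l * r ^ (-κ) * f r)) r := by
    have h1 := (Real.hasDerivAt_rpow_const (x := r) (p := -κ) (Or.inl hr.1.ne')).const_mul l
    exact (h1.mul (hfc.integral_hasStrictDerivAt 0 r).hasDerivAt).neg
  have h3 : y =ᶠ[𝓝 r] fun s => -(l * s ^ (-κ) * ∫ t in (0 : ℝ)..s, f t) := by
    filter_upwards [Ioo_mem_nhds hr.1 hr.2] with s hs using heq s hs
  refine (hder.congr_of_eventuallyEq h3).congr_deriv ?_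
  have h4 : r ^ (-κ - 1) = r ^ (-κ) / r := Real.rpow_sub_one hr.1.ne' _
  have h5 : r ^ (-κ) * r ^ κ = 1 := by rw [← Real.rpow_add hr.1]; simp
  rw [h4, hf]
  have h6 := heq r hr
  simp only
  have h7 : r ≠ 0 := hr.1.ne'
  rw [show -(l * (-κ * (r ^ (-κ) / r)) * (∫ t in (0 : ℝ)..r, f t)
      + l * r ^ (-κ) * (r ^ κ * (b + truncPow e (y r))))
    = -(κ * -(l * r ^ (-κ) * ∫ t in (0 : ℝ)..r, f t) / r)
      - (r ^ (-κ) * r ^ κ) * (l * (b + truncPow e (y r))) by ring, ← h6, h5, one_mul]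

theorem integral_singularKernel_bounds (hκ : 0 ≤ κ) (hb : 0 ≤ b) (he : 0 ≤ e) {y : ℝ → ℝ}
    (hy : Continuous y) {r η : ℝ}
    (hη : ∀ t ∈ Icc (0 : ℝ) 1, truncPow e (y (r * t)) ≤ η) :
    0 ≤ ∫ t in (0 : ℝ)..1, singularKernel κ b e y r t ∧
      ∫ t in (0 : ℝ)..1, singularKernel κ b e y r t ≤ (b + η) / (κ + 1) := by
  have hint : IntervalIntegrable (fun t => singularKernel κ b e y r t) MeasureTheory.volume 0 1 :=
    ((continuous_singularKernel hκ he hy).comp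
      (continuous_const.prodMk continuous_id)).intervalIntegrable 0 1
  constructor
  · refine intervalIntegral.integral_nonneg zero_le_one fun t ht => ?_
    exact mul_nonneg (Real.rpow_nonneg ht.1 _) (add_nonneg hb (truncPow_nonneg _))
  · have h1 : ∫ t in (0 : ℝ)..1, t ^ κ * (b + η) = (b + η) / (κ + 1) := by
      rw [intervalIntegral.integral_mul_const, integral_rpow (Or.inl (by linarith))]
      rw [Real.one_rpow, Real.zero_rpow (by linarith)]
      ring
    rw [← h1]
    refine intervalIntegral.integral_mono_on zero_le_one hint ?_ fun t ht => ?_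
    · exact ((continuous_id.rpow_const fun _ => Or.inr hκ).mul continuous_const).intervalIntegrable
        0 1
    · exact mul_le_mul_of_nonneg_left (by linarith [hη t ht]) (Real.rpow_nonneg ht.1 _)

end SingularODE

namespace RadialParams

variable (P : RadialParams)

/-- For u > 0 near the origin both Pucci arguments should be nonpositive. On that branch the Riccati
equation is y' = -κy/r - l(b + |y|^(1+γ)) with l = α+1, κ = lν and b = 1/a; its solution is then
shown to stay on the branch. -/
theorem exists_riccati_near_zero : ∃ δ > 0, ∃ y : ℝ → ℝ, Continuous y ∧ y 0 = 0 ∧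
    ∀ r ∈ Ioo 0 δ, HasDerivAt y (P.riccati r (y r)) r := by
  have ha := P.a_pos
  have hν := P.ν_nonneg
  have hl := P.α_add_one_pos
  have hγ := P.γ_pos
  set l := P.α + 1 with hldef
  set κ := l * P.ν with hκdef
  have hκ : 0 ≤ κ := mul_nonneg hl.le hν
  set b := P.a⁻¹ with hbdef
  have hb : 0 < b := inv_pos.2 ha
  -- The bound 1 makes the truncation inactive; the bound b/(κ+1) keeps the outer Pucci argument
  -- nonpositive.
  set η := min 1 (b / (κ + 1)) with hη
  have hη0 : 0 < η := lt_min one_pos (by positivity)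
  have he : 1 < 1 + P.γ := by linarith
  set δ := min (1 / (2 * (l * (1 + P.γ)))) (η / (l * (b + 1))) with hδ
  have hδ0 : 0 < δ := lt_min (by positivity) (by positivity)
  have hδ1 : l * δ * (1 + P.γ) ≤ 1 / 2 := by
    have : δ ≤ 1 / (2 * (l * (1 + P.γ))) := min_le_left _ _
    rw [le_div_iff₀ (by positivity)] at this
    linarith
  have hδ2 : l * δ * (b + 1) ≤ η := by
    have : δ ≤ η / (l * (b + 1)) := min_le_right _ _
    rw [le_div_iff₀ (by positivity)] at this
    linarith
  obtain ⟨y, hyc, hfix⟩ := exists_fixedPoint_singular hκ hb.le he hl.le hδ0.le hδ1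
  have hy1 : ∀ r ∈ Icc 0 δ, |y r| ≤ η := by
    intro r hr
    have h1 := integral_singularKernel_bounds hκ hb.le (by linarith) hyc (r := r) (η := 1)
      fun t _ => truncPow_le_one (e := 1 + P.γ) (by linarith) (y (r * t))
    have h2 : (b + 1) / (κ + 1) ≤ b + 1 := div_le_self (by positivity) (by linarith)
    rw [hfix r hr, abs_neg, abs_of_nonneg (mul_nonneg (mul_nonneg hl.le hr.1) h1.1)]
    refine le_trans ?_ hδ2
    have := hr.1
    have := hr.2
    exact mul_le_mul (by gcongr) (h1.2.trans h2) h1.1 (by positivity)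
  have htr : ∀ r ∈ Icc 0 δ, truncPow (1 + P.γ) (y r) ≤ b / (κ + 1) := fun r hr =>
    (truncPow_le_abs he.le ((hy1 r hr).trans (min_le_left _ _))).trans
      ((hy1 r hr).trans (min_le_right _ _))
  refine ⟨δ, hδ0, y, hyc, by rw [hfix 0 ⟨le_rfl, hδ0.le⟩]; simp, fun r hr => ?_⟩
  have hr' := Ioo_subset_Icc_self hr
  refine (hasDerivAt_of_fixedPoint_singular hκ (by linarith) hyc hfix hr).congr_deriv ?_
  have h1 := integral_singularKernel_bounds hκ hb.le (e := 1 + P.γ) (by linarith) hyc (r := r)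
    (η := b / (κ + 1)) fun t ht => htr _ ⟨mul_nonneg hr.1.le ht.1, by nlinarith [ht.2, hr.1, hr.2]⟩
  set I := ∫ t in (0 : ℝ)..1, singularKernel κ b (1 + P.γ) y r t
  have hyI : y r = -(l * r * I) := hfix r hr'
  have hy0 : y r ≤ 0 := by
    rw [hyI]; exact neg_nonpos.2 (mul_nonneg (mul_nonneg hl.le hr.1.le) h1.1)
  -- With the chosen η this reduces to κ(κ+2) ≤ (κ+1)².
  have harg : -1 - P.ν / r * (P.a * y r) ≤ 0 := by
    have h2 : P.ν / r * (P.a * y r) = -(κ * P.a * I) := by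
      rw [hyI, hκdef]; field_simp [hr.1.ne']
    have h3 : κ * P.a * I ≤ 1 := by
      calc κ * P.a * I ≤ κ * P.a * ((b + b / (κ + 1)) / (κ + 1)) := by gcongr; exact h1.2
        _ = (P.a * b) * (κ * (κ + 2) / (κ + 1) ^ 2) := by field_simp; ring
        _ = κ * (κ + 2) / (κ + 1) ^ 2 := by rw [hbdef, mul_inv_cancel₀ ha.ne', one_mul]
        _ ≤ 1 := by rw [div_le_one (by positivity)]; nlinarith
    linarith
  rw [riccati, mul_vel, force, mom_one, pucci_of_nonpos hy0, pucci_of_nonpos harg,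
    truncPow_of_abs_le_one ((hy1 r hr').trans (min_le_left _ _))]
  have h4 : r ≠ 0 := hr.1.ne'
  have h5 : P.a⁻¹ * P.a = 1 := inv_mul_cancel₀ ha.ne'
  rw [← hldef, hκdef, ← hbdef] at *
  have h6 : b * (-1 - P.ν / r * (P.a * y r)) = -b - (b * P.a) * (P.ν * y r / r) := by ring
  rw [h6, h5]; ring

theorem exists_isSolOn_near_zero : ∃ δ > 0, ∃ u p : ℝ → ℝ, P.IsSolOn (Ioo 0 δ) u p ∧
    Tendsto u (𝓝[>] 0) (𝓝 1) ∧ Tendsto p (𝓝[>] 0) (𝓝 0) := by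
  obtain ⟨δ, hδ, y, hyc, hy0, hy⟩ := P.exists_riccati_near_zero
  have hvc : Continuous fun s => P.vel (y s) := P.continuous_vel.comp hyc
  set F : ℝ → ℝ := fun t => ∫ s in (0 : ℝ)..t, P.vel (y s) with hF
  have hFd : ∀ t, HasDerivAt F (P.vel (y t)) t := fun t =>
    (hvc.integral_hasStrictDerivAt 0 t).hasDerivAt
  have hFc : Continuous F := continuous_iff_continuousAt.2 fun t => (hFd t).continuousAt
  have hF0 : F 0 = 0 := by simp [hF]
  have huc : Continuous fun t => Real.exp (F t) := Real.continuous_exp.comp hFc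
  refine ⟨δ, hδ, fun t => Real.exp (F t), fun t => y t * P.mom (Real.exp (F t)), ?_, ?_, ?_⟩
  · intro t ht
    refine hasDerivAt_of_riccati (u := fun t => Real.exp (F t)) (Real.exp_pos _) (hy t ht) ?_
    exact (hFd t).exp.congr_deriv (by ring)
  · have := huc.tendsto 0
    rw [hF0, Real.exp_zero] at this
    exact this.mono_left nhdsWithin_le_nhds
  · have := (hyc.tendsto 0).mul ((P.continuous_mom.comp huc).tendsto 0)
    rw [hy0, zero_mul] at this
    exact this.mono_left nhdsWithin_le_nhds

/-! ### Global existence -/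

variable {P}

theorem IsSolOn.congr_of_eventuallyEq {u p u' p' : ℝ → ℝ} {J : Set ℝ} {r : ℝ}
    (h : P.IsSolOn J u p) (hr : r ∈ J) (hu : u' =ᶠ[𝓝 r] u) (hp : p' =ᶠ[𝓝 r] p) :
    HasDerivAt u' (P.vel (p' r)) r ∧
      HasDerivAt p' ((P.α + 1) * P.force r (u' r) (p' r)) r := by
  rw [hp.eq_of_nhds, hu.eq_of_nhds]
  exact ⟨(h r hr).1.congr_of_eventuallyEq hu, (h r hr).2.congr_of_eventuallyEq hp⟩

/-- `(u, p)` solves the system on `(0, T)` with the initial values `u(0) = 1` and `p(0) = 0`. -/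
def IsInitSol (P : RadialParams) (T : ℝ) (u p : ℝ → ℝ) : Prop :=
  P.IsSolOn (Ioo 0 T) u p ∧ Tendsto u (𝓝[>] 0) (𝓝 1) ∧ Tendsto p (𝓝[>] 0) (𝓝 0)

/-- Restarting at T - δ/2 with step δ reaches T + δ/2, and uniqueness on the overlap allows gluing.
Since δ is fixed, iteration reaches any radius. -/
theorem IsInitSol.extend {c δ T : ℝ} (hc : 0 < c) (hδ : 0 < δ)
    (hloc : ∀ r₀, c + δ ≤ r₀ → ∀ u₀ p₀ : ℝ, u₀ ≠ 0 ∨ p₀ ≠ 0 →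
      ∃ u p, P.IsSolOn (Ioo (r₀ - δ) (r₀ + δ)) u p ∧ u r₀ = u₀ ∧ p r₀ = p₀)
    (hT : c + δ + δ / 2 ≤ T) {u p : ℝ → ℝ} (h : P.IsInitSol T u p) :
    ∃ u' p', P.IsInitSol (T + δ / 2) u' p' := by
  obtain ⟨h1, h2, h3⟩ := h
  have hT0 : 0 < T := by linarith
  have hne : ∀ r ∈ Ioo 0 T, u r ≠ 0 ∨ p r ≠ 0 := by
    have hev0 : ∀ᶠ t in 𝓝[>] (0 : ℝ), t ∈ Ioo 0 T := Ioo_mem_nhdsGT hT0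
    obtain ⟨t, ht, ht'⟩ := (hev0.and (h2.eventually (lt_mem_nhds one_pos))).exists
    exact h1.ne_zero le_rfl ht (Or.inl ht'.ne')
  have hr₀ : T - δ / 2 ∈ Ioo 0 T := ⟨by linarith, by linarith⟩
  obtain ⟨v, q, h4, h5, h6⟩ := hloc (T - δ / 2) (by linarith) _ _ (hne _ hr₀)
  have hagree : ∀ r ∈ Ioo (T - δ / 2 - δ) T, u r = v r ∧ p r = q r := by
    refine IsSolOn.eqOn (r₀ := T - δ / 2) (by linarith)
      (h1.mono (Ioo_subset_Ioo (by linarith) le_rfl))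
      (h4.mono (Ioo_subset_Ioo le_rfl (by linarith))) ⟨by linarith, by linarith⟩ h5.symm h6.symm
      (hne _ hr₀)
  have hleft : ∀ r, r < T → (fun r => if r < T then u r else v r) =ᶠ[𝓝 r] u ∧
      (fun r => if r < T then p r else q r) =ᶠ[𝓝 r] p := fun r hr =>
    ⟨(eventually_lt_nhds hr).mono fun t ht => if_pos ht,
      (eventually_lt_nhds hr).mono fun t ht => if_pos ht⟩
  have hright : ∀ r, T ≤ r → (fun r => if r < T then u r else v r) =ᶠ[𝓝 r] v ∧
      (fun r => if r < T then p r else q r) =ᶠ[𝓝 r] q := by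
    intro r hr
    have : ∀ᶠ t in 𝓝 r, T - δ / 2 - δ < t := eventually_gt_nhds (by linarith)
    constructor
    · filter_upwards [this] with t ht
      split_ifs with h
      · exact (hagree t ⟨ht, h⟩).1
      · rfl
    · filter_upwards [this] with t ht
      split_ifs with h
      · exact (hagree t ⟨ht, h⟩).2
      · rfl
  have hev : ∀ᶠ t in 𝓝[>] (0 : ℝ), t < T := mem_of_superset (Ioo_mem_nhdsGT hT0) fun t ht => ht.2
  refine ⟨fun r => if r < T then u r else v r, fun r => if r < T then p r else q r, ?_, ?_, ?_⟩
  · intro r hr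
    rcases lt_or_ge r T with h | h
    · exact h1.congr_of_eventuallyEq ⟨hr.1, h⟩ (hleft r h).1 (hleft r h).2
    · exact h4.congr_of_eventuallyEq (r := r) ⟨by linarith, by linarith [hr.2]⟩ (hright r h).1
        (hright r h).2
  · exact h2.congr' (hev.mono fun t ht => (if_pos ht).symm)
  · exact h3.congr' (hev.mono fun t ht => (if_pos ht).symm)

theorem IsInitSol.eq {T₁ T₂ r : ℝ} {u₁ u₂ p₁ p₂ : ℝ → ℝ} (h1 : P.IsInitSol T₁ u₁ p₁)
    (h2 : P.IsInitSol T₂ u₂ p₂) (hr : 0 < r) (hr1 : r < T₁) (hr2 : r < T₂) :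
    u₁ r = u₂ r ∧ p₁ r = p₂ r :=
  IsSolOn.eqOn_of_tendsto (R := min T₁ T₂) (lt_min (hr.trans hr1) (hr.trans hr2))
    (h1.1.mono (Ioo_subset_Ioo le_rfl (min_le_left _ _)))
    (h2.1.mono (Ioo_subset_Ioo le_rfl (min_le_right _ _))) one_ne_zero h1.2.1 h2.2.1 h1.2.2 h2.2.2
    r ⟨hr, lt_min hr1 hr2⟩

theorem exists_isInitSol (P : RadialParams) (T : ℝ) : ∃ u p, P.IsInitSol T u p := by
  obtain ⟨δ₀, hδ₀, u, p, h0⟩ := P.exists_isSolOn_near_zero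
  -- With c = δ₀/4 and δ ≤ δ₀/4, c + 3δ/2 ≤ δ₀, so the first extension is already admissible.
  obtain ⟨δ₁, hδ₁, hloc₁⟩ := P.exists_isSolOn (c := δ₀ / 4) (by linarith)
  have hδ : 0 < min δ₁ (δ₀ / 4) := lt_min hδ₁ (by linarith)
  have hδle : min δ₁ (δ₀ / 4) ≤ δ₀ / 4 := min_le_right _ _
  have hloc := hloc₁ _ hδ (min_le_left _ _)
  set δ := min δ₁ (δ₀ / 4)
  have hn : ∀ n : ℕ, ∃ u p, P.IsInitSol (δ₀ + n * (δ / 2)) u p := by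
    intro n
    induction n with
    | zero => exact ⟨u, p, by simpa using h0.1, h0.2⟩
    | succ n ih =>
      obtain ⟨u, p, h⟩ := ih
      have hn0 : 0 ≤ n * (δ / 2) := by positivity
      obtain ⟨u', p', h'⟩ := h.extend (by linarith) hδ hloc (by linarith)
      refine ⟨u', p', ?_⟩
      convert h' using 1
      push_cast; ring
  obtain ⟨n, hnT⟩ := exists_nat_ge ((T - δ₀) / (δ / 2))
  obtain ⟨u, p, h1, h2⟩ := hn n
  rw [div_le_iff₀ (by positivity)] at hnT
  exact ⟨u, p, h1.mono (Ioo_subset_Ioo le_rfl (by linarith)), h2⟩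

theorem exists_global (P : RadialParams) : ∃ u p, P.IsSolOn (Ioi 0) u p ∧
    Tendsto u (𝓝[>] 0) (𝓝 1) ∧ Tendsto p (𝓝[>] 0) (𝓝 0) := by
  choose u p h using P.exists_isInitSol
  -- Solutions on different intervals agree, so the diagonal choice T = t + 1 defines one global
  -- solution.
  have key : ∀ T t, 0 < t → t < T → u (t + 1) t = u T t ∧ p (t + 1) t = p T t := fun T t ht htT =>
    (h (t + 1)).eq (h T) ht (by linarith) htT
  refine ⟨fun t => u (t + 1) t, fun t => p (t + 1) t, fun r hr => ?_, ?_, ?_⟩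
  · have hr : 0 < r := hr
    have hev : ∀ᶠ t in 𝓝 r, t ∈ Ioo 0 (r + 1) := Ioo_mem_nhds hr (by linarith)
    exact (h (r + 1)).1.congr_of_eventuallyEq (r := r) ⟨hr, by linarith⟩
      (hev.mono fun t ht => (key (r + 1) t ht.1 ht.2).1)
      (hev.mono fun t ht => (key (r + 1) t ht.1 ht.2).2)
  · have hev : ∀ᶠ t in 𝓝[>] (0 : ℝ), t ∈ Ioo 0 1 := Ioo_mem_nhdsGT one_pos
    exact (h 1).2.1.congr' (hev.mono fun t ht => (key 1 t ht.1 ht.2).1.symm)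
  · have hev : ∀ᶠ t in 𝓝[>] (0 : ℝ), t ∈ Ioo 0 1 := Ioo_mem_nhdsGT one_pos
    exact (h 1).2.2.congr' (hev.mono fun t ht => (key 1 t ht.1 ht.2).2.symm)

end RadialParams

namespace RadialParams

variable {P : RadialParams} {N : ℕ} {u p u₁ u₂ p₁ p₂ : ℝ → ℝ} {s : ℝ}

/-! ### From the system to regular radial solutions -/

theorem abs_vel_rpow_mul {p : ℝ} (hp : p ≠ 0) : |P.vel p| ^ P.α * |p| ^ (P.γ - 1) = 1 := by
  rw [vel, abs_signedPow (by linarith [P.γ_pos]), ← Real.rpow_mul (abs_nonneg p),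
    ← Real.rpow_add (abs_pos.2 hp)]
  rw [show (P.γ - 1 + 1) * P.α + (P.γ - 1) = P.γ * (P.α + 1) - 1 by ring, γ_mul, sub_self,
    Real.rpow_zero]

theorem hasDerivAt_vel {r : ℝ} (hp : HasDerivAt p ((P.α + 1) * P.force r (u r) (p r)) r)
    (h0 : p r ≠ 0) :
    HasDerivAt (fun x => P.vel (p x)) (|p r| ^ (P.γ - 1) * P.force r (u r) (p r)) r := by
  refine ((hasDerivAt_signedPow (β := P.γ - 1) h0).comp r hp).congr_deriv ?_
  linear_combination |p r| ^ (P.γ - 1) * P.force r (u r) (p r) * P.γ_mul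

theorem IsSolOn.isRadialSolution (hν : P.ν = (N : ℝ) - 1) (h : P.IsSolOn (Ioi 0) u p)
    (hu : Tendsto u (𝓝[>] 0) (𝓝 s)) (hp : Tendsto p (𝓝[>] 0) (𝓝 0)) :
    IsRadialSolution N P.α P.a P.A 1 (Ici 0) (fun r => if r ≤ 0 then s else u r) := by
  set w : ℝ → ℝ := fun r => if r ≤ 0 then s else u r with hw
  have hwu : ∀ r, 0 < r → w =ᶠ[𝓝 r] u := fun r hr =>
    (eventually_gt_nhds hr).mono fun t ht => if_neg (not_le.2 ht)
  have hwd : ∀ r, 0 < r → HasDerivAt w (P.vel (p r)) r := fun r hr =>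
    (h r hr).1.congr_of_eventuallyEq (hwu r hr)
  have hd : ∀ r, 0 < r → deriv w r = P.vel (p r) := fun r hr => (hwd r hr).deriv
  have hpc : ContinuousOn p (Ioi 0) := fun r hr => (h.continuousAt_snd hr).continuousWithinAt
  have hv0 : Tendsto (fun r => P.vel (p r)) (𝓝[>] 0) (𝓝 0) := by
    have := (P.continuous_vel.tendsto 0).comp hp
    rwa [vel_zero] at this
  have hw0 : HasDerivWithinAt w 0 (Ici 0) 0 := by
    refine hasDerivWithinAt_Ici_of_tendsto_deriv (s := Ioi 0)
      (fun r hr => (hwd r hr).differentiableAt.differentiableWithinAt) ?_ self_mem_nhdsWithin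
      (hv0.congr' ?_)
    · have : w 0 = s := if_pos le_rfl
      rw [ContinuousWithinAt, this]
      exact hu.congr' (by
        filter_upwards [self_mem_nhdsWithin] with t ht using (if_neg (not_le.2 ht)).symm)
    · filter_upwards [self_mem_nhdsWithin] with t ht using (hd t ht).symm
  have hS : IsOpen (Ioi 0 ∩ p ⁻¹' {0}ᶜ) := hpc.isOpen_inter_preimage isOpen_Ioi isOpen_compl_singleton
  have hdd : ∀ r ∈ Ioi 0 ∩ p ⁻¹' {0}ᶜ,
      HasDerivAt (deriv w) (|p r| ^ (P.γ - 1) * P.force r (u r) (p r)) r := fun r hr =>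
    (hasDerivAt_vel (h r hr.1).2 hr.2).congr_of_eventuallyEq
      ((eventually_gt_nhds hr.1).mono fun t ht => hd t ht)
  refine ⟨?_, hw0.derivWithin (uniqueDiffOn_Ici 0 0 self_mem_Ici), ?_, ?_⟩
  · rw [contDiffOn_one_iff_derivWithin (uniqueDiffOn_Ici 0)]
    constructor
    · intro r hr
      rcases (show (0 : ℝ) ≤ r from hr).eq_or_lt with rfl | hr
      · exact hw0.differentiableWithinAt
      · exact (hwd r hr).differentiableAt.differentiableWithinAt
    · have hcongr : ∀ r ∈ Ici (0 : ℝ), derivWithin w (Ici 0) r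
          = if r ≤ 0 then 0 else P.vel (p r) := by
        intro r hr
        rcases (show (0 : ℝ) ≤ r from hr).eq_or_lt with rfl | hr
        · rw [hw0.derivWithin (uniqueDiffOn_Ici 0 0 self_mem_Ici), if_pos le_rfl]
        · rw [derivWithin_of_mem_nhds (Ici_mem_nhds hr), hd r hr, if_neg (not_le.2 hr)]
      refine ContinuousOn.congr ?_ hcongr
      intro r hr
      rcases (show (0 : ℝ) ≤ r from hr).eq_or_lt with rfl | hr
      · rw [← continuousWithinAt_Ioi_iff_Ici, ContinuousWithinAt, if_pos le_rfl]
        exact hv0.congr' (by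
          filter_upwards [self_mem_nhdsWithin] with t ht using (if_neg (not_le.2 ht)).symm)
      · refine (ContinuousAt.congr (P.continuous_vel.continuousAt.comp (h.continuousAt_snd hr))
          ?_).continuousWithinAt
        exact (eventually_gt_nhds hr).mono fun t ht => (if_neg (not_le.2 ht)).symm
  · intro r _ hr hne
    rw [hd r hr] at hne
    have hpr : p r ≠ 0 := fun h0 => hne (by simp [h0])
    have hrS : r ∈ Ioi 0 ∩ p ⁻¹' {0}ᶜ := ⟨hr, hpr⟩
    constructor
    · have hC : ContDiffOn ℝ (1 + 1) w (Ioi 0 ∩ p ⁻¹' {0}ᶜ) := by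
        rw [contDiffOn_succ_iff_deriv_of_isOpen hS]
        refine ⟨fun t ht => (hwd t ht.1).differentiableAt.differentiableWithinAt, by simp, ?_⟩
        rw [← zero_add (1 : WithTop ℕ∞), contDiffOn_succ_iff_deriv_of_isOpen hS]
        refine ⟨fun t ht => (hdd t ht).differentiableAt.differentiableWithinAt, by simp, ?_⟩
        rw [contDiffOn_zero]
        refine ContinuousOn.congr (f := fun t => |p t| ^ (P.γ - 1) * P.force t (u t) (p t)) ?_
          fun t ht => (hdd t ht).deriv
        intro t ht
        have ht0 : (0 : ℝ) < t := ht.1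
        refine ContinuousAt.continuousWithinAt ?_
        exact ((h.continuousAt_snd ht.1).abs.rpow_const (Or.inl (abs_pos.2 ht.2).ne')).mul
          (continuousAt_force ht0.ne' (h.continuousAt_fst ht.1) (h.continuousAt_snd ht.1))
      rw [one_add_one_eq_two] at hC
      exact hC.contDiffAt (hS.mem_nhds hrS)
    · have hwr : w r = u r := if_neg (not_le.2 hr)
      rw [hd r hr, (hdd r hrS).deriv, hwr, radialOp]
      have ht : 0 ≤ |P.vel (p r)| ^ P.α := by positivity
      have e1 : |P.vel (p r)| ^ P.α * pucci P.a P.A (|p r| ^ (P.γ - 1) * P.force r (u r) (p r))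
          = -P.mom (u r) - P.ν / r * pucci P.a P.A (p r) := by
        rw [← pucci_mul_of_nonneg ht, ← mul_assoc, abs_vel_rpow_mul hpr, one_mul, force,
          pucci_pucci_inv P.a_pos P.A_pos]
      have e2 : |P.vel (p r)| ^ P.α * pucci P.a P.A (P.vel (p r)) = pucci P.a P.A (p r) := by
        rw [← pucci_mul_of_nonneg ht]
        exact congrArg _ (P.mom_vel (p r))
      have e3 : |u r| ^ P.α * u r = P.mom (u r) := rfl
      rw [e3]
      rw [hν] at e1
      linear_combination e1 + (N - 1) / r * e2
  · intro r _ hr hconst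
    have hwr : w r = u r := if_neg (not_le.2 hr)
    -- Local constancy gives p = 0 and p' = 0; then the force vanishes, and injectivity of the Pucci
    -- function gives u(r) = 0.
    have hp0 : ∀ᶠ t in 𝓝 r, p t = 0 := by
      filter_upwards [hconst.eventually_nhds, eventually_gt_nhds hr] with t ht ht0
      have h1 : deriv w t = 0 := by
        have : w =ᶠ[𝓝 t] fun _ => w r := ht
        rw [this.deriv_eq, deriv_const]
      rw [hd t ht0] at h1
      exact P.vel_eq_zero_iff.1 h1
    have h2 := (h r hr).2
    have h3 : HasDerivAt p 0 r := (hasDerivAt_const r (0 : ℝ)).congr_of_eventuallyEq hp0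
    have h4 := h2.unique h3
    rw [hp0.self_of_nhds, force, pucci_zero, mul_zero, sub_zero] at h4
    have h5 : pucci P.a⁻¹ P.A⁻¹ (-P.mom (u r)) = 0 :=
      (mul_eq_zero.1 h4).resolve_left P.α_add_one_pos.ne'
    have h6 : -P.mom (u r) = 0 :=
      (strictMono_pucci (inv_pos.2 P.a_pos) (inv_pos.2 P.A_pos)).injective (by rw [h5, pucci_zero])
    have h7 : |u r| ^ P.α * u r = P.mom (u r) := rfl
    rw [hwr, h7]; linarith

/-! ### Oscillation -/

/-- Finite time blow-up: linear growth brings Y above 1, and from then on the positive function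
Y^(-γ) decreases at rate at least γc. -/
theorem _root_.false_of_superlinear_deriv {Y Y' : ℝ → ℝ} {R c γ : ℝ} (hc : 0 < c) (hγ : 0 < γ)
    (hY : ∀ r, R < r → HasDerivAt Y (Y' r) r) (hle : ∀ r, R < r → c * (1 + |Y r| ^ (1 + γ)) ≤ Y' r) :
    False := by
  have hgrow : ∀ x y, R < x → x ≤ y → c * (y - x) ≤ Y y - Y x := by
    intro x y hx hxy
    refine (convex_Ici x).mul_sub_le_image_sub_of_le_deriv
      (fun t ht => (hY t (hx.trans_le ht)).continuousAt.continuousWithinAt)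
      (fun t ht => ?_) (fun t ht => ?_) x self_mem_Ici y hxy hxy
    · exact (hY t (hx.trans_le (interior_subset ht))).differentiableAt.differentiableWithinAt
    · have ht' : R < t := hx.trans_le (interior_subset ht)
      rw [(hY t ht').deriv]
      have : 0 ≤ |Y t| ^ (1 + γ) := by positivity
      have := hle t ht'
      nlinarith
  -- At slope c, Y gains at least |1 - Y(R+1)| between R + 1 and R₂, so it is at least 1 from R₂ on.
  set R₂ := R + 1 + |1 - Y (R + 1)| / c with hR₂
  have hR₂' : R + 1 ≤ R₂ := by rw [hR₂]; linarith [div_nonneg (abs_nonneg (1 - Y (R + 1))) hc.le]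
  have hone : ∀ r, R₂ ≤ r → 1 ≤ Y r := by
    intro r hr
    have h1 := hgrow (R + 1) r (by linarith) (hR₂'.trans hr)
    have h2 : c * (R₂ - (R + 1)) ≤ c * (r - (R + 1)) := by gcongr
    have h3 : c * (R₂ - (R + 1)) = |1 - Y (R + 1)| := by rw [hR₂]; field_simp; ring
    have := le_abs_self (1 - Y (R + 1))
    linarith
  have hV : ∀ r, R₂ ≤ r → HasDerivAt (fun t => Y t ^ (-γ)) (Y' r * -γ * Y r ^ (-γ - 1)) r :=
    fun r hr => (hY r (by linarith)).rpow_const (Or.inl (by linarith [hone r hr]))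
  have hVle : ∀ r, R₂ ≤ r → Y' r * -γ * Y r ^ (-γ - 1) ≤ -(γ * c) := by
    intro r hr
    have h1 : 0 < Y r := by linarith [hone r hr]
    have h2 := hle r (by linarith)
    rw [abs_of_pos h1] at h2
    have h3 : 0 < Y r ^ (-γ - 1) := Real.rpow_pos_of_pos h1 _
    have h4 : Y r ^ (1 + γ) * Y r ^ (-γ - 1) = 1 := by
      rw [← Real.rpow_add h1, show 1 + γ + (-γ - 1) = 0 by ring, Real.rpow_zero]
    have h5 := mul_le_mul_of_nonneg_right h2 h3.le
    have h6 : c * (1 + Y r ^ (1 + γ)) * Y r ^ (-γ - 1) = c * Y r ^ (-γ - 1) + c := by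
      linear_combination c * h4
    have h7 : c ≤ Y' r * Y r ^ (-γ - 1) := by linarith [mul_pos hc h3]
    have := mul_le_mul_of_nonneg_left h7 hγ.le
    linarith
  have hdec : ∀ y, R₂ ≤ y → Y y ^ (-γ) - Y R₂ ^ (-γ) ≤ -(γ * c) * (y - R₂) := by
    intro y hy
    refine (convex_Ici R₂).image_sub_le_mul_sub_of_deriv_le
      (f := fun t => Y t ^ (-γ))
      (fun t ht => (hV t ht).continuousAt.continuousWithinAt)
      (fun t ht => ?_) (fun t ht => ?_) R₂ self_mem_Ici y hy hy
    · exact (hV t (interior_subset ht)).differentiableAt.differentiableWithinAt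
    · rw [(hV t (interior_subset ht)).deriv]
      exact hVle t (interior_subset ht)
  have h1 : 0 < Y R₂ ^ (-γ) := Real.rpow_pos_of_pos (by linarith [hone R₂ le_rfl]) _
  have h2 := hdec (R₂ + Y R₂ ^ (-γ) / (γ * c)) (by
    linarith [div_pos h1 (mul_pos hγ hc)])
  have h3 : -(γ * c) * (R₂ + Y R₂ ^ (-γ) / (γ * c) - R₂) = -Y R₂ ^ (-γ) := by field_simp; ring
  rw [h3] at h2
  have h4 : 0 < Y (R₂ + Y R₂ ^ (-γ) / (γ * c)) ^ (-γ) :=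
    Real.rpow_pos_of_pos (by
      linarith [hone (R₂ + Y R₂ ^ (-γ) / (γ * c)) (by linarith [div_pos h1 (mul_pos hγ hc)])]) _
  linarith

/-- At y = 0 the force is -1/a, and friction changes it by at most C|y|/r. For large r half of the
two negative terms -1/a and -|y|^(1+γ) absorbs this change. -/
theorem riccati_le_of_large (P : RadialParams) : ∃ c > 0, ∃ R > 0, ∀ r, R < r → ∀ y,
    P.riccati r y ≤ -(c * (1 + |y| ^ (1 + P.γ))) := by
  have ha := inv_pos.2 P.a_pos
  have hA := inv_pos.2 P.A_pos
  have haA : 0 < P.a + P.A := add_pos P.a_pos P.A_pos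
  have hν := P.ν_nonneg
  have hα := P.α_add_one_pos
  have hγ := P.γ_pos
  set C := (P.a⁻¹ + P.A⁻¹) * (P.ν * (P.a + P.A)) with hC
  have hC0 : 0 ≤ C := by positivity
  set m := min 1 P.a⁻¹ with hm
  have hm0 : 0 < m := lt_min one_pos ha
  refine ⟨(P.α + 1) * (m / 2), by positivity, 2 * (C + 1) / m, by positivity, fun r hr y => ?_⟩
  have hr0 : 0 < r := lt_trans (by positivity) hr
  have h1 : C / r ≤ m / 2 := by
    rw [div_lt_iff₀ hm0] at hr
    rw [div_le_iff₀ hr0]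
    linarith
  have h2 : P.force r 1 y ≤ -P.a⁻¹ + C / r * |y| := by
    have h3 : P.force r 1 0 = -P.a⁻¹ := by
      rw [force, mom_one, pucci_zero, mul_zero, sub_zero, pucci_of_nonpos (by norm_num)]; ring
    have h4 := P.abs_force_sub_le hr0 le_rfl 1 y 0
    rw [h3, sub_zero] at h4
    have h5 := (abs_le.1 h4).2
    have h6 : (P.a⁻¹ + P.A⁻¹) * (P.ν / r * (P.a + P.A)) * |y| = C / r * |y| := by rw [hC]; ring
    linarith
  have h7 : |y| ≤ 1 + |y| ^ (1 + P.γ) := by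
    rcases le_total |y| 1 with h | h
    · linarith [Real.rpow_nonneg (abs_nonneg y) (1 + P.γ)]
    · have := Real.self_le_rpow_of_one_le h (show 1 ≤ 1 + P.γ by linarith)
      linarith
  have h8 : C / r * |y| ≤ m / 2 * (1 + |y| ^ (1 + P.γ)) := by gcongr
  have h9 : m ≤ P.a⁻¹ := min_le_right _ _
  have h10 : m * |y| ^ (1 + P.γ) ≤ 1 * |y| ^ (1 + P.γ) := by
    gcongr; exact min_le_left _ _
  rw [riccati, mul_vel, mul_assoc, ← mul_neg]
  refine mul_le_mul_of_nonneg_left ?_ hα.le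
  linarith

theorem IsSolOn.not_pos_of_large (h : P.IsSolOn (Ioi 0) u p) {R : ℝ} (hR : 0 < R)
    (hpos : ∀ r, R < r → 0 < u r) : False := by
  obtain ⟨c, hc, R', hR', hle⟩ := P.riccati_le_of_large
  refine false_of_superlinear_deriv (Y := fun t => -(p t / P.mom (u t)))
    (Y' := fun t => -P.riccati t (p t / P.mom (u t))) (R := max R R') hc P.γ_pos
    (fun r hr => ?_) fun r hr => ?_
  · have hr1 : R < r := (le_max_left _ _).trans_lt hr
    have hr0 : r ∈ Ioi (0 : ℝ) := hR.trans hr1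
    exact (hasDerivAt_riccati (h r hr0).1 (h r hr0).2 (hpos r hr1)).neg
  · have := hle r ((le_max_right _ _).trans_lt hr) (p r / P.mom (u r))
    rw [abs_neg]
    linarith

theorem IsSolOn.exists_zero_gt (h : P.IsSolOn (Ioi 0) u p) {R : ℝ} (hR : 0 < R) :
    ∃ r, R < r ∧ u r = 0 := by
  by_contra! hne
  have hcont : ContinuousOn u (Ioi R) := fun t ht =>
    (h.continuousAt_fst (hR.trans ht)).continuousWithinAt
  have hzero : ∀ x y, R < x → R < y → u x < 0 → 0 < u y → False := by
    intro x y hx hy hux huy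
    obtain ⟨t, ht, ht0⟩ := isPreconnected_Ioi.intermediate_value (show x ∈ Ioi R from hx)
      (show y ∈ Ioi R from hy) hcont ⟨hux.le, huy.le⟩
    exact hne t ht ht0
  rcases lt_or_gt_of_ne (hne (R + 1) (by linarith)) with h1 | h1
  · refine h.neg.not_pos_of_large hR fun r hr => ?_
    rcases lt_or_gt_of_ne (hne r hr) with h2 | h2
    · linarith
    · exact (hzero _ _ (by linarith) hr h1 h2).elim
  · refine h.not_pos_of_large hR fun r hr => ?_
    rcases lt_or_gt_of_ne (hne r hr) with h2 | h2
    · exact (hzero _ _ hr (by linarith) h2 h1).elim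
    · exact h2

/-! ### Sturm comparison -/

theorem _root_.deriv_neg_of_pos_left {f : ℝ → ℝ} {f' c d : ℝ} (h : HasDerivAt f f' d) (hf' : f' ≠ 0)
    (hcd : c < d) (hpos : ∀ r ∈ Ioo c d, 0 < f r) (hd : f d = 0) : f' < 0 := by
  refine lt_of_le_of_ne ?_ hf'
  by_contra! hp
  have h2 : ∀ᶠ t in 𝓝[<] d, 0 < slope f d t :=
    ((hasDerivAt_iff_tendsto_slope.1 h).mono_left
      (nhdsWithin_mono _ fun t (ht : t < d) => ht.ne)).eventually (lt_mem_nhds hp)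
  obtain ⟨t, ht, ht'⟩ := (h2.and (Ioo_mem_nhdsLT hcd)).exists
  rw [slope_def_field, hd, sub_zero] at ht
  exact absurd ht (not_lt.2 (div_nonpos_of_nonneg_of_nonpos (hpos t ht').le (by linarith [ht'.2])))

theorem IsSolOn.eqOn_Ioi {r₀ : ℝ} (h1 : P.IsSolOn (Ioi 0) u₁ p₁) (h2 : P.IsSolOn (Ioi 0) u₂ p₂)
    (hr₀ : 0 < r₀) (hu : u₁ r₀ = u₂ r₀) (hp : p₁ r₀ = p₂ r₀) (h0 : u₁ r₀ ≠ 0 ∨ p₁ r₀ ≠ 0) :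
    ∀ r, 0 < r → u₁ r = u₂ r := fun r hr =>
  (IsSolOn.eqOn (c := 0) (d := max r₀ r + 1) le_rfl (h1.mono fun _ ht => ht.1)
    (h2.mono fun _ ht => ht.1) ⟨hr₀, by linarith [le_max_left r₀ r]⟩ hu hp h0 r
    ⟨hr, by linarith [le_max_right r₀ r]⟩).1

theorem IsSolOn.ne_zero_Ioi {r₀ : ℝ} (h : P.IsSolOn (Ioi 0) u p) (hr₀ : 0 < r₀)
    (h0 : u r₀ ≠ 0 ∨ p r₀ ≠ 0) : ∀ r, 0 < r → u r ≠ 0 ∨ p r ≠ 0 := fun r hr =>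
  IsSolOn.ne_zero (c := 0) (d := max r₀ r + 1) le_rfl (h.mono fun _ ht => ht.1)
    ⟨hr₀, by linarith [le_max_left r₀ r]⟩ h0 r ⟨hr, by linarith [le_max_right r₀ r]⟩

theorem IsSolOn.snd_neg_of_zero (h : P.IsSolOn (Ioi 0) u p) {c d : ℝ} (hc : 0 < c) (hcd : c < d)
    (hpos : ∀ r ∈ Ioo c d, 0 < u r) (hd : u d = 0) : p d < 0 := by
  have hd0 : 0 < d := hc.trans hcd
  have hm : (c + d) / 2 ∈ Ioo c d := ⟨by linarith, by linarith⟩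
  have hne := h.ne_zero_Ioi (hc.trans hm.1) (Or.inl (hpos _ hm).ne') d hd0
  have hpd : p d ≠ 0 := by simpa [hd] using hne
  exact P.vel_neg_iff.1 (deriv_neg_of_pos_left (h d hd0).1 (mt P.vel_eq_zero_iff.1 hpd) hcd hpos hd)

/-- Between two zeros of a solution, no second solution has the same sign up to the left zero. -/
theorem IsSolOn.sturm (h1 : P.IsSolOn (Ioi 0) u₁ p₁) (h2 : P.IsSolOn (Ioi 0) u₂ p₂) {c d : ℝ}
    (hc : 0 < c) (hcd : c < d) (hu1c : u₁ c = 0) (hu1d : u₁ d = 0)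
    (hpos1 : ∀ r ∈ Ioo c d, 0 < u₁ r) (hpos2 : ∀ r ∈ Ico c d, 0 < u₂ r) : False := by
  have hd0 : 0 < d := hc.trans hcd
  have hcontra : ∀ t x, 0 < t → 0 < x → u₁ x = t * u₂ x → p₁ x = P.mom t * p₂ x →
      (u₁ x ≠ 0 ∨ p₁ x ≠ 0) → False := by
    intro t x ht hx hu hp h0
    have := h1.eqOn_Ioi (h2.smul ht.le) hx hu hp h0 c hc
    rw [hu1c] at this
    have h3 := hpos2 c ⟨le_rfl, hcd⟩
    have := mul_pos ht h3
    linarith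
  have hmom : ∀ t x, P.vel (p₁ x) = t * P.vel (p₂ x) → p₁ x = P.mom t * p₂ x := by
    intro t x hv
    rw [← P.mom_vel (p₁ x), hv, mom_mul, mom_vel]
  have hu2d : 0 ≤ u₂ d := by
    have h3 : Tendsto u₂ (𝓝[<] d) (𝓝 (u₂ d)) :=
      (h2.continuousAt_fst hd0).tendsto.mono_left nhdsWithin_le_nhds
    refine ge_of_tendsto h3 ?_
    filter_upwards [Ioo_mem_nhdsLT hcd] with t ht using (hpos2 t ⟨ht.1.le, ht.2⟩).le
  have hv1 := P.vel_neg_iff.2 (h1.snd_neg_of_zero hc hcd hpos1 hu1d)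
  -- If u₂ also vanishes at d, both slopes there are negative, and their quotient is the factor that
  -- makes u₂ agree with u₁ to first order. Otherwise u₁/u₂ has an interior maximum.
  rcases hu2d.eq_or_lt with hu2d | hu2d
  · have hv2 := P.vel_neg_iff.2 (h2.snd_neg_of_zero hc hcd
      (fun r hr => hpos2 r ⟨hr.1.le, hr.2⟩) hu2d.symm)
    refine hcontra (P.vel (p₁ d) / P.vel (p₂ d)) d (div_pos_of_neg_of_neg hv1 hv2) hd0
      (by rw [hu1d, ← hu2d, mul_zero]) (hmom _ _ (by field_simp [hv2.ne])) (Or.inr ?_)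
    exact (h1.snd_neg_of_zero hc hcd hpos1 hu1d).ne
  · have hpos2' : ∀ r ∈ Icc c d, 0 < u₂ r := by
      intro r hr
      rcases hr.2.eq_or_lt with rfl | h
      · exact hu2d
      · exact hpos2 r ⟨hr.1, h⟩
    have hcont : ContinuousOn (fun r => u₁ r / u₂ r) (Icc c d) := fun r hr =>
      ((h1.continuousAt_fst (hc.trans_le hr.1)).div (h2.continuousAt_fst (hc.trans_le hr.1))
        (hpos2' r hr).ne').continuousWithinAt
    obtain ⟨x, hx, hmax⟩ := isCompact_Icc.exists_isMaxOn (nonempty_Icc.2 hcd.le) hcont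
    have hm : (c + d) / 2 ∈ Ioo c d := ⟨by linarith, by linarith⟩
    have hm' := Ioo_subset_Icc_self hm
    have ht : 0 < u₁ x / u₂ x := (div_pos (hpos1 _ hm) (hpos2' _ hm')).trans_le (hmax hm')
    have hux : 0 < u₁ x := (div_pos_iff_of_pos_right (hpos2' x hx)).1 ht
    have hxI : x ∈ Ioo c d := by
      refine ⟨lt_of_le_of_ne hx.1 ?_, lt_of_le_of_ne hx.2 ?_⟩
      · rintro rfl; exact hux.ne' hu1c
      · rintro rfl; exact hux.ne' hu1d
    have hx0 : 0 < x := hc.trans hxI.1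
    -- The multiple of u₂ touches u₁ from above at x, so values and slopes agree and uniqueness
    -- applies.
    have hloc : IsLocalMax (fun r => u₁ r - u₁ x / u₂ x * u₂ r) x := by
      filter_upwards [Ioo_mem_nhds hxI.1 hxI.2] with r hr
      have hr' := Ioo_subset_Icc_self hr
      have h3 : u₁ r / u₂ r ≤ u₁ x / u₂ x := hmax hr'
      rw [div_le_iff₀ (hpos2' r hr')] at h3
      rw [div_mul_cancel₀ _ (hpos2' x hx).ne']
      linarith
    have hder := hloc.hasDerivAt_eq_zero ((h1 x hx0).1.sub ((h2 x hx0).1.const_mul (u₁ x / u₂ x)))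
    exact hcontra _ x ht hx0 (by rw [div_mul_cancel₀ _ (hpos2' x hx).ne'])
      (hmom _ _ (by linarith)) (Or.inl hux.ne')

end RadialParams

/-! ### Nodal sequences -/

theorem pos_on_Ioo_of_ne_zero {f : ℝ → ℝ} {c d x₀ : ℝ} (hf : ContinuousOn f (Ioo c d))
    (hne : ∀ r ∈ Ioo c d, f r ≠ 0) (hx₀ : x₀ ∈ Ioo c d) (h0 : 0 < f x₀) :
    ∀ r ∈ Ioo c d, 0 < f r := by
  intro r hr
  by_contra! hle
  obtain ⟨t, ht, ht0⟩ := isPreconnected_Ioo.intermediate_value hr hx₀ hf ⟨hle, h0.le⟩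
  exact hne t ht ht0

/-- `Z` enumerates consecutive positive zeros of `w`, after `Z 0 = 0`. -/
structure IsNodalSequence (w : ℝ → ℝ) (Z : ℕ → ℝ) : Prop where
  zero : Z 0 = 0
  lt_succ : ∀ k, Z k < Z (k + 1)
  apply_succ : ∀ k, w (Z (k + 1)) = 0
  ne_zero : ∀ k, ∀ r ∈ Ioo (Z k) (Z (k + 1)), w r ≠ 0

namespace IsNodalSequence

variable {w : ℝ → ℝ} {Z : ℕ → ℝ}

theorem strictMono (h : IsNodalSequence w Z) : StrictMono Z := strictMono_nat_of_lt_succ h.lt_succ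

theorem nonneg (h : IsNodalSequence w Z) (k : ℕ) : 0 ≤ Z k := by
  rw [← h.zero]; exact h.strictMono.monotone (Nat.zero_le k)

theorem pos (h : IsNodalSequence w Z) {k : ℕ} (hk : 1 ≤ k) : 0 < Z k := by
  rw [← h.zero]; exact h.strictMono hk

theorem apply (h : IsNodalSequence w Z) {k : ℕ} (hk : 1 ≤ k) : w (Z k) = 0 := by
  obtain ⟨j, rfl⟩ := Nat.exists_eq_add_of_le' hk
  exact h.apply_succ j

end IsNodalSequence

namespace RadialParams

variable {P : RadialParams} {N : ℕ} {w p : ℝ → ℝ} {s : ℝ} {Z : ℕ → ℝ}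

theorem IsSolOn.nondegenerate (h : P.IsSolOn (Ioi 0) w p) (hlim : Tendsto w (𝓝[>] 0) (𝓝 s))
    (hs : s ≠ 0) : ∀ r, 0 < r → w r ≠ 0 ∨ p r ≠ 0 := by
  obtain ⟨t, ht, ht'⟩ := ((hlim.eventually_ne hs).and self_mem_nhdsWithin).exists
  exact h.ne_zero_Ioi ht' (Or.inl ht)

theorem IsSolOn.eventually_ne_zero (h : P.IsSolOn (Ioi 0) w p)
    (hlim : Tendsto w (𝓝[>] 0) (𝓝 s)) (hs : s ≠ 0) {c : ℝ} (hc : 0 < c) :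
    ∀ᶠ r in 𝓝[≠] c, w r ≠ 0 := by
  by_cases h0 : w c = 0
  · have hp : p c ≠ 0 := by simpa [h0] using h.nondegenerate hlim hs c hc
    exact (h c hc).1.eventually_ne (mt P.vel_eq_zero_iff.1 hp)
  · exact ((h.continuousAt_fst hc).eventually_ne h0).filter_mono nhdsWithin_le_nhds

/-- Zeros do not accumulate at c from the right, also for c = 0 where w tends to s ≠ 0, so the zeros
beyond c form a closed set. Oscillation makes it nonempty, so the infimum is attained. -/
theorem IsSolOn.sInf_zero_mem (h : P.IsSolOn (Ioi 0) w p)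
    (hlim : Tendsto w (𝓝[>] 0) (𝓝 s)) (hs : s ≠ 0) {c : ℝ} (hc : 0 ≤ c) :
    sInf {r | c < r ∧ w r = 0} ∈ {r | c < r ∧ w r = 0} := by
  have hev : ∀ᶠ r in 𝓝[>] c, w r ≠ 0 := by
    rcases hc.eq_or_lt with rfl | hc
    · exact hlim.eventually_ne hs
    · exact (h.eventually_ne_zero hlim hs hc).filter_mono
        (nhdsWithin_mono _ fun t (ht : c < t) => ht.ne')
  obtain ⟨e, he, hsub⟩ := mem_nhdsGT_iff_exists_Ioo_subset.1 hev
  have he : c < e := he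
  have heq : {r | c < r ∧ w r = 0} = Ici e ∩ w ⁻¹' {0} := by
    ext r
    constructor
    · rintro ⟨h1, h2⟩
      refine ⟨?_, h2⟩
      by_contra hlt
      exact hsub ⟨h1, not_le.1 hlt⟩ h2
    · rintro ⟨h1, h2⟩
      exact ⟨he.trans_le h1, h2⟩
  have hclosed : IsClosed {r | c < r ∧ w r = 0} := by
    rw [heq]
    exact ContinuousOn.preimage_isClosed_of_isClosed
      (fun r hr => (h.continuousAt_fst (hc.trans_lt (he.trans_le hr))).continuousWithinAt)
      isClosed_Ici isClosed_singleton
  obtain ⟨r, hr, hr0⟩ := h.exists_zero_gt (R := c + 1) (by linarith)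
  exact hclosed.csInf_mem ⟨r, by linarith, hr0⟩ ⟨c, fun t ht => ht.1.le⟩

theorem IsSolOn.isNodalSequence (h : P.IsSolOn (Ioi 0) w p)
    (hlim : Tendsto w (𝓝[>] 0) (𝓝 s)) (hs : s ≠ 0) (hZ0 : Z 0 = 0)
    (hZ : ∀ k, Z (k + 1) = sInf {r | Z k < r ∧ w r = 0}) : IsNodalSequence w Z := by
  have hmem : ∀ k, 0 ≤ Z k → Z (k + 1) ∈ {r | Z k < r ∧ w r = 0} := fun k hk => by
    rw [hZ k]; exact h.sInf_zero_mem hlim hs hk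
  have hnn : ∀ k, 0 ≤ Z k := by
    intro k
    induction k with
    | zero => exact hZ0.ge
    | succ k ih => exact ih.trans (hmem k ih).1.le
  refine ⟨hZ0, fun k => (hmem k (hnn k)).1, fun k => (hmem k (hnn k)).2, fun k r hr h0 => ?_⟩
  have h1 := hr.2
  rw [hZ k] at h1
  exact notMem_of_lt_csInf h1 ⟨Z k, fun t ht => ht.1.le⟩ ⟨hr.1, h0⟩

/-- A zero missed by the sequence would bound it, and the zeros would accumulate at its positive
limit, against their isolation. -/
theorem IsSolOn.exists_eq_of_zero (h : P.IsSolOn (Ioi 0) w p)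
    (hlim : Tendsto w (𝓝[>] 0) (𝓝 s)) (hs : s ≠ 0) (hZ : IsNodalSequence w Z) {r : ℝ} (hr : 0 < r)
    (h0 : w r = 0) : ∃ k, 1 ≤ k ∧ Z k = r := by
  by_contra! hne
  have hlt : ∀ k, Z k < r := by
    intro k
    induction k with
    | zero => rwa [hZ.zero]
    | succ k ih =>
      by_contra! hle
      exact hZ.ne_zero k r ⟨ih, lt_of_le_of_ne hle (hne (k + 1) (by omega)).symm⟩ h0
  have hb : BddAbove (range Z) := ⟨r, by rintro _ ⟨k, rfl⟩; exact (hlt k).le⟩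
  have hL := tendsto_atTop_ciSup hZ.strictMono.monotone hb
  set L := ⨆ k, Z k
  have hZL : ∀ k, Z k < L := fun k => (hZ.lt_succ k).trans_le (le_ciSup hb (k + 1))
  have hL0 : 0 < L := (hZ.nonneg 0).trans_lt (hZL 0)
  have hL' : Tendsto Z atTop (𝓝[≠] L) :=
    tendsto_nhdsWithin_iff.2 ⟨hL, Eventually.of_forall fun k => (hZL k).ne⟩
  obtain ⟨k, hk, hk1⟩ := ((hL'.eventually (h.eventually_ne_zero hlim hs hL0)).and
    (eventually_ge_atTop 1)).exists
  exact hk (hZ.apply hk1)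

/-- Every positive zero is simple, so the sign changes at each of them. -/
theorem IsSolOn.sign_nodal (h : P.IsSolOn (Ioi 0) w p)
    (hlim : Tendsto w (𝓝[>] 0) (𝓝 s)) (hs : s ≠ 0) (hZ : IsNodalSequence w Z) (k : ℕ) :
    ∀ r ∈ Ioo (Z k) (Z (k + 1)), 0 < s * (-1) ^ k * w r := by
  have hcont : ∀ k, ContinuousOn (fun r => s * (-1) ^ k * w r) (Ioo (Z k) (Z (k + 1))) :=
    fun k r hr => (continuousAt_const.mul
      (h.continuousAt_fst ((hZ.nonneg k).trans_lt hr.1))).continuousWithinAt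
  have hsk : ∀ k : ℕ, s * (-1) ^ k ≠ 0 := fun k => mul_ne_zero hs (pow_ne_zero _ (by norm_num))
  have hne : ∀ k, ∀ r ∈ Ioo (Z k) (Z (k + 1)), s * (-1) ^ k * w r ≠ 0 := fun k r hr =>
    mul_ne_zero (hsk k) (hZ.ne_zero k r hr)
  induction k with
  | zero =>
    have h1 : Tendsto (fun r => s * (-1) ^ 0 * w r) (𝓝[>] 0) (𝓝 (s * (-1) ^ 0 * s)) :=
      hlim.const_mul _
    have h2 : 0 < s * (-1) ^ 0 * s := by
      rw [pow_zero, mul_one]; exact mul_self_pos.2 hs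
    have h3 : ∀ᶠ t in 𝓝[>] (0 : ℝ), t ∈ Ioo (Z 0) (Z (0 + 1)) := by
      rw [hZ.zero]; exact Ioo_mem_nhdsGT (hZ.pos le_rfl)
    obtain ⟨t, ht, ht'⟩ := ((h1.eventually (lt_mem_nhds h2)).and h3).exists
    exact pos_on_Ioo_of_ne_zero (hcont 0) (hne 0) ht' ht
  | succ k ih =>
    have hd0 : 0 < Z (k + 1) := hZ.pos (by omega)
    have hpd : p (Z (k + 1)) ≠ 0 := by
      simpa [hZ.apply_succ k] using h.nondegenerate hlim hs _ hd0
    have hder := (h _ hd0).1.const_mul (s * (-1) ^ k)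
    have hneg := deriv_neg_of_pos_left hder
      (mul_ne_zero (hsk k) (mt P.vel_eq_zero_iff.1 hpd)) (hZ.lt_succ k) ih
      (by rw [hZ.apply_succ, mul_zero])
    have h2 : ∀ᶠ t in 𝓝[>] Z (k + 1), slope (fun r => s * (-1) ^ k * w r) (Z (k + 1)) t < 0 :=
      ((hasDerivAt_iff_tendsto_slope.1 hder).mono_left
        (nhdsWithin_mono _ fun t (ht : Z (k + 1) < t) => ht.ne')).eventually (gt_mem_nhds hneg)
    obtain ⟨t, ht, ht'⟩ := (h2.and (Ioo_mem_nhdsGT (hZ.lt_succ (k + 1)))).exists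
    refine pos_on_Ioo_of_ne_zero (hcont (k + 1)) (hne (k + 1)) ht' ?_
    rw [slope_def_field, hZ.apply_succ, mul_zero, sub_zero,
      div_lt_iff₀ (sub_pos.2 ht'.1), zero_mul] at ht
    rw [pow_succ]; linarith

/-- The zeros of solutions of opposite initial signs interlace. -/
theorem IsSolOn.nodal_interlace {w₁ w₂ p₁ p₂ : ℝ → ℝ} {Z₁ Z₂ : ℕ → ℝ}
    (h1 : P.IsSolOn (Ioi 0) w₁ p₁) (h2 : P.IsSolOn (Ioi 0) w₂ p₂)
    (hs : s = 1 ∨ s = -1) (hlim1 : Tendsto w₁ (𝓝[>] 0) (𝓝 s))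
    (hlim2 : Tendsto w₂ (𝓝[>] 0) (𝓝 (-s))) (hZ1 : IsNodalSequence w₁ Z₁)
    (hZ2 : IsNodalSequence w₂ Z₂) (k : ℕ) : Z₂ k < Z₁ (k + 1) := by
  have hs0 : s ≠ 0 := by rcases hs with rfl | rfl <;> norm_num
  induction k with
  | zero => rw [hZ2.zero]; exact hZ1.pos le_rfl
  | succ k ih =>
    by_contra! hle
    have hc : 0 < Z₁ (k + 1) := hZ1.pos (by omega)
    have g1 := h1.sign_nodal hlim1 hs0 hZ1 (k + 1)
    -- If interlacing failed, this nodal interval of w₁ would lie inside the k-th one of w₂. The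
    -- opposite initial sign compensates for the index shift, so both functions have the same sign
    -- there.
    have g2 : ∀ r ∈ Ico (Z₁ (k + 1)) (Z₁ (k + 1 + 1)), 0 < s * (-1) ^ (k + 1) * w₂ r := by
      intro r hr
      have := h2.sign_nodal hlim2 (neg_ne_zero.2 hs0) hZ2 k r
        ⟨ih.trans_le hr.1, hr.2.trans_le hle⟩
      rw [pow_succ]; linarith
    have hσ : s * (-1) ^ (k + 1) = 1 ∨ s * (-1) ^ (k + 1) = -1 := by
      rcases hs with rfl | rfl <;> rcases neg_one_pow_eq_or ℝ (k + 1) with h | h <;> rw [h] <;>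
        norm_num
    rcases hσ with h | h
    · rw [h] at g1 g2
      exact h1.sturm h2 hc (hZ1.lt_succ _) (hZ1.apply_succ _) (hZ1.apply_succ _)
        (by simpa using g1) (by simpa using g2)
    · rw [h] at g1 g2
      exact h1.neg.sturm h2.neg hc (hZ1.lt_succ _) (by simp [hZ1.apply_succ])
        (by simp [hZ1.apply_succ]) (by simpa using g1) (by simpa using g2)

end RadialParams

/-! ### Restriction, scaling and uniqueness of regular radial solutions -/

section

variable {N : ℕ} {α a A μ : ℝ} {I : Set ℝ} {u : ℝ → ℝ}

theorem IsRadialSolution.inter_Iio (h : IsRadialSolution N α a A μ I u) {R : ℝ} (hR : 0 < R) :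
    IsRadialSolution N α a A μ (I ∩ Iio R) u where
  contDiffOn := h.contDiffOn.mono inter_subset_left
  deriv_zero := by rw [derivWithin_inter (Iio_mem_nhds hR), h.deriv_zero]
  equation := fun r hr => h.equation r hr.1
  locally_const := fun r hr => h.locally_const r hr.1

theorem IsRadialSolution.restrict_Ico (h : IsRadialSolution N α a A μ (Ici 0) u) {R : ℝ}
    (hR : 0 < R) : IsRadialSolution N α a A μ (Ico 0 R) u := by
  rw [← Ici_inter_Iio]; exact h.inter_Iio hR

theorem radialOp_scale {c κ : ℝ} (hc : 0 < c) (hκ : 0 < κ) (r p q : ℝ) :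
    radialOp N α a A r (c * κ * p) (c * κ ^ 2 * q)
      = c ^ (α + 1) * κ ^ (α + 2) * radialOp N α a A (κ * r) p q := by
  rw [radialOp, radialOp, pucci_mul_of_nonneg (by positivity), pucci_mul_of_nonneg (by positivity),
    abs_mul, abs_of_pos (mul_pos hc hκ), Real.mul_rpow (by positivity) (abs_nonneg _),
    Real.mul_rpow hc.le hκ.le, Real.rpow_add_one hc.ne', Real.rpow_add hκ, Real.rpow_two]
  -- At r = 0 the division by zero yields 0 on both sides.
  rcases eq_or_ne r 0 with rfl | hr
  · simp; ring
  · field_simp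

theorem IsRadialSolution.scale (h : IsRadialSolution N α a A μ I u) (h0 : 0 ∈ I) {c κ : ℝ}
    (hc : 0 < c) (hκ : 0 < κ) :
    IsRadialSolution N α a A (μ * κ ^ (α + 2)) {r | κ * r ∈ I} (fun r => c * u (κ * r)) := by
  have hd1 : deriv (fun r => c * u (κ * r)) = fun r => c * κ * deriv u (κ * r) := by
    ext r
    rw [deriv_const_mul_field, deriv_comp_mul_left, smul_eq_mul, mul_assoc]
  have hd2 : ∀ r, deriv (fun r => c * κ * deriv u (κ * r)) r
      = c * κ ^ 2 * deriv (deriv u) (κ * r) := by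
    intro r
    rw [deriv_const_mul_field, deriv_comp_mul_left κ (deriv u), smul_eq_mul]; ring
  have hmaps : MapsTo (fun r => κ * r) {r | κ * r ∈ I} I := fun r hr => hr
  have hscale : ∀ x : ℝ, |c * x| ^ α * (c * x) = c ^ (α + 1) * (|x| ^ α * x) := by
    intro x
    rw [abs_mul, abs_of_pos hc, Real.mul_rpow hc.le (abs_nonneg _), Real.rpow_add_one hc.ne']; ring
  refine ⟨?_, ?_, ?_, ?_⟩
  · exact contDiffOn_const.mul (h.contDiffOn.comp (contDiff_const.mul contDiff_id).contDiffOn hmaps)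
  · by_cases hun : UniqueDiffWithinAt ℝ {r | κ * r ∈ I} 0
    · have h1 : HasDerivWithinAt u 0 I (κ * 0) := by
        have := (h.contDiffOn.differentiableOn (by norm_num) 0 h0).hasDerivWithinAt
        rw [h.deriv_zero] at this
        rwa [mul_zero]
      have h2 : HasDerivWithinAt (fun r => κ * r) (κ * 1) {r | κ * r ∈ I} 0 :=
        ((hasDerivAt_id (0 : ℝ)).const_mul κ).hasDerivWithinAt
      have h3 := (HasDerivWithinAt.comp 0 h1 h2 hmaps).const_mul c
      rw [zero_mul, mul_zero] at h3
      exact h3.derivWithin hun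
    -- Without unique differentiability `derivWithin` has the default value 0.
    · exact derivWithin_zero_of_not_uniqueDiffWithinAt hun
  · intro r hr hr0 hne
    rw [hd1] at hne ⊢
    obtain ⟨h1, h2⟩ := h.equation (κ * r) hr (mul_pos hκ hr0) (right_ne_zero_of_mul hne)
    refine ⟨?_, ?_⟩
    · exact contDiffAt_const.mul (ContDiffAt.comp r h1 (contDiff_const.mul contDiff_id).contDiffAt)
    · rw [hd2, radialOp_scale hc hκ, hscale]
      linear_combination c ^ (α + 1) * κ ^ (α + 2) * h2
  · intro r hr hr0 hconst
    have h1 : ∀ᶠ x in 𝓝 (κ * r), u x = u (κ * r) := by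
      have ht : Tendsto (fun x => x / κ) (𝓝 (κ * r)) (𝓝 r) := by
        have := (continuous_id.div_const κ).tendsto (κ * r)
        simpa [mul_div_cancel_left₀ _ hκ.ne'] using this
      filter_upwards [ht.eventually hconst] with x hx
      rw [mul_div_cancel₀ _ hκ.ne'] at hx
      exact mul_left_cancel₀ hc.ne' hx
    have h2 := h.locally_const (κ * r) hr (mul_pos hκ hr0) h1
    rw [hscale]
    linear_combination c ^ (α + 1) * κ ^ (α + 2) * h2

end

namespace RadialParams

variable {P : RadialParams} {N : ℕ} {w v : ℝ → ℝ} {s μ : ℝ}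

theorem eqOn_of_isRadialSolution (hν : P.ν = (N : ℝ) - 1) {R : ℝ} (hR : 0 < R)
    (hw : IsRadialSolution N P.α P.a P.A 1 (Ico 0 R) w)
    (hv : IsRadialSolution N P.α P.a P.A 1 (Ico 0 R) v) (h0 : w 0 = v 0) (hne : v 0 ≠ 0) :
    EqOn w v (Ico 0 R) := by
  have h1 := tendsto_nhdsGT_of_isRadialSolution hR hw
  rw [h0] at h1
  have := (isSolOn_of_isRadialSolution hν hw (h0 ▸ hne)).eqOn_of_tendsto hR
    (isSolOn_of_isRadialSolution hν hv hne) hne h1 (tendsto_nhdsGT_of_isRadialSolution hR hv)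
    (tendsto_mom_deriv_zero hR hw) (tendsto_mom_deriv_zero hR hv)
  intro r hr
  rcases hr.1.eq_or_lt with rfl | h
  · exact h0
  · exact (this r ⟨h, hr.2⟩).1

/-- There is no regular radial solution with boundary value zero when `μ ≤ 0`. -/
theorem false_of_nonpos_of_pos (hν : P.ν = (N : ℝ) - 1)
    (hv : IsRadialSolution N P.α P.a P.A μ (Ico 0 1) v) (hc : ContinuousOn v (Icc 0 1))
    (h1 : v 1 = 0) (h0 : 0 < v 0) (hμ : μ ≤ 0) : False := by
  have hcl : IsClosed (Icc (0 : ℝ) 1 ∩ v ⁻¹' {0}) :=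
    hc.preimage_isClosed_of_isClosed isClosed_Icc isClosed_singleton
  have hbb : BddBelow (Icc (0 : ℝ) 1 ∩ v ⁻¹' {0}) := ⟨0, fun t ht => ht.1.1⟩
  have hb : sInf (Icc (0 : ℝ) 1 ∩ v ⁻¹' {0}) ∈ Icc (0 : ℝ) 1 ∩ v ⁻¹' {0} :=
    hcl.csInf_mem ⟨1, by simp, h1⟩ hbb
  set b := sInf (Icc (0 : ℝ) 1 ∩ v ⁻¹' {0})
  have hvb : v b = 0 := hb.2
  have hb0 : 0 < b := by
    refine lt_of_le_of_ne hb.1.1 ?_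
    intro h
    rw [← h] at hvb
    exact h0.ne' hvb
  have hne : ∀ r ∈ Ico 0 b, v r ≠ 0 := fun r hr h =>
    notMem_of_lt_csInf hr.2 hbb ⟨⟨hr.1, hr.2.le.trans hb.1.2⟩, h⟩
  have hpos : ∀ r ∈ Ico 0 b, 0 < v r := by
    intro r hr
    by_contra! hle
    obtain ⟨t, ht, ht0⟩ := intermediate_value_Icc' hr.1
      (hc.mono (Icc_subset_Icc le_rfl (hr.2.le.trans hb.1.2))) ⟨hle, h0.le⟩
    exact hne t ⟨ht.1, ht.2.trans_lt hr.2⟩ ht0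
  -- Falling from v(0) > 0 to the first zero b, v has a negative derivative at some x.
  obtain ⟨x, hx, hxd⟩ := exists_hasDerivAt_eq_slope v (deriv v) hb0
    (hc.mono (Icc_subset_Icc le_rfl hb.1.2))
    fun t ht => hv.hasDerivAt ⟨ht.1, ht.2.trans_le hb.1.2⟩
  have hdx : deriv v x < 0 := by
    rw [hxd, hvb]; exact div_neg_of_neg_of_pos (by linarith) (by linarith)
  have hx1 : x < 1 := hx.2.trans_le hb.1.2
  set g := derivWithin v (Ico 0 1) with hg
  have hgc : ContinuousOn g (Icc 0 x) :=
    (hv.contDiffOn.continuousOn_derivWithin (uniqueDiffOn_Ico 0 1) le_rfl).mono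
      (Icc_subset_Ico_right hx1)
  have hgd : ∀ t ∈ Ioo (0 : ℝ) 1, g t = deriv v t := fun t ht =>
    derivWithin_of_mem_nhds (Ico_mem_nhds ht.1 ht.2)
  have hScl : IsClosed (Icc 0 x ∩ g ⁻¹' Ici 0) :=
    hgc.preimage_isClosed_of_isClosed isClosed_Icc isClosed_Ici
  have hSb : BddAbove (Icc 0 x ∩ g ⁻¹' Ici 0) := ⟨x, fun t ht => ht.1.2⟩
  -- The last point c before x with nonnegative derivative exists because v'(0) = 0.
  have hmem : sSup (Icc 0 x ∩ g ⁻¹' Ici 0) ∈ Icc 0 x ∩ g ⁻¹' Ici 0 :=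
    hScl.csSup_mem ⟨0, ⟨le_rfl, hx.1.le⟩, hv.deriv_zero.ge⟩ hSb
  set c := sSup (Icc 0 x ∩ g ⁻¹' Ici 0)
  have hgc0 : 0 ≤ g c := hmem.2
  have hcx : c < x := by
    refine lt_of_le_of_ne hmem.1.2 fun h => ?_
    rw [h, hgd x ⟨hx.1, hx1⟩] at hgc0
    linarith
  have hneg : ∀ t ∈ Ioo c x, t ∈ Ioo (0 : ℝ) 1 ∧ g t < 0 := by
    intro t ht
    refine ⟨⟨hmem.1.1.trans_lt ht.1, ht.2.trans hx1⟩, ?_⟩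
    by_contra! hle
    exact absurd (le_csSup hSb ⟨⟨hmem.1.1.trans ht.1.le, ht.2.le⟩, hle⟩) (not_le.2 ht.1)
  have hder : ∀ t ∈ Ioo c x, HasDerivAt (fun t => P.mom (g t)) ((P.α + 1) * pucci P.a⁻¹ P.A⁻¹
      (-(μ * P.mom (v t)) - P.ν / t * pucci P.a P.A (P.mom (deriv v t)))) t := by
    intro t ht
    obtain ⟨ht1, ht2⟩ := hneg t ht
    rw [hgd t ht1] at ht2
    obtain ⟨e1, e2⟩ := hv.equation t ⟨ht1.1.le, ht1.2⟩ ht1.1 ht2.ne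
    refine (hasDerivAt_mom_of_equation' hν ht2.ne e1 e2).congr_of_eventuallyEq ?_
    filter_upwards [Ioo_mem_nhds ht1.1 ht1.2] with y hy
    rw [hgd y hy]
  -- On (c, x), v > 0, v' < 0 and μ ≤ 0 make both terms of the momentum equation nonnegative; so the
  -- momentum cannot fall from a nonnegative value at c to a negative one at x.
  have hmono : MonotoneOn (fun t => P.mom (g t)) (Icc c x) := by
    refine monotoneOn_of_deriv_nonneg (convex_Icc c x)
      (P.continuous_mom.comp_continuousOn (hgc.mono (Icc_subset_Icc_left hmem.1.1))) ?_ ?_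
    · rw [interior_Icc]
      exact fun t ht => (hder t ht).differentiableAt.differentiableWithinAt
    · rw [interior_Icc]
      intro t ht
      obtain ⟨ht1, ht2⟩ := hneg t ht
      rw [(hder t ht).deriv]
      rw [hgd t ht1] at ht2
      refine mul_nonneg P.α_add_one_pos.le
        (pucci_nonneg (inv_pos.2 P.a_pos) (inv_pos.2 P.A_pos) ?_)
      have e1 := pucci_nonpos P.a_pos P.A_pos (P.mom_neg_iff.2 ht2).le
      have e2 := P.mom_pos_iff.2 (hpos t ⟨ht1.1.le, ht.2.trans hx.2⟩)
      have e3 := mul_nonpos_of_nonneg_of_nonpos (div_nonneg P.ν_nonneg ht1.1.le) e1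
      have e4 := mul_nonpos_of_nonpos_of_nonneg hμ e2.le
      linarith
  have h3 := hmono (left_mem_Icc.2 hcx.le) (right_mem_Icc.2 hcx.le) hcx.le
  have h4 : 0 ≤ P.mom (g c) := signedPow_nonneg hgc0
  rw [← hgd x ⟨hx.1, hx1⟩] at hdx
  have h5 := P.mom_neg_iff.2 hdx
  simp only at h3
  linarith

theorem pos_of_isRadialEigenfunction (hν : P.ν = (N : ℝ) - 1)
    (hv : IsRadialEigenfunction N P.α P.a P.A μ v) (h0 : v 0 ≠ 0) : 0 < μ := by
  by_contra! hμ
  rcases lt_or_gt_of_ne h0 with h | h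
  · exact false_of_nonpos_of_pos (P := P.swap) hν hv.solution.neg hv.continuousOn.neg
      (by simp [hv.boundary]) (by simpa using h) hμ
  · exact false_of_nonpos_of_pos hν hv.solution hv.continuousOn hv.boundary h hμ

/-! ### The profiles and the half-eigenvalues -/

theorem exists_isProfile (hν : P.ν = (N : ℝ) - 1) (hs : s = 1 ∨ s = -1) :
    ∃ w, IsProfile N P.α P.a P.A s w := by
  rcases hs with rfl | rfl
  · obtain ⟨u, p, h, hu, hp⟩ := P.exists_global
    exact ⟨_, h.isRadialSolution hν hu hp, by simp⟩
  · obtain ⟨u, p, h, hu, hp⟩ := P.swap.exists_global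
    exact ⟨_, h.neg.isRadialSolution (P := P) hν hu.neg (by simpa using hp.neg), by simp⟩

theorem isProfile_profile (hν : P.ν = (N : ℝ) - 1) (hs : s = 1 ∨ s = -1) :
    IsProfile N P.α P.a P.A s (profile N P.α P.a P.A s) :=
  Classical.epsilon_spec (exists_isProfile hν hs)

theorem _root_.IsProfile.isSolOn (hν : P.ν = (N : ℝ) - 1) (hs : s ≠ 0)
    (hw : IsProfile N P.α P.a P.A s w) :
    P.IsSolOn (Ioi 0) w (fun x => P.mom (deriv w x)) ∧ Tendsto w (𝓝[>] 0) (𝓝 s) := by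
  constructor
  · intro r hr
    have hr : 0 < r := hr
    exact isSolOn_of_isRadialSolution hν (hw.1.restrict_Ico (R := r + 1) (by linarith))
      (by rwa [hw.2]) r ⟨hr, by linarith⟩
  · have := tendsto_nhdsGT_of_isRadialSolution one_pos (hw.1.restrict_Ico one_pos)
    rwa [hw.2] at this

theorem isNodalSequence_profileZero (hν : P.ν = (N : ℝ) - 1) (hs : s = 1 ∨ s = -1) :
    IsNodalSequence (profile N P.α P.a P.A s) (profileZero N P.α P.a P.A s) := by
  have hs0 : s ≠ 0 := by rcases hs with rfl | rfl <;> norm_num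
  obtain ⟨h1, h2⟩ := (isProfile_profile hν hs).isSolOn hν hs0
  exact h1.isNodalSequence h2 hs0 rfl fun _ => rfl

theorem _root_.IsProfile.eqOn (hν : P.ν = (N : ℝ) - 1) (hs : s ≠ 0)
    (hw : IsProfile N P.α P.a P.A s w) (hv : IsProfile N P.α P.a P.A s v) :
    EqOn w v (Ici 0) := by
  intro r hr
  have hr : 0 ≤ r := hr
  exact eqOn_of_isRadialSolution hν (R := r + 1) (by linarith) (hw.1.restrict_Ico (by linarith))
    (hv.1.restrict_Ico (by linarith)) (by rw [hw.2, hv.2]) (by rwa [hv.2]) ⟨hr, by linarith⟩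

theorem _root_.IsRadialEigenfunction.isRadialSolution_scale {α a A : ℝ} {κ c : ℝ} (hκ : 0 < κ)
    (hc : 0 < c) (hv : IsRadialEigenfunction N α a A (κ ^ (α + 2)) v) :
    IsRadialSolution N α a A 1 (Ico 0 κ) (fun r => c * v (κ⁻¹ * r)) := by
  have h := hv.solution.scale (by simp) hc (inv_pos.2 hκ)
  have e1 : κ ^ (α + 2) * κ⁻¹ ^ (α + 2) = 1 := by
    rw [← Real.mul_rpow hκ.le (inv_pos.2 hκ).le, mul_inv_cancel₀ hκ.ne', Real.one_rpow]
  have e2 : {r | κ⁻¹ * r ∈ Ico (0 : ℝ) 1} = Ico 0 κ := by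
    ext r
    simp only [mem_ofPred_eq, mem_Ico]
    rw [inv_mul_lt_iff₀ hκ, mul_one, mul_nonneg_iff_of_pos_left (inv_pos.2 hκ)]
  rwa [e1, e2] at h

/-- With v(0) = v'(0) = 0 the rescaled solution vanishes identically by the forward energy estimate.
-/
theorem apply_zero_ne_zero_of_isRadialEigenfunction (hν : P.ν = (N : ℝ) - 1) {κ : ℝ} (hκ : 0 < κ)
    (hv : IsRadialEigenfunction N P.α P.a P.A (κ ^ (P.α + 2)) v) : v 0 ≠ 0 := by
  intro h0
  obtain ⟨r, hr, hne⟩ := hv.nontrivial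
  have := eq_zero_of_isRadialSolution hν (hv.isRadialSolution_scale hκ one_pos) (by simp [h0])
    (κ * r) ⟨mul_nonneg hκ.le hr.1, by nlinarith [hr.2]⟩
  rw [one_mul, inv_mul_cancel_left₀ hκ.ne'] at this
  exact hne this

/-- A regular radial eigenfunction is a multiple of a rescaled profile. -/
theorem eq_smul_profile_of_isRadialEigenfunction (hν : P.ν = (N : ℝ) - 1)
    (hs : s = 1 ∨ s = -1) {κ : ℝ} (hκ : 0 < κ)
    (hv : IsRadialEigenfunction N P.α P.a P.A (κ ^ (P.α + 2)) v) (h0 : 0 < s * v 0) :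
    ∀ r ∈ Icc (0 : ℝ) 1, v r = |v 0| * profile N P.α P.a P.A s (κ * r) := by
  have hw := isProfile_profile (P := P) hν hs
  set w := profile N P.α P.a P.A s
  have hv0 : v 0 ≠ 0 := right_ne_zero_of_mul h0.ne'
  have habs : 0 < |v 0| := abs_pos.2 hv0
  have hsv : |v 0|⁻¹ * v 0 = s := by
    rcases hs with rfl | rfl
    · rw [one_mul] at h0
      rw [abs_of_pos h0, inv_mul_cancel₀ hv0]
    · have : v 0 < 0 := by linarith
      rw [abs_of_neg this]; field_simp
  have hs0 : s ≠ 0 := by rcases hs with rfl | rfl <;> norm_num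
  have heq := eqOn_of_isRadialSolution hν hκ
    (hv.isRadialSolution_scale hκ (inv_pos.2 habs)) (hw.1.restrict_Ico hκ)
    (by simp only [mul_zero]; rw [hsv, hw.2]) (by rwa [hw.2])
  have hlt : ∀ r ∈ Ico (0 : ℝ) 1, v r = |v 0| * w (κ * r) := by
    intro r hr
    have := heq (x := κ * r) ⟨mul_nonneg hκ.le hr.1, by nlinarith [hr.2]⟩
    simp only [inv_mul_cancel_left₀ hκ.ne'] at this
    rw [← this, mul_inv_cancel_left₀ habs.ne']
  have hwc : ContinuousOn (fun r => |v 0| * w (κ * r)) (Icc 0 1) :=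
    continuousOn_const.mul (hw.1.contDiffOn.continuousOn.comp
      (continuous_const.mul continuous_id).continuousOn fun r hr => mul_nonneg hκ.le hr.1)
  -- The equation is available only on [0, 1); the identity reaches r = 1 by continuity of both
  -- sides.
  have hcl : closure (Ico (0 : ℝ) 1) = Icc 0 1 := closure_Ico zero_ne_one
  have := EqOn.of_subset_closure (s := Ico (0 : ℝ) 1) (t := Icc (0 : ℝ) 1) hlt hv.continuousOn hwc
    Ico_subset_Icc_self hcl.ge
  exact fun r hr => this hr

theorem encard_interiorZeros_halfEigenfunction (hν : P.ν = (N : ℝ) - 1) (hs : s = 1 ∨ s = -1)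
    {k : ℕ} (hk : 1 ≤ k) :
    (interiorZeros (halfEigenfunction N P.α P.a P.A s k)).encard + 1 = k := by
  have hs0 : s ≠ 0 := by rcases hs with rfl | rfl <;> norm_num
  obtain ⟨h1, h2⟩ := (isProfile_profile (P := P) hν hs).isSolOn hν hs0
  have hZ := isNodalSequence_profileZero (P := P) hν hs
  have hZk := hZ.pos hk
  have heq : interiorZeros (halfEigenfunction N P.α P.a P.A s k) =
      (fun j => profileZero N P.α P.a P.A s j / profileZero N P.α P.a P.A s k) ''
        (Finset.Ico 1 k : Set ℕ) := by
    ext r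
    simp only [interiorZeros, halfEigenfunction, mem_ofPred_eq, mem_image, Finset.coe_Ico, mem_Ico,
      mem_Ioo]
    constructor
    · rintro ⟨⟨hr0, hr1⟩, hr⟩
      obtain ⟨j, hj, hjr⟩ := h1.exists_eq_of_zero h2 hs0 hZ (mul_pos hZk hr0) hr
      refine ⟨j, ⟨hj, ?_⟩, by rw [hjr]; field_simp⟩
      rw [← hZ.strictMono.lt_iff_lt, hjr]
      nlinarith
    · rintro ⟨j, ⟨hj, hjk⟩, rfl⟩
      refine ⟨⟨div_pos (hZ.pos hj) hZk, (div_lt_one hZk).2 (hZ.strictMono hjk)⟩, ?_⟩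
      rw [mul_div_cancel₀ _ hZk.ne']
      exact hZ.apply hj
  have hinj : Function.Injective
      (fun j => profileZero N P.α P.a P.A s j / profileZero N P.α P.a P.A s k) := fun i j hij =>
    hZ.strictMono.injective ((div_left_inj' hZk.ne').1 hij)
  rw [heq, hinj.encard_image, Set.encard_coe_eq_coe_finsetCard, Nat.card_Ico]
  exact_mod_cast Nat.sub_add_cancel hk

theorem isRadialEigenfunction_halfEigenfunction (hν : P.ν = (N : ℝ) - 1) (hs : s = 1 ∨ s = -1)
    {k : ℕ} (hk : 1 ≤ k) :
    IsRadialEigenfunction N P.α P.a P.A (halfEigenvalue N P.α P.a P.A s k)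
      (halfEigenfunction N P.α P.a P.A s k) := by
  have hs0 : s ≠ 0 := by rcases hs with rfl | rfl <;> norm_num
  have hw := isProfile_profile (P := P) hν hs
  have hZ := isNodalSequence_profileZero (P := P) hν hs
  have hZk := hZ.pos hk
  have h1 := hw.1.scale self_mem_Ici one_pos hZk
  have e2 : {r | profileZero N P.α P.a P.A s k * r ∈ Ici (0 : ℝ)} = Ici 0 := by
    ext r
    simp only [mem_ofPred_eq, mem_Ici]
    rw [mul_nonneg_iff_of_pos_left hZk]
  simp only [one_mul] at h1
  rw [e2] at h1
  exact
    { solution := h1.restrict_Ico one_pos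
      continuousOn := h1.contDiffOn.continuousOn.mono Icc_subset_Ici_self
      boundary := by rw [halfEigenfunction, mul_one]; exact hZ.apply hk
      nontrivial := ⟨0, by simp, by rw [halfEigenfunction, mul_zero, hw.2]; exact hs0⟩ }

/-- Positivity of μ permits the root κ = μ^(1/(α+2)). The boundary condition makes κ some profile
zero with index j, and the count of interior zeros gives j = k. -/
theorem eq_halfEigenvalue_of_encard (hν : P.ν = (N : ℝ) - 1) (hs : s = 1 ∨ s = -1) {k : ℕ}
    (hv : IsRadialEigenfunction N P.α P.a P.A μ v) (h0 : 0 < s * v 0)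
    (hk : (interiorZeros v).encard + 1 = k) : μ = halfEigenvalue N P.α P.a P.A s k := by
  have hs0 : s ≠ 0 := by rcases hs with rfl | rfl <;> norm_num
  obtain ⟨h1, h2⟩ := (isProfile_profile (P := P) hν hs).isSolOn hν hs0
  have hZ := isNodalSequence_profileZero (P := P) hν hs
  have hv0 : v 0 ≠ 0 := right_ne_zero_of_mul h0.ne'
  have hμ := pos_of_isRadialEigenfunction hν hv hv0
  have hα2 : P.α + 2 ≠ 0 := by linarith [P.neg_one_lt_α]
  obtain ⟨κ, hκ, rfl⟩ : ∃ κ : ℝ, 0 < κ ∧ κ ^ (P.α + 2) = μ :=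
    ⟨μ ^ (P.α + 2)⁻¹, Real.rpow_pos_of_pos hμ _, by
      rw [← Real.rpow_mul hμ.le, inv_mul_cancel₀ hα2, Real.rpow_one]⟩
  have heq := eq_smul_profile_of_isRadialEigenfunction hν hs hκ hv h0
  have hwκ : profile N P.α P.a P.A s κ = 0 := by
    have := heq 1 (by simp)
    rw [hv.boundary, mul_one] at this
    exact (mul_eq_zero.1 this.symm).resolve_left (abs_pos.2 hv0).ne'
  obtain ⟨j, hj, rfl⟩ := h1.exists_eq_of_zero h2 hs0 hZ hκ hwκ
  have hzeros : interiorZeros v = interiorZeros (halfEigenfunction N P.α P.a P.A s j) := by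
    ext r
    simp only [interiorZeros, mem_ofPred_eq]
    refine and_congr_right fun hr => ?_
    rw [heq r (Ioo_subset_Icc_self hr), halfEigenfunction, mul_eq_zero]
    simp [hv0]
  rw [hzeros, encard_interiorZeros_halfEigenfunction hν hs hj] at hk
  have hjk : j = k := by exact_mod_cast hk
  rw [hjk, halfEigenvalue]

/-- Interlacing of the zeros passes through the increasing map x ↦ x^(α+2). -/
theorem halfEigenvalue_lt (hν : P.ν = (N : ℝ) - 1) (hs : s = 1 ∨ s = -1) (k : ℕ) :
    halfEigenvalue N P.α P.a P.A (-s) k < halfEigenvalue N P.α P.a P.A s (k + 1) := by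
  have hs' : -s = 1 ∨ -s = -1 := by rcases hs with rfl | rfl <;> simp
  have hs0 : s ≠ 0 := by rcases hs with rfl | rfl <;> norm_num
  obtain ⟨h1, h2⟩ := (isProfile_profile (P := P) hν hs).isSolOn hν hs0
  obtain ⟨h3, h4⟩ := (isProfile_profile (P := P) hν hs').isSolOn hν (neg_ne_zero.2 hs0)
  have hZ := isNodalSequence_profileZero (P := P) hν hs
  have hZ' := isNodalSequence_profileZero (P := P) hν hs'
  exact Real.rpow_lt_rpow (hZ'.nonneg k) (h1.nodal_interlace h3 hs h2 h4 hZ hZ' k)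
    (by linarith [P.neg_one_lt_α])

end RadialParams

/-! ### The theorem -/

theorem mainTheorem5 (N : ℕ) (hN : 1 ≤ N) (α a A : ℝ) (hα : -1 < α) (ha : 0 < a) (haA : a ≤ A) :
    (∀ s : ℝ, s = 1 ∨ s = -1 →
      -- the functions `w^±` exist and are unique, and `β_1^± < β_2^± < …` are all their zeros
      IsProfile N α a A s (profile N α a A s) ∧
      (∀ w, IsProfile N α a A s w → EqOn w (profile N α a A s) (Ici 0)) ∧
      StrictMono (profileZero N α a A s) ∧
      profileZero N α a A s '' Ici 1 = {r | 0 < r ∧ profile N α a A s r = 0} ∧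
      ∀ k : ℕ, 1 ≤ k →
        -- `u_k^±` is an eigenfunction for `μ_k^±` with `k - 1` interior zeros
        (IsRadialEigenfunction N α a A (halfEigenvalue N α a A s k)
            (halfEigenfunction N α a A s k) ∧
          0 < s * halfEigenfunction N α a A s k 0 ∧
          (interiorZeros (halfEigenfunction N α a A s k)).encard + 1 = k) ∧
        -- uniqueness among the eigenfunctions for the eigenvalue `μ_k^±`
        (∀ v, IsRadialEigenfunction N α a A (halfEigenvalue N α a A s k) v →
          v 0 ≠ 0 ∧
          (0 < s * v 0 → ∃ c : ℝ, 0 < c ∧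
            ∀ r ∈ Icc (0 : ℝ) 1, v r = c * halfEigenfunction N α a A s k r)) ∧
        -- uniqueness among the eigenfunctions with `k - 1` interior zeros
        (∀ μ v, IsRadialEigenfunction N α a A μ v → 0 < s * v 0 →
          (interiorZeros v).encard + 1 = k →
          μ = halfEigenvalue N α a A s k ∧
          ∃ c : ℝ, 0 < c ∧ ∀ r ∈ Icc (0 : ℝ) 1, v r = c * halfEigenfunction N α a A s k r)) ∧
    (∀ k : ℕ, 1 ≤ k →
      halfEigenvalue N α a A (-1) k < halfEigenvalue N α a A 1 (k + 1) ∧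
      halfEigenvalue N α a A 1 k < halfEigenvalue N α a A (-1) (k + 1)) := by
  let P : RadialParams := ⟨(N : ℝ) - 1, α, a, A, by
    have : (1 : ℝ) ≤ N := by exact_mod_cast hN
    linarith, hα, ha, ha.trans_le haA⟩
  have hν : P.ν = (N : ℝ) - 1 := rfl
  refine ⟨fun s hs => ?_, fun k _ => ⟨?_, ?_⟩⟩
  · have hs0 : s ≠ 0 := by rcases hs with rfl | rfl <;> norm_num
    have hw : IsProfile N α a A s (profile N α a A s) := RadialParams.isProfile_profile (P := P) hν hs
    have hZ : IsNodalSequence (profile N α a A s) (profileZero N α a A s) :=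
      RadialParams.isNodalSequence_profileZero (P := P) hν hs
    obtain ⟨h1, h2⟩ := IsProfile.isSolOn (P := P) hν hs0 hw
    have huniq : ∀ k, 1 ≤ k → ∀ v, IsRadialEigenfunction N α a A (halfEigenvalue N α a A s k) v →
        0 < s * v 0 → ∃ c : ℝ, 0 < c ∧
          ∀ r ∈ Icc (0 : ℝ) 1, v r = c * halfEigenfunction N α a A s k r := fun k hk v hv h0 =>
      ⟨|v 0|, abs_pos.2 (right_ne_zero_of_mul h0.ne'),
        RadialParams.eq_smul_profile_of_isRadialEigenfunction (P := P) hν hs (hZ.pos hk) hv h0⟩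
    refine ⟨hw, fun v hv => IsProfile.eqOn (P := P) hν hs0 hv hw, hZ.strictMono, ?_, fun k hk =>
      ⟨⟨RadialParams.isRadialEigenfunction_halfEigenfunction (P := P) hν hs hk, ?_,
        RadialParams.encard_interiorZeros_halfEigenfunction (P := P) hν hs hk⟩,
        fun v hv => ⟨RadialParams.apply_zero_ne_zero_of_isRadialEigenfunction (P := P) hν
          (hZ.pos hk) hv, huniq k hk v hv⟩, fun μ v hv h0 hcard => ?_⟩⟩
    · ext r
      constructor
      · rintro ⟨k, hk, rfl⟩
        exact ⟨hZ.pos hk, hZ.apply hk⟩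
      · rintro ⟨hr, hr0⟩
        exact h1.exists_eq_of_zero h2 hs0 hZ hr hr0
    · rw [halfEigenfunction, mul_zero, hw.2]
      exact mul_self_pos.2 hs0
    · have hμ := RadialParams.eq_halfEigenvalue_of_encard (P := P) hν hs hv h0 hcard
      exact ⟨hμ, huniq k hk v (hμ ▸ hv) h0⟩
  · exact RadialParams.halfEigenvalue_lt (P := P) hν (Or.inl rfl) k
  · have := RadialParams.halfEigenvalue_lt (P := P) hν (s := -1) (Or.inr rfl) k
    rwa [neg_neg] at this
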